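/- A matching multicut of a finite simple graph $G$ on $t$ parts is a partition $\{A_1,\dots,A_t\}$ of $V(G)$ into non-empty parts such that, for every $i$, each vertex of $A_i$ has at most one neighbour outside of $A_i$. In the problem Enum Matching Multicut, an instance is a pair $x=(G,\ell)$ of a graph $G$ and a non-negative integer $\ell$, and $\mathrm{Sol}(x)$ is the set of all matching multicuts of $G$ on at least $\ell$ parts. A graph is a co-cluster graph if each connected component of its complement is a clique of the complement. The parameter $\kappa(x)$ is the vertex-deletion distance of $G$ to co-cluster, that is, the least size of a set $U\subseteq V(G)$ such that $G-U$ is a co-cluster graph. A polynomial-delay enumeration kernel is a pair of algorithms $\mathcal A$ (the compressor) and $\mathcal A'$ (the lifting algorithm) such that: (i) given $(x,k)$ with $k=\kappa(x)$, $\mathcal A$ computes, in time polynomial in $|x|+k$, a pair $(x',k')$, where $x'$ is an instance of the same problem, $k'=\kappa(x')$, and $|x'|,k'\le g(k)$ for some computable function $g$; (ii) given $(x,k)$, $(x',k')$ and $s\in\mathrm{Sol}(x')$, $\mathcal A'$ enumerates, without repetition and with delay polynomial in $|x|+|x'|+k+k'$ (also before the first and after the last output), a non-empty set $S_s$, such that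 the sets $S_s$, $s\in\mathrm{Sol}(x')$, are pairwise disjoint and their union is $\mathrm{Sol}(x)$. Theorem. Enum Matching Multicut, parameterized by the vertex-deletion distance $k$ to co-cluster, admits a polynomial-delay enumeration kernel whose output graph has $O(k^2)$ vertices, i.e. at most $C\,(k^2+1)$ vertices for an absolute constant $C$. -/

import Mathlib

namespace EnumKernel

/-! ## Machine model

A while-language over binary trees. The cost of a step dominates the sizes of all trees that it
reads or builds, so that time is polynomially equivalent to Turing machine time. -/

/-- Binary trees, the data on which programs operate. -/
inductive Data : Type
  | nil : Data
  | cons : Data → Data → Data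

/-- The number of nodes of a tree, leaves included. -/
def Data.size : Data → ℕ
  | .nil => 1
  | .cons a b => 1 + a.size + b.size

def Data.head : Data → Data
  | .nil => .nil
  | .cons a _ => a

def Data.tail : Data → Data
  | .nil => .nil
  | .cons _ b => b

/-- The contents of the program variables (numbered by `ℕ`; a program mentions finitely many). -/
abbrev Store : Type := ℕ → Data

inductive Expr : Type
  | var : ℕ → Expr
  | nil : Expr
  | cons : Expr → Expr → Expr
  | head : Expr → Expr
  | tail : Expr → Expr

def Expr.eval (σ : Store) : Expr → Data
  | .var i => σ i
  | .nil => .nil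
  | .cons e f => .cons (e.eval σ) (f.eval σ)
  | .head e => (e.eval σ).head
  | .tail e => (e.eval σ).tail

/-- The time needed to evaluate an expression; reading a variable costs the size of its value. -/
def Expr.cost (σ : Store) : Expr → ℕ
  | .var i => (σ i).size
  | .nil => 1
  | .cons e f => 1 + e.cost σ + f.cost σ
  | .head e => 1 + e.cost σ
  | .tail e => 1 + e.cost σ

/-- Programs. A guard counts as true when its value is not `nil`; `emit e` outputs the value
of `e`. -/
inductive Prog : Type
  | assign : ℕ → Expr → Prog
  | emit : Expr → Prog
  | seq : Prog → Prog → Prog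
  | ite : Expr → Prog → Prog → Prog
  | loop : Expr → Prog → Prog

/-- The chronological record of a run: `none` is one unit of time, `some d` is the output of `d`. -/
abbrev Trace : Type := List (Option Data)

/-- `m` units of time without output. -/
def ticks (m : ℕ) : Trace := List.replicate m none

/-- `Run c σ t τ`: program `c`, started in store `σ`, halts in store `τ` after a run recorded
by `t`. -/
inductive Run : Prog → Store → Trace → Store → Prop
  | assign (i : ℕ) (e : Expr) (σ : Store) :
      Run (.assign i e) σ (ticks (1 + e.cost σ)) (Function.update σ i (e.eval σ))
  | emit (e : Expr) (σ : Store) :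
      Run (.emit e) σ (ticks (1 + e.cost σ) ++ [some (e.eval σ)]) σ
  | seq {c d : Prog} {σ τ ρ : Store} {t u : Trace} :
      Run c σ t τ → Run d τ u ρ → Run (.seq c d) σ (t ++ u) ρ
  | iteTrue {e : Expr} {c d : Prog} {σ τ : Store} {t : Trace} :
      e.eval σ ≠ .nil → Run c σ t τ → Run (.ite e c d) σ (ticks (1 + e.cost σ) ++ t) τ
  | iteFalse {e : Expr} {c d : Prog} {σ τ : Store} {t : Trace} :
      e.eval σ = .nil → Run d σ t τ → Run (.ite e c d) σ (ticks (1 + e.cost σ) ++ t) τ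
  | loopTrue {e : Expr} {c : Prog} {σ τ ρ : Store} {t u : Trace} :
      e.eval σ ≠ .nil → Run c σ t τ → Run (.loop e c) τ u ρ →
      Run (.loop e c) σ (ticks (1 + e.cost σ) ++ t ++ u) ρ
  | loopFalse {e : Expr} {c : Prog} {σ : Store} :
      e.eval σ = .nil → Run (.loop e c) σ (ticks (1 + e.cost σ)) σ

/-- The store in which variable `0` holds the input and all other variables hold `nil`. -/
def initStore (input : Data) : Store := fun i => if i = 0 then input else .nil

/-- On `input`, program `c` halts within time `T` with `output` in variable `0`. -/
def ComputesInTime (c : Prog) (input output : Data) (T : ℕ) : Prop :=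
  ∃ (t : Trace) (τ : Store), Run c (initStore input) t τ ∧ τ 0 = output ∧ t.length ≤ T

/-- On `input`, program `c` halts, outputs every element of `S` exactly once and nothing else, and
no period without output (before the first output, between two consecutive outputs, or after the
last one) is longer than `D`. -/
def EnumeratesWithDelay (c : Prog) (input : Data) (S : Set Data) (D : ℕ) : Prop :=
  ∃ (t : Trace) (τ : Store), Run c (initStore input) t τ ∧
    (t.filterMap id).Nodup ∧ {d | d ∈ t.filterMap id} = S ∧
    ∀ m : ℕ, ticks m <:+: t → m ≤ D

/-! ## Encodings -/

def encBool : Bool → Data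
  | false => .nil
  | true => .cons .nil .nil

def encList (l : List Data) : Data := l.foldr .cons .nil

/-- Binary encoding of natural numbers, least significant bit first. -/
def encNat (n : ℕ) : Data := encList (n.bits.map encBool)

open Classical in
/-- The matrix of a binary relation on `Fin n`, as a list of `n` rows of `n` bits. -/
noncomputable def encRel {n : ℕ} (r : Fin n → Fin n → Prop) : Data :=
  encList ((List.finRange n).map fun i =>
    encList ((List.finRange n).map fun j => encBool (decide (r i j))))

/-! ## Parameterized enumeration problems and polynomial-delay enumeration kernels -/

/-- A parameterized enumeration problem: encoded instances, for every instance the set of its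
(encoded) solutions, and the parameter of every instance. -/
structure ParamEnumProblem : Type 1 where
  Inst : Type
  enc : Inst → Data
  Sol : Inst → Set Data
  param : Inst → ℕ

/-- The length `|x|` of an instance. -/
def ParamEnumProblem.length (Q : ParamEnumProblem) (x : Q.Inst) : ℕ := (Q.enc x).size

/-- The encoding of the pair `(x, k)`, where `k` is the parameter of `x`. -/
def ParamEnumProblem.encPair (Q : ParamEnumProblem) (x : Q.Inst) : Data :=
  .cons (Q.enc x) (encNat (Q.param x))

/-- The programs `A` (compressor) and `A'` (lifting algorithm) form a polynomial-delay enumeration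
kernel for `Q`, where `red x` is the instance that `A` produces from `x`. -/
structure IsPDEKernel (Q : ParamEnumProblem) (A A' : Prog) (red : Q.Inst → Q.Inst) : Prop where
  /-- From `(x, k)` the compressor computes `(x', k')` in time polynomial in `|x| + k`. -/
  compress : ∃ p : Polynomial ℕ, ∀ x : Q.Inst,
    ComputesInTime A (Q.encPair x) (Q.encPair (red x)) (p.eval (Q.length x + Q.param x))
  /-- `|x'|` and `k'` are bounded by a computable function of `k`. -/
  bounded : ∃ g : ℕ → ℕ, Computable g ∧ ∀ x : Q.Inst,
    Q.length (red x) ≤ g (Q.param x) ∧ Q.param (red x) ≤ g (Q.param x)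
  /-- From `(x, k)`, `(x', k')` and a solution `s` of `x'` the lifting algorithm enumerates a set
  `S x s`, with delay polynomial in `|x| + |x'| + k + k'`, and the sets `S x s`, for `s` ranging
  over the solutions of `x'`, form a partition of the set of solutions of `x`. -/
  lift : ∃ S : Q.Inst → Data → Set Data,
    (∀ x : Q.Inst,
      (∀ s ∈ Q.Sol (red x), (S x s).Nonempty) ∧
      (Q.Sol (red x)).PairwiseDisjoint (S x) ∧
      ⋃ s ∈ Q.Sol (red x), S x s = Q.Sol x) ∧
    ∃ p : Polynomial ℕ, ∀ x : Q.Inst, ∀ s ∈ Q.Sol (red x),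
      EnumeratesWithDelay A' (.cons (Q.encPair x) (.cons (Q.encPair (red x)) s)) (S x s)
        (p.eval (Q.length x + Q.length (red x) + Q.param x + Q.param (red x)))

/-! ## Co-cluster graphs and matching multicuts -/

/-- Every connected component is a clique. -/
def IsCluster {V : Type*} (G : SimpleGraph V) : Prop :=
  ∀ c : G.ConnectedComponent, G.IsClique c.supp

/-- The complement is a cluster graph. -/
def IsCoCluster {V : Type*} (G : SimpleGraph V) : Prop := IsCluster Gᶜ

/-- The vertex-deletion distance to co-cluster: the least size of a vertex set `U` such that
`G - U` is a co-cluster graph. -/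
noncomputable def coClusterDist {V : Type*} [Fintype V] (G : SimpleGraph V) : ℕ :=
  sInf {m | ∃ U : Finset V, U.card = m ∧ IsCoCluster (G.induce {v | v ∉ U})}

/-- A partition `P` of the vertex set (into non-empty parts) is a matching multicut if every vertex
has at most one neighbour outside of its own part. -/
def IsMatchingMulticut {V : Type*} [Fintype V] [DecidableEq V] (G : SimpleGraph V)
    (P : Finpartition (Finset.univ : Finset V)) : Prop :=
  ∀ A ∈ P.parts, ∀ v ∈ A, {u | G.Adj v u ∧ u ∉ A}.ncard ≤ 1

/-- A graph on the vertex set `Fin n` together with the required number `ℓ` of parts. -/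
structure MulticutInstance : Type where
  n : ℕ
  graph : SimpleGraph (Fin n)
  ℓ : ℕ

/-- A partition, encoded by the matrix of the relation of lying in the same part. -/
noncomputable def encPartition {n : ℕ} (P : Finpartition (Finset.univ : Finset (Fin n))) : Data :=
  encRel fun i j => ∃ A ∈ P.parts, i ∈ A ∧ j ∈ A

/-- Enum Matching Multicut, parameterized by the vertex-deletion distance to co-cluster: given
`(G, ℓ)`, enumerate all matching multicuts of `G` on at least `ℓ` parts. -/
noncomputable def enumMatchingMulticut : ParamEnumProblem where
  Inst := MulticutInstance
  enc x := .cons (encRel x.graph.Adj) (encNat x.ℓ)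
  Sol x := {d | ∃ P : Finpartition (Finset.univ : Finset (Fin x.n)),
    IsMatchingMulticut x.graph P ∧ x.ℓ ≤ P.parts.card ∧ encPartition P = d}
  param x := coClusterDist x.graph

end EnumKernel

/-! ### Polynomial-time computation on the tree machine. -/

namespace EnumKernel

/-! ## Silent runs and their cost -/

/-! The compressor visits each vertex once and deletes `v` whenever the matching multicuts of the
current graph can be recovered from those of the graph without `v`. Three situations qualify. An
isolated `v` may form a new part or join any old one, and the required number of parts drops by one.
If `v` is pendant at `u` and another pendant vertex `p` hangs at `u`, then at most one of the two is
separated from `u`: either `v` lies with `u`, or `v` takes over the place of a separated `p` while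
`p` moves to `u`. If `v` has at least two neighbours, any two of which have three common neighbours
besides `v`, then all neighbours lie in one part, since vertices in different parts cannot have
three common neighbours (`IsMM.of_common`); hence `v` is forced into that part.

In each situation a solution of the smaller graph yields a non-empty list of solutions of the larger
one, and these lists partition the solutions of the larger graph (`isLift_children`). Such lifts
compose (`IsLift.flatMap`), so the log of deletions describes a search tree of polynomial depth
without dead ends. Depth-first search lists its leaves with polynomial delay (`exists_enumerator`).

For the size, let `U` be a smallest set whose deletion leaves a co-cluster graph; it enters only the
analysis, never the algorithm. Outside `U` non-adjacency is transitive, so non-adjacent vertices are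
twins there. A vertex is kept either as the only pendant vertex at its neighbour, or because of two
neighbours with at most three common neighbours among the kept vertices outside `U`. Each `u` is
responsible for at most one kept pendant vertex. A pair inside `U` is responsible for at most three
vertices, which gives the quadratic term. Pairs that leave `U` cost a constant for each vertex of
`U`, or a constant altogether, because of the twins (`card_kerSet_le`).

The output must carry its own exact parameter. To make this number explicit, a clique on `2 *
K.card` new vertices is attached to the first vertex of the remaining set `K`. The clique always
lies in one part, so the solutions do not change (`isLift_unker`), while the distance to co-cluster
becomes `K.card - 1` (`coClusterDist_reduced`).

Running times are handled by the predicate `PTF`, which is closed under the usual list operations,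
so that most of the algorithms are certified by `fun_prop`. -/

theorem Data.size_pos (d : Data) : 0 < d.size := by
  cases d <;> simp only [Data.size] <;> omega

theorem Data.size_head_le (d : Data) : d.head.size ≤ d.size := by
  cases d <;> simp [Data.size, Data.head]; omega

theorem Data.size_tail_le (d : Data) : d.tail.size ≤ d.size := by
  cases d <;> simp [Data.size, Data.tail]

theorem Expr.size_eval_le_cost (σ : Store) (e : Expr) : (e.eval σ).size ≤ e.cost σ := by
  induction e with
  | var i => exact le_rfl
  | nil => exact le_rfl
  | cons e f he hf => simp only [Expr.eval, Expr.cost, Data.size]; omega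
  | head e he => exact (Data.size_head_le _).trans (by simp only [Expr.cost]; omega)
  | tail e he => exact (Data.size_tail_le _).trans (by simp only [Expr.cost]; omega)

theorem ticks_length (m : ℕ) : (ticks m).length = m := List.length_replicate

theorem ticks_add (m n : ℕ) : ticks (m + n) = ticks m ++ ticks n := by
  exact (List.replicate_append_replicate ..).symm

/-- A run only builds data that it pays for. -/
theorem Run.size_le {c : Prog} {σ τ : Store} {t : Trace} (h : Run c σ t τ) (i : ℕ) :
    (τ i).size ≤ (σ i).size + t.length := by
  induction h with
  | assign j e σ =>
    by_cases hij : i = j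
    · subst hij
      have := Expr.size_eval_le_cost σ e
      simp only [Function.update_self, ticks_length]; omega
    · simp [Function.update_of_ne hij]
  | emit e σ => simp
  | seq _ _ h1 h2 => simp only [List.length_append]; omega
  | iteTrue _ _ h => simp only [List.length_append]; omega
  | iteFalse _ _ h => simp only [List.length_append]; omega
  | loopTrue _ _ _ h1 h2 => simp only [List.length_append]; omega
  | loopFalse _ => simp

/-- `c` runs from `σ` to `τ` without output in at most `m` units of time. -/
def Silent (c : Prog) (σ : Store) (m : ℕ) (τ : Store) : Prop :=
  ∃ k ≤ m, Run c σ (ticks k) τ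

theorem Silent.mono {c : Prog} {σ τ : Store} {m n : ℕ} (h : Silent c σ m τ) (hmn : m ≤ n) :
    Silent c σ n τ := by
  obtain ⟨k, hk, hr⟩ := h
  exact ⟨k, hk.trans hmn, hr⟩

theorem Silent.seq {c d : Prog} {σ τ ρ : Store} {m n : ℕ} (h : Silent c σ m τ)
    (h' : Silent d τ n ρ) : Silent (.seq c d) σ (m + n) ρ := by
  obtain ⟨k, hk, hr⟩ := h
  obtain ⟨k', hk', hr'⟩ := h'
  exact ⟨k + k', by omega, ticks_add k k' ▸ hr.seq hr'⟩

theorem Silent.assign (i : ℕ) (e : Expr) (σ : Store) :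
    Silent (.assign i e) σ (1 + e.cost σ) (Function.update σ i (e.eval σ)) :=
  ⟨_, le_rfl, Run.assign i e σ⟩

theorem Silent.iteTrue {e : Expr} {c d : Prog} {σ τ : Store} {m : ℕ} (he : e.eval σ ≠ .nil)
    (h : Silent c σ m τ) : Silent (.ite e c d) σ (1 + e.cost σ + m) τ := by
  obtain ⟨k, hk, hr⟩ := h
  exact ⟨1 + e.cost σ + k, by omega, ticks_add _ k ▸ hr.iteTrue he⟩

theorem Silent.iteFalse {e : Expr} {c d : Prog} {σ τ : Store} {m : ℕ} (he : e.eval σ = .nil)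
    (h : Silent d σ m τ) : Silent (.ite e c d) σ (1 + e.cost σ + m) τ := by
  obtain ⟨k, hk, hr⟩ := h
  exact ⟨1 + e.cost σ + k, by omega, ticks_add _ k ▸ hr.iteFalse he⟩

theorem Silent.loopTrue {e : Expr} {c : Prog} {σ τ ρ : Store} {m n : ℕ} (he : e.eval σ ≠ .nil)
    (h : Silent c σ m τ) (h' : Silent (.loop e c) τ n ρ) :
    Silent (.loop e c) σ (1 + e.cost σ + m + n) ρ := by
  obtain ⟨k, hk, hr⟩ := h
  obtain ⟨k', hk', hr'⟩ := h'
  refine ⟨1 + e.cost σ + k + k', by omega, ?_⟩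
  rw [ticks_add, ticks_add]
  exact hr.loopTrue he hr'

theorem Silent.loopFalse {e : Expr} {c : Prog} {σ : Store} (he : e.eval σ = .nil) :
    Silent (.loop e c) σ (1 + e.cost σ) σ :=
  ⟨_, le_rfl, Run.loopFalse he⟩

/-! ## Typed data -/

/-- Types whose elements are represented by data. -/
class Enc (α : Type) where
  enc : α → Data

open Enc (enc)

instance : Enc Unit := ⟨fun _ => .nil⟩

instance : Enc Bool := ⟨encBool⟩

/-- Natural numbers are represented in unary. -/
instance : Enc ℕ := ⟨fun n => encList (List.replicate n .nil)⟩

instance {α β : Type} [Enc α] [Enc β] : Enc (α × β) := ⟨fun p => .cons (enc p.1) (enc p.2)⟩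

instance {α : Type} [Enc α] : Enc (List α) := ⟨fun l => encList (l.map enc)⟩

/-- The size of the representation. -/
def sz {α : Type} [Enc α] (a : α) : ℕ := (enc a).size

section
variable {α β γ δ : Type} [Enc α] [Enc β] [Enc γ] [Enc δ]

theorem enc_mk (a : α) (b : β) : enc (a, b) = .cons (enc a) (enc b) := rfl

theorem enc_nil : enc ([] : List α) = .nil := rfl

theorem enc_cons (a : α) (l : List α) : enc (a :: l) = .cons (enc a) (enc l) := rfl

theorem enc_zero : enc (0 : ℕ) = .nil := rfl

theorem enc_succ (n : ℕ) : enc (n + 1) = .cons .nil (enc n) := rfl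

theorem sz_pos (a : α) : 0 < sz a := Data.size_pos _

theorem sz_mk (a : α) (b : β) : sz (a, b) = 1 + sz a + sz b := rfl

theorem sz_nil : sz ([] : List α) = 1 := rfl

theorem sz_cons (a : α) (l : List α) : sz (a :: l) = 1 + sz a + sz l := rfl

theorem sz_nat (n : ℕ) : sz n = 2 * n + 1 := by
  induction n with
  | zero => rfl
  | succ n ih =>
    have : sz (n + 1) = 1 + 1 + sz n := rfl
    omega

theorem sz_bool (b : Bool) : sz b ≤ 3 := by
  cases b <;> decide

theorem sz_list (l : List α) : sz l = 1 + (l.map fun a => 1 + sz a).sum := by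
  induction l with
  | nil => rfl
  | cons a l ih => rw [sz_cons, ih, List.map_cons, List.sum_cons]; omega

theorem length_lt_sz (l : List α) : l.length < sz l := by
  induction l with
  | nil => exact sz_pos _
  | cons a l ih => rw [sz_cons, List.length_cons]; omega

theorem sz_append (l₁ l₂ : List α) : sz (l₁ ++ l₂) + 1 = sz l₁ + sz l₂ := by
  induction l₁ with
  | nil => simp [sz_nil]; omega
  | cons a l ih => rw [List.cons_append, sz_cons, sz_cons]; omega

theorem sz_le_of_sublist {l₁ l₂ : List α} (h : l₁.Sublist l₂) : sz l₁ ≤ sz l₂ := by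
  induction h with
  | slnil => exact le_rfl
  | cons a _ ih => rw [sz_cons]; omega
  | cons_cons a _ ih => rw [sz_cons, sz_cons]; omega

theorem sz_le_of_mem {l : List α} {a : α} (h : a ∈ l) : sz a ≤ sz l := by
  have := sz_le_of_sublist (List.singleton_sublist.2 h)
  rw [sz_cons] at this; omega

theorem sz_le_of_forall {l : List α} {B : ℕ} (h : ∀ a ∈ l, sz a ≤ B) :
    sz l ≤ 1 + l.length * (1 + B) := by
  induction l with
  | nil => simp [sz_nil]
  | cons a l ih =>
    have h1 := ih fun b hb => h b (List.mem_cons_of_mem _ hb)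
    have h2 := h a List.mem_cons_self
    rw [sz_cons, List.length_cons, Nat.add_mul]; omega

/-! ## Polynomially bounded functions -/

/-- `T` is bounded by a polynomial in the size of the argument. -/
def PolyBd (T : α → ℕ) : Prop := ∃ p : Polynomial ℕ, ∀ a, T a ≤ p.eval (sz a)

/-- Coefficients in `ℕ` are non-negative, so a bound on the argument can be substituted into a time
bound. -/
theorem eval_mono (p : Polynomial ℕ) : Monotone fun n => p.eval n := by
  intro m n h
  induction p using Polynomial.induction_on' with
  | add p q hp hq => simpa using Nat.add_le_add hp hq
  | monomial k a => simpa using Nat.mul_le_mul_left a (Nat.pow_le_pow_left h k)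

theorem PolyBd.mono {S T : α → ℕ} (hT : PolyBd T) (h : ∀ a, S a ≤ T a) : PolyBd S := by
  obtain ⟨p, hp⟩ := hT
  exact ⟨p, fun a => (h a).trans (hp a)⟩

theorem PolyBd.const (n : ℕ) : PolyBd fun _ : α => n := ⟨Polynomial.C n, by simp⟩

theorem PolyBd.sz : PolyBd fun a : α => sz a := ⟨Polynomial.X, by simp⟩

theorem PolyBd.add {S T : α → ℕ} (hS : PolyBd S) (hT : PolyBd T) : PolyBd fun a => S a + T a := by
  obtain ⟨p, hp⟩ := hS
  obtain ⟨q, hq⟩ := hT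
  exact ⟨p + q, fun a => by simpa using Nat.add_le_add (hp a) (hq a)⟩

theorem PolyBd.mul {S T : α → ℕ} (hS : PolyBd S) (hT : PolyBd T) : PolyBd fun a => S a * T a := by
  obtain ⟨p, hp⟩ := hS
  obtain ⟨q, hq⟩ := hT
  exact ⟨p * q, fun a => by simpa using Nat.mul_le_mul (hp a) (hq a)⟩

theorem PolyBd.eval (p : Polynomial ℕ) {T : α → ℕ} (hT : PolyBd T) :
    PolyBd fun a => p.eval (T a) := by
  obtain ⟨q, hq⟩ := hT
  exact ⟨p.comp q, fun a => by simpa using eval_mono p (hq a)⟩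

theorem PolyBd.comp {T : β → ℕ} {g : α → β} (hT : PolyBd T) (hg : PolyBd fun a => EnumKernel.sz (g a)) :
    PolyBd fun a => T (g a) := by
  obtain ⟨p, hp⟩ := hT
  exact (PolyBd.eval p hg).mono fun a => hp _

/-! ## Functions computed in polynomial time -/

/-- `f` is computed in polynomial time by a program that finds its argument in variable `N`, leaves
the value there, and does not touch the variables below `N`, where `N` is arbitrary. -/
@[fun_prop]
def PTF (f : α → β) : Prop :=
  ∃ T : α → ℕ, PolyBd T ∧ ∀ N, ∃ c : Prog, ∀ (σ : Store) (a : α), σ N = enc a →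
    ∃ τ, Silent c σ (T a) τ ∧ τ N = enc (f a) ∧ ∀ i < N, τ i = σ i

/-- A run pays for all the data that it builds, so short runs have small outputs. This is what keeps
compositions polynomial. -/
theorem PTF.polyBd_sz {f : α → β} (hf : PTF f) : PolyBd fun a => sz (f a) := by
  obtain ⟨T, hT, h⟩ := hf
  obtain ⟨c, hc⟩ := h 0
  refine (PolyBd.sz.add hT).mono fun a => ?_
  obtain ⟨τ, ⟨k, hk, hr⟩, h0, -⟩ := hc (fun _ => enc a) a rfl
  have := hr.size_le 0
  rw [h0, ticks_length] at this
  simp only [sz]; omega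

theorem PTF.of_expr {f : α → β} {T : α → ℕ} (hT : PolyBd T)
    (h : ∀ N, ∃ e : Expr, ∀ (σ : Store) (a : α), σ N = enc a →
      e.eval σ = enc (f a) ∧ e.cost σ ≤ T a) : PTF f := by
  refine ⟨_, (PolyBd.const 1).add hT, fun N => ?_⟩
  obtain ⟨e, he⟩ := h N
  refine ⟨.assign N e, fun σ a ha => ⟨_, (Silent.assign N e σ).mono ?_, ?_, ?_⟩⟩
  · have := (he σ a ha).2; omega
  · simpa using (he σ a ha).1
  · intro i hi; exact Function.update_of_ne hi.ne _ _

/-- Functions between types may be exchanged for functions with the same effect on data. -/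
theorem PTF.congr_enc {f : α → β} (hf : PTF f) {g : α → γ} (h : ∀ a, enc (g a) = enc (f a)) :
    PTF g := by
  obtain ⟨T, hT, hc⟩ := hf
  refine ⟨T, hT, fun N => ?_⟩
  obtain ⟨c, hc⟩ := hc N
  exact ⟨c, fun σ a ha => by rw [h]; exact hc σ a ha⟩

@[fun_prop]
theorem PTF.id : PTF fun a : α => a :=
  PTF.of_expr PolyBd.sz fun N => ⟨.var N, fun σ a ha => ⟨ha, by simp [Expr.cost, ha, EnumKernel.sz]⟩⟩

theorem exists_expr (d : Data) : ∃ e : Expr, ∀ σ, e.eval σ = d ∧ e.cost σ = d.size := by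
  induction d with
  | nil => exact ⟨.nil, fun σ => ⟨rfl, rfl⟩⟩
  | cons a b ha hb =>
    obtain ⟨e, he⟩ := ha
    obtain ⟨f, hf⟩ := hb
    exact ⟨.cons e f, fun σ => by
      simp [Expr.eval, Expr.cost, Data.size, (he σ).1, (he σ).2, (hf σ).1, (hf σ).2]⟩

@[fun_prop]
theorem PTF.const (b : β) : PTF fun _ : α => b := by
  obtain ⟨e, he⟩ := exists_expr (enc b)
  exact PTF.of_expr (PolyBd.const (enc b).size) fun _ => ⟨e, fun σ a _ => ⟨(he σ).1, (he σ).2.le⟩⟩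

-- The second program runs on the same variable `N`; its time is polynomial in the size of the
-- intermediate value, which is itself polynomially bounded.
@[fun_prop]
theorem PTF.comp {g : β → γ} {f : α → β} (hg : PTF g) (hf : PTF f) : PTF fun a => g (f a) := by
  have hs := hf.polyBd_sz
  obtain ⟨S, hS, hg⟩ := hg
  obtain ⟨T, hT, hf⟩ := hf
  refine ⟨_, hT.add (hS.comp hs), fun N => ?_⟩
  obtain ⟨c, hc⟩ := hf N
  obtain ⟨d, hd⟩ := hg N
  refine ⟨.seq c d, fun σ a ha => ?_⟩
  obtain ⟨τ, h1, h2, h3⟩ := hc σ a ha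
  obtain ⟨ρ, h4, h5, h6⟩ := hd τ _ h2
  exact ⟨ρ, h1.seq h4, h5, fun i hi => (h6 i hi).trans (h3 i hi)⟩

-- The second program works from `N + 2` upwards, so it preserves the first result in `N + 1`;
-- neither program touches the argument in `N`.
@[fun_prop]
theorem PTF.prodMk {f : α → β} {g : α → γ} (hf : PTF f) (hg : PTF g) :
    PTF fun a => (f a, g a) := by
  have hsf := hf.polyBd_sz
  have hsg := hg.polyBd_sz
  obtain ⟨S, hS, hf⟩ := hf
  obtain ⟨T, hT, hg⟩ := hg
  refine ⟨fun a => (1 + sz a + S a) + (1 + sz a + T a) + (2 + sz (f a) + sz (g a)),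
    (((PolyBd.const 1).add .sz).add hS).add (((PolyBd.const 1).add .sz).add hT) |>.add
      (((PolyBd.const 2).add hsf).add hsg), fun N => ?_⟩
  obtain ⟨c, hc⟩ := hf (N + 1)
  obtain ⟨d, hd⟩ := hg (N + 2)
  refine ⟨.seq (.seq (.seq (.assign (N + 1) (.var N)) c) (.seq (.assign (N + 2) (.var N)) d))
    (.assign N (.cons (.var (N + 1)) (.var (N + 2)))), fun σ a ha => ?_⟩
  have s1 := Silent.assign (N + 1) (.var N) σ
  obtain ⟨τ, h1, h2, h3⟩ := hc (Function.update σ (N + 1) ((Expr.var N).eval σ)) a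
    (by simp [Expr.eval, ha])
  have hτN : τ N = enc a := by rw [h3 N (by omega)]; simp [ha]
  have s2 := Silent.assign (N + 2) (.var N) τ
  obtain ⟨ρ, h4, h5, h6⟩ := hd (Function.update τ (N + 2) ((Expr.var N).eval τ)) a
    (by simp [Expr.eval, hτN])
  have hρ : ρ (N + 1) = enc (f a) := by rw [h6 _ (by omega)]; simp [h2]
  have s3 := Silent.assign N (.cons (.var (N + 1)) (.var (N + 2))) ρ
  refine ⟨_, (((s1.seq h1).seq (s2.seq h4)).seq s3).mono ?_, ?_, ?_⟩
  · simp only [Expr.cost, ha, hτN, hρ, h5, sz]; omega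
  · simp [Expr.eval, hρ, h5, enc_mk]
  · intro i hi
    rw [Function.update_of_ne (by omega), h6 _ (by omega), Function.update_of_ne (by omega),
      h3 _ (by omega), Function.update_of_ne (by omega)]

theorem PTF.fst' : PTF fun p : α × β => p.1 :=
  PTF.of_expr ((PolyBd.const 1).add .sz) fun N => ⟨.head (.var N), fun σ a ha => by
    obtain ⟨a, b⟩ := a
    simp [Expr.eval, Expr.cost, ha, enc_mk, Data.head, sz]⟩

theorem PTF.snd' : PTF fun p : α × β => p.2 :=
  PTF.of_expr ((PolyBd.const 1).add .sz) fun N => ⟨.tail (.var N), fun σ a ha => by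
    obtain ⟨a, b⟩ := a
    simp [Expr.eval, Expr.cost, ha, enc_mk, Data.tail, sz]⟩

@[fun_prop]
theorem PTF.fst {f : α → β × γ} (hf : PTF f) : PTF fun a => (f a).1 := PTF.fst'.comp hf

@[fun_prop]
theorem PTF.snd {f : α → β × γ} (hf : PTF f) : PTF fun a => (f a).2 := PTF.snd'.comp hf

@[fun_prop]
theorem PTF.ite {b : α → Bool} {f g : α → β} (hb : PTF b) (hf : PTF f) (hg : PTF g) :
    PTF fun a => if b a = true then f a else g a := by
  have hsb := hb.polyBd_sz
  obtain ⟨R, hR, hb⟩ := hb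
  obtain ⟨S, hS, hf⟩ := hf
  obtain ⟨T, hT, hg⟩ := hg
  refine ⟨fun a => (1 + sz a + R a) + (1 + sz (b a) + (S a + T a)),
    (((PolyBd.const 1).add .sz).add hR).add (((PolyBd.const 1).add hsb).add (hS.add hT)),
    fun N => ?_⟩
  obtain ⟨r, hr⟩ := hb (N + 1)
  obtain ⟨c, hc⟩ := hf N
  obtain ⟨d, hd⟩ := hg N
  refine ⟨.seq (.seq (.assign (N + 1) (.var N)) r) (.ite (.var (N + 1)) c d), fun σ a ha => ?_⟩
  have s1 := Silent.assign (N + 1) (.var N) σ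
  obtain ⟨τ, h1, h2, h3⟩ := hr (Function.update σ (N + 1) ((Expr.var N).eval σ)) a
    (by simp [Expr.eval, ha])
  have hτN : τ N = enc a := by rw [h3 N (by omega)]; simp [ha]
  cases hba : b a with
  | true =>
    obtain ⟨ρ, h4, h5, h6⟩ := hc τ a hτN
    refine ⟨ρ, ((s1.seq h1).seq (h4.iteTrue (d := d) (e := .var (N + 1)) ?_)).mono ?_, ?_, ?_⟩
    · rw [Expr.eval, h2, hba]; simp [enc, encBool]
    · simp only [Expr.cost, ha, h2, sz]; omega
    · simp [h5, hba]
    · intro i hi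
      rw [h6 _ hi, h3 _ (by omega), Function.update_of_ne (by omega)]
  | false =>
    obtain ⟨ρ, h4, h5, h6⟩ := hd τ a hτN
    refine ⟨ρ, ((s1.seq h1).seq (h4.iteFalse (c := c) (e := .var (N + 1)) ?_)).mono ?_, ?_, ?_⟩
    · rw [Expr.eval, h2, hba]; simp [enc, encBool]
    · simp only [Expr.cost, ha, h2, sz]; omega
    · simp [h5, hba]
    · intro i hi
      rw [h6 _ hi, h3 _ (by omega), Function.update_of_ne (by omega)]

@[fun_prop]
theorem PTF.cons {f : α → β} {g : α → List β} (hf : PTF f) (hg : PTF g) :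
    PTF fun a => f a :: g a :=
  (hf.prodMk hg).congr_enc fun _ => rfl

theorem PTF.tail' : PTF fun l : List α => l.tail :=
  PTF.of_expr ((PolyBd.const 1).add .sz) fun N => ⟨.tail (.var N), fun σ a ha => by
    cases a <;> simp [Expr.eval, Expr.cost, ha, enc_nil, enc_cons, Data.tail, sz]⟩

@[fun_prop]
theorem PTF.tail {f : α → List β} (hf : PTF f) : PTF fun a => (f a).tail := PTF.tail'.comp hf

-- In unary, adding one is pairing with `nil`, the code of `()`.
@[fun_prop]
theorem PTF.succ {f : α → ℕ} (hf : PTF f) : PTF fun a => f a + 1 :=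
  ((PTF.const ()).prodMk hf).congr_enc fun _ => rfl

theorem PTF.pred' : PTF fun n : ℕ => n - 1 :=
  PTF.of_expr ((PolyBd.const 1).add .sz) fun N => ⟨.tail (.var N), fun σ a ha => by
    cases a <;> simp [Expr.eval, Expr.cost, ha, enc_zero, enc_succ, Data.tail, sz]⟩

theorem PTF.pred {f : α → ℕ} (hf : PTF f) : PTF fun a => f a - 1 := PTF.pred'.comp hf

/-- Testing whether the data are `nil`. -/
theorem PTF.of_nil_iff {b : α → Bool} (h : ∀ a, b a = true ↔ enc a = .nil) : PTF b := by
  refine ⟨fun a => (1 + sz a) + 4, ((PolyBd.const 1).add .sz).add (PolyBd.const 4), fun N => ?_⟩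
  refine ⟨.ite (.var N) (.assign N .nil) (.assign N (.cons .nil .nil)), fun σ a ha => ?_⟩
  by_cases hn : enc a = .nil
  · refine ⟨_, (Silent.iteFalse (by simpa [Expr.eval, ha] using hn)
      (Silent.assign N (.cons .nil .nil) σ)).mono ?_, ?_, ?_⟩
    · simp [Expr.cost, ha, sz]
    · simp [Expr.eval, (h a).2 hn, enc, encBool]
    · intro i hi; exact Function.update_of_ne hi.ne _ _
  · refine ⟨_, (Silent.iteTrue (by simpa [Expr.eval, ha] using hn)
      (Silent.assign N .nil σ)).mono ?_, ?_, ?_⟩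
    · simp only [Expr.cost, ha, sz]; omega
    · have : b a = false := by rw [← Bool.not_eq_true, h a]; exact hn
      simp [Expr.eval, this, enc, encBool]
    · intro i hi; exact Function.update_of_ne hi.ne _ _

@[fun_prop]
theorem PTF.isEmpty {f : α → List β} (hf : PTF f) : PTF fun a => (f a).isEmpty :=
  PTF.comp (g := fun l : List β => l.isEmpty)
    (PTF.of_nil_iff fun l => by cases l <;> simp [enc_nil, enc_cons]) hf

@[fun_prop]
theorem PTF.not {f : α → Bool} (hf : PTF f) : PTF fun a => !(f a) :=
  PTF.comp (g := fun b : Bool => !b)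
    (PTF.of_nil_iff fun b => by cases b <;> simp [enc, encBool]) hf

theorem PTF.eqZero {f : α → ℕ} (hf : PTF f) : PTF fun a => f a == 0 :=
  PTF.comp (g := fun n : ℕ => n == 0)
    (PTF.of_nil_iff fun n => by cases n <;> simp [enc_zero, enc_succ]) hf

@[fun_prop]
theorem PTF.and {f g : α → Bool} (hf : PTF f) (hg : PTF g) : PTF fun a => f a && g a :=
  (hf.ite hg (PTF.const false)).congr_enc fun a => by cases f a <;> rfl

@[fun_prop]
theorem PTF.or {f g : α → Bool} (hf : PTF f) (hg : PTF g) : PTF fun a => f a || g a :=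
  (hf.ite (PTF.const true) hg).congr_enc fun a => by cases f a <;> rfl

@[fun_prop]
theorem PTF.xor {f g : α → Bool} (hf : PTF f) (hg : PTF g) : PTF fun a => Bool.xor (f a) (g a) :=
  (hf.ite hg.not hg).congr_enc fun a => by cases f a <;> cases g a <;> rfl

/-- The empty list needs its own branch: the head of `nil` is `nil`, which need not represent
`default`. -/
theorem PTF.headD' [Inhabited α] : PTF fun l : List α => l.headD default := by
  have h : PTF fun l : List α => if (!l.isEmpty) = true then l.headD default else default := by
    refine ⟨fun a => (1 + sz a) + (1 + (1 + sz a) + (1 + sz (default : α))),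
      ((PolyBd.const 1).add .sz).add (((PolyBd.const 1).add ((PolyBd.const 1).add .sz)).add
        (PolyBd.const _)), fun N => ?_⟩
    obtain ⟨e, he⟩ := exists_expr (enc (default : α))
    refine ⟨.ite (.var N) (.assign N (.head (.var N))) (.assign N e), fun σ l hl => ?_⟩
    cases l with
    | nil =>
      refine ⟨_, (Silent.iteFalse (by simpa [Expr.eval, hl] using enc_nil)
        (Silent.assign N e σ)).mono ?_, ?_, ?_⟩
      · simp only [Expr.cost, hl, sz, (he σ).2]; omega
      · simp [(he σ).1]
      · intro i hi; exact Function.update_of_ne hi.ne _ _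
    | cons b l =>
      refine ⟨_, (Silent.iteTrue (by simp [Expr.eval, hl, enc_cons])
        (Silent.assign N (.head (.var N)) σ)).mono ?_, ?_, ?_⟩
      · simp only [Expr.cost, hl, sz]; omega
      · simp [Expr.eval, hl, enc_cons, Data.head]
      · intro i hi; exact Function.update_of_ne hi.ne _ _
  exact h.congr_enc fun l => by cases l <;> simp

@[fun_prop]
theorem PTF.headD [Inhabited β] {f : α → List β} (hf : PTF f) :
    PTF fun a => (f a).headD default := PTF.headD'.comp hf

/-! ## Iteration over a list -/

/-- Iterating a polynomial-time step may blow up exponentially, so a polynomial bound `B` on all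
intermediate accumulators has to be supplied. With it every round costs at most a fixed polynomial
`I`. -/
theorem PTF.foldl {l : α → List β} {init : α → γ} {g : α → γ → β → γ} (hl : PTF l)
    (hi : PTF init) (hg : PTF fun p : α × γ × β => g p.1 p.2.1 p.2.2)
    {B : α → ℕ} (hB : PolyBd B)
    (hb : ∀ a l₁, l₁ <+: l a → sz (l₁.foldl (g a) (init a)) ≤ B a) :
    PTF fun a => (l a).foldl (g a) (init a) := by
  have hsl := hl.polyBd_sz
  have hsi := hi.polyBd_sz
  obtain ⟨R, hR, hl⟩ := hl
  obtain ⟨S, hS, hi⟩ := hi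
  obtain ⟨T, ⟨p, hp⟩, hg⟩ := hg
  have hM : PolyBd fun a => 2 + sz a + B a + sz (l a) :=
    (((PolyBd.const 2).add .sz).add hB).add hsl
  let M : α → ℕ := fun a => 2 + sz a + B a + sz (l a)
  let I : α → ℕ := fun a => 6 * M a + 10 + p.eval (M a)
  have hI : PolyBd I := (((PolyBd.const 6).mul hM).add (PolyBd.const 10)).add (PolyBd.eval p hM)
  refine ⟨fun a => (1 + sz a + R a) + (1 + sz a + S a) + (sz (l a) * I a) + (1 + B a),
    ((((PolyBd.const 1).add .sz).add hR).add (((PolyBd.const 1).add .sz).add hS)).add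
      (hsl.mul hI) |>.add ((PolyBd.const 1).add hB), fun N => ?_⟩
  obtain ⟨cl, hcl⟩ := hl (N + 1)
  obtain ⟨ci, hci⟩ := hi (N + 2)
  obtain ⟨cg, hcg⟩ := hg (N + 3)
  let body : Prog := .seq (.seq (.seq
    (.assign (N + 3) (.cons (.var N) (.cons (.var (N + 2)) (.head (.var (N + 1)))))) cg)
    (.assign (N + 2) (.var (N + 3)))) (.assign (N + 1) (.tail (.var (N + 1))))
  -- Loop invariant: `l₁` has been consumed, `l₂` is in `N + 1`, and the accumulator is in `N + 2`.
  -- The additional `+ 1` pays for the last test of the guard.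
  have loop : ∀ a l₂ l₁ (σ : Store), l₁ ++ l₂ = l a → σ N = enc a → σ (N + 1) = enc l₂ →
      σ (N + 2) = enc (l₁.foldl (g a) (init a)) →
      ∃ τ, Silent (.loop (.var (N + 1)) body) σ ((l₂.length + 1) * I a) τ ∧
        τ (N + 2) = enc ((l a).foldl (g a) (init a)) ∧ ∀ i < N, τ i = σ i := by
    intro a l₂
    induction l₂ with
    | nil =>
      intro l₁ σ h1 h2 h3 h4
      refine ⟨σ, (Silent.loopFalse (e := .var (N + 1)) (σ := σ) h3).mono ?_, ?_, fun _ _ => rfl⟩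
      · simp only [Expr.cost, h3, enc_nil, Data.size, I]; simp; omega
      · rw [h4, ← h1, List.append_nil]
    | cons b l₂ ih =>
      intro l₁ σ h1 h2 h3 h4
      have hacc : sz (l₁.foldl (g a) (init a)) ≤ B a := hb a l₁ ⟨_, h1⟩
      have hacc' : sz ((l₁ ++ [b]).foldl (g a) (init a)) ≤ B a :=
        hb a _ ⟨l₂, by simpa using h1⟩
      have hsz : sz (b :: l₂) ≤ sz (l a) := by
        rw [← h1]; exact sz_le_of_sublist (List.sublist_append_right _ _)
      rw [sz_cons] at hsz
      have s1 := Silent.assign (N + 3) (.cons (.var N) (.cons (.var (N + 2))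
        (.head (.var (N + 1))))) σ
      obtain ⟨τ, h5, h6, h7⟩ := hcg (Function.update σ (N + 3) ((Expr.cons (.var N)
        (.cons (.var (N + 2)) (.head (.var (N + 1))))).eval σ)) (a, l₁.foldl (g a) (init a), b)
        (by simp [Expr.eval, h2, h3, h4, enc_cons, enc_mk, Data.head])
      have t1 : τ (N + 1) = enc (b :: l₂) := by rw [h7 _ (by omega)]; simp [h3]
      have t0 : τ N = enc a := by rw [h7 _ (by omega)]; simp [h2]
      have s2 := Silent.assign (N + 2) (.var (N + 3)) τ
      have s3 := Silent.assign (N + 1) (.tail (.var (N + 1)))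
        (Function.update τ (N + 2) ((Expr.var (N + 3)).eval τ))
      obtain ⟨ρ, h8, h9, h10⟩ := ih (l₁ ++ [b]) (Function.update (Function.update τ (N + 2)
        ((Expr.var (N + 3)).eval τ)) (N + 1) ((Expr.tail (.var (N + 1))).eval
          (Function.update τ (N + 2) ((Expr.var (N + 3)).eval τ))))
        (by simpa using h1) (by simp [t0]) (by simp [Expr.eval, t1, enc_cons, Data.tail])
        (by simp [Expr.eval, h6])
      have hT : T (a, l₁.foldl (g a) (init a), b) ≤ p.eval (M a) := by
        refine (hp _).trans (eval_mono p ?_)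
        simp only [sz_mk, M]; omega
      refine ⟨ρ, (Silent.loopTrue (by simp [Expr.eval, h3, enc_cons])
        (((s1.seq h5).seq s2).seq s3) h8).mono ?_, h9, fun i hi => ?_⟩
      · have e1 : (enc (b :: l₂)).size ≤ M a := by
          change sz _ ≤ _; rw [sz_cons]; simp only [M]; omega
        have e2 : (enc a).size ≤ M a := by change sz _ ≤ _; simp only [M]; omega
        have e3 : (enc (l₁.foldl (g a) (init a))).size ≤ M a := by
          change sz _ ≤ _; simp only [M]; omega
        have e4 : (enc (g a (l₁.foldl (g a) (init a)) b)).size ≤ M a := by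
          rw [List.foldl_append] at hacc'
          change sz (g a _ b) ≤ _ at hacc'
          change sz _ ≤ _; simp only [M]; omega
        simp only [Expr.cost, h2, h3, h4, h6, t1, Function.update_of_ne (show N + 1 ≠ N + 2 by omega)]
        rw [List.length_cons, Nat.add_mul (l₂.length + 1) 1 (I a), Nat.one_mul]
        generalize (l₂.length + 1) * I a = X
        simp only [I] at *
        omega
      · rw [h10 i hi, Function.update_of_ne (by omega), Function.update_of_ne (by omega),
          h7 _ (by omega), Function.update_of_ne (by omega)]
  refine ⟨.seq (.seq (.seq (.seq (.assign (N + 1) (.var N)) cl)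
    (.seq (.assign (N + 2) (.var N)) ci)) (.loop (.var (N + 1)) body))
    (.assign N (.var (N + 2))), fun σ a ha => ?_⟩
  have s1 := Silent.assign (N + 1) (.var N) σ
  obtain ⟨τ, h1, h2, h3⟩ := hcl (Function.update σ (N + 1) ((Expr.var N).eval σ)) a
    (by simp [Expr.eval, ha])
  have hτN : τ N = enc a := by rw [h3 N (by omega)]; simp [ha]
  have s2 := Silent.assign (N + 2) (.var N) τ
  obtain ⟨ρ, h4, h5, h6⟩ := hci (Function.update τ (N + 2) ((Expr.var N).eval τ)) a
    (by simp [Expr.eval, hτN])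
  have hρN : ρ N = enc a := by rw [h6 N (by omega)]; simp [hτN]
  have hρl : ρ (N + 1) = enc (l a) := by rw [h6 _ (by omega)]; simp [h2]
  obtain ⟨υ, h7, h8, h9⟩ := loop a (l a) [] ρ (by simp) hρN hρl (by simpa using h5)
  have s3 := Silent.assign N (.var (N + 2)) υ
  refine ⟨_, ((((s1.seq h1).seq (s2.seq h4)).seq h7).seq s3).mono ?_, ?_, ?_⟩
  · have e1 := hb a (l a) List.prefix_rfl
    have e2 : ((l a).length + 1) * I a ≤ sz (l a) * I a := Nat.mul_le_mul_right _ (length_lt_sz _)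
    simp only [Expr.cost, ha, hτN, h8]
    simp only [sz] at *
    omega
  · simp [Expr.eval, h8]
  · intro i hi
    rw [Function.update_of_ne (by omega), h9 _ hi, h6 _ (by omega), Function.update_of_ne (by omega),
      h3 _ (by omega), Function.update_of_ne (by omega)]

end

end EnumKernel

/-! ### Polynomial-time list operations and unary arithmetic. -/

namespace EnumKernel
open Enc (enc)

section
variable {α β γ δ : Type} [Enc α] [Enc β] [Enc γ] [Enc δ]

/-! ## Lists -/

theorem sz_perm {l₁ l₂ : List α} (h : l₁.Perm l₂) : sz l₁ = sz l₂ := by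
  rw [sz_list, sz_list, (h.map _).sum_eq]

/-- Folding with `cons` reverses the list; both `reverse` and `append` follow from this one fold. -/
theorem PTF.revAppend {f g : α → List β} (hf : PTF f) (hg : PTF g) :
    PTF fun a => (f a).reverse ++ g a := by
  have h : PTF fun a => (f a).foldl (fun acc b => b :: acc) (g a) := by
    refine PTF.foldl hf hg (by fun_prop) (hf.polyBd_sz.add hg.polyBd_sz) fun a l₁ h₁ => ?_
    have e := sz_append l₁.reverse (g a)
    have e' := sz_le_of_sublist h₁.sublist
    have e'' := sz_perm (List.reverse_perm l₁)
    rw [List.foldl_flip_cons_eq_append, List.map_id']; omega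
  exact h.congr_enc fun a => by rw [List.foldl_flip_cons_eq_append, List.map_id']

@[fun_prop]
theorem PTF.reverse {f : α → List β} (hf : PTF f) : PTF fun a => (f a).reverse :=
  (hf.revAppend (PTF.const [])).congr_enc fun a => by simp

@[fun_prop]
theorem PTF.append {f g : α → List β} (hf : PTF f) (hg : PTF g) : PTF fun a => f a ++ g a :=
  (hf.reverse.revAppend hg).congr_enc fun a => by simp

theorem foldl_append_flatMap {β γ : Type} (g : β → List γ) (l : List β) (init : List γ) :
    l.foldl (fun acc b => acc ++ g b) init = init ++ l.flatMap g := by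
  induction l generalizing init with
  | nil => simp
  | cons b l ih => simp [ih]

@[fun_prop]
theorem PTF.flatMap {l : α → List β} {g : α → β → List γ} (hl : PTF l)
    (hg : PTF fun p : α × β => g p.1 p.2) : PTF fun a => (l a).flatMap (g a) := by
  obtain ⟨p, hp⟩ := hg.polyBd_sz
  have h : PTF fun a => (l a).foldl (fun acc b => acc ++ g a b) [] := by
    -- There are at most `sz (l a)` pieces, and each of them has size at most `p` of the size of the
    -- pair `(a, b)`.
    have hB : PolyBd fun a => 1 + sz (l a) * p.eval (1 + sz a + sz (l a)) :=
      (PolyBd.const 1).add (hl.polyBd_sz.mul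
        (PolyBd.eval p (((PolyBd.const 1).add .sz).add hl.polyBd_sz)))
    refine PTF.foldl (g := fun a acc b => acc ++ g a b) hl (PTF.const []) ?_ hB ?_
    · exact PTF.append (by fun_prop) (hg.comp (f := fun q : α × List γ × β => (q.1, q.2.2))
        (by fun_prop))
    · intro a l₁ h₁
      rw [foldl_append_flatMap, List.nil_append]
      have hlen : l₁.length ≤ sz (l a) := h₁.length_le.trans (length_lt_sz _).le
      have hsub : ∀ b ∈ l₁, sz (g a b) ≤ p.eval (1 + sz a + sz (l a)) := fun b hb =>
        (hp (a, b)).trans (eval_mono p (by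
          have := sz_le_of_mem (h₁.subset hb)
          rw [sz_mk]; omega))
      refine le_trans ?_ (Nat.add_le_add_left (Nat.mul_le_mul_right _ hlen) 1)
      clear hlen h₁
      induction l₁ with
      | nil => simp [sz_nil]
      | cons b l₁ ih =>
        have e := sz_append (g a b) (l₁.flatMap (g a))
        have e1 := ih fun b hb => hsub b (List.mem_cons_of_mem _ hb)
        have e2 := hsub b List.mem_cons_self
        rw [List.flatMap_cons, List.length_cons, Nat.add_mul]; omega
  exact h.congr_enc fun a => by rw [foldl_append_flatMap, List.nil_append]

@[fun_prop]
theorem PTF.map {l : α → List β} {g : α → β → γ} (hl : PTF l)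
    (hg : PTF fun p : α × β => g p.1 p.2) : PTF fun a => (l a).map (g a) :=
  (hl.flatMap (g := fun a b => [g a b]) (by fun_prop)).congr_enc fun a => by
    congr 1
    induction l a <;> simp_all

@[fun_prop]
theorem PTF.filter {l : α → List β} {g : α → β → Bool} (hl : PTF l)
    (hg : PTF fun p : α × β => g p.1 p.2) : PTF fun a => (l a).filter (g a) :=
  (hl.flatMap (g := fun a b => if g a b = true then [b] else []) (by fun_prop)).congr_enc fun a => by
    congr 1
    induction l a with
    | nil => rfl
    | cons b t ih => rw [List.flatMap_cons, ← ih, List.filter_cons]; split <;> rfl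

@[fun_prop]
theorem PTF.any {l : α → List β} {g : α → β → Bool} (hl : PTF l)
    (hg : PTF fun p : α × β => g p.1 p.2) : PTF fun a => (l a).any (g a) :=
  (hl.filter (g := g) hg).isEmpty.not.congr_enc fun a => by
    congr 1
    rw [Bool.eq_iff_iff]
    simp

@[fun_prop]
theorem PTF.all {l : α → List β} {g : α → β → Bool} (hl : PTF l)
    (hg : PTF fun p : α × β => g p.1 p.2) : PTF fun a => (l a).all (g a) :=
  (hl.filter (g := fun a b => !(g a b)) (by fun_prop)).isEmpty.congr_enc fun a => by
    congr 1
    rw [Bool.eq_iff_iff]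
    simp

/-! ## Unary natural numbers -/

/-- Unary numbers and lists of units are the same data, which turns bounded iteration into a fold.
-/
theorem enc_list_unit (l : List Unit) : enc l = enc l.length := by
  induction l with
  | nil => rfl
  | cons a l ih => rw [enc_cons, ih]; rfl

@[fun_prop]
theorem PTF.length {l : α → List β} (hl : PTF l) : PTF fun a => (l a).length :=
  (hl.map (g := fun _ _ => ()) (PTF.const ())).congr_enc fun a => by
    rw [enc_list_unit, List.length_map]

theorem PTF.replicateUnit {f : α → ℕ} (hf : PTF f) : PTF fun a => List.replicate (f a) () :=
  hf.congr_enc fun a => by rw [enc_list_unit, List.length_replicate]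

theorem foldl_replicate {γ : Type} (g : γ → γ) (n : ℕ) (c : γ) :
    (List.replicate n ()).foldl (fun c _ => g c) c = g^[n] c := by
  induction n generalizing c with
  | zero => rfl
  | succ n ih => exact ih (g c)

theorem PTF.iterate {f : α → ℕ} {init : α → γ} {g : α → γ → γ} (hf : PTF f) (hi : PTF init)
    (hg : PTF fun p : α × γ => g p.1 p.2) {B : α → ℕ} (hB : PolyBd B)
    (hb : ∀ a, ∀ i ≤ f a, sz ((g a)^[i] (init a)) ≤ B a) :
    PTF fun a => (g a)^[f a] (init a) := by
  refine (PTF.foldl (g := fun a c (_ : Unit) => g a c) hf.replicateUnit hi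
    (hg.comp (f := fun p : α × γ × Unit => (p.1, p.2.1)) (by fun_prop)) hB ?_).congr_enc
      fun a => by rw [foldl_replicate]
  intro a l₁ h₁
  obtain ⟨i, rfl⟩ : ∃ i, l₁ = List.replicate i () := ⟨l₁.length, by
    exact List.eq_replicate_of_mem fun _ _ => rfl⟩
  rw [foldl_replicate]
  exact hb a i (by simpa using h₁.length_le)

@[fun_prop]
theorem PTF.add {f g : α → ℕ} (hf : PTF f) (hg : PTF g) : PTF fun a => f a + g a :=
  (hf.replicateUnit.append hg.replicateUnit).length.congr_enc fun a => by simp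

@[fun_prop]
theorem PTF.sub {f g : α → ℕ} (hf : PTF f) (hg : PTF g) : PTF fun a => f a - g a := by
  have e : ∀ m n : ℕ, (fun n => n - 1)^[m] n = n - m := fun m n => Nat.pred_iterate n m
  refine (PTF.iterate (g := fun _ n => n - 1) hg hf (PTF.snd PTF.id).pred hf.polyBd_sz
    fun a i _ => ?_).congr_enc fun a => ?_
  · rw [e, sz_nat, sz_nat]; omega
  · rw [e]

@[fun_prop]
theorem PTF.le {f g : α → ℕ} (hf : PTF f) (hg : PTF g) : PTF fun a => decide (f a ≤ g a) :=
  (hf.sub hg).eqZero.congr_enc fun a => by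
    congr 1
    rw [Bool.eq_iff_iff]
    simp; omega

@[fun_prop]
theorem PTF.beq {f g : α → ℕ} (hf : PTF f) (hg : PTF g) : PTF fun a => f a == g a :=
  ((hf.le hg).and (hg.le hf)).congr_enc fun a => by
    congr 1
    rw [Bool.eq_iff_iff]
    simp; omega

@[fun_prop]
theorem PTF.min {f g : α → ℕ} (hf : PTF f) (hg : PTF g) : PTF fun a => Min.min (f a) (g a) :=
  ((hf.le hg).ite hf hg).congr_enc fun a => by
    congr 1
    simp [min_def]

@[fun_prop]
theorem PTF.range {f : α → ℕ} (hf : PTF f) : PTF fun a => List.range (f a) := by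
  have e : ∀ n : ℕ, (fun l : List ℕ => l ++ [l.length])^[n] [] = List.range n := by
    intro n
    induction n with
    | zero => rfl
    | succ n ih => rw [Function.iterate_succ_apply', ih, List.length_range, List.range_succ]
  refine (PTF.iterate (g := fun _ l => l ++ [l.length]) hf (PTF.const []) (by fun_prop)
    (B := fun a => 1 + sz (f a) * (1 + sz (f a)))
    ((PolyBd.const 1).add (hf.polyBd_sz.mul ((PolyBd.const 1).add hf.polyBd_sz)))
    fun a i hi => ?_).congr_enc fun a => by rw [e]
  rw [e]
  refine (sz_le_of_forall (B := sz (f a)) fun b hb => ?_).trans (Nat.add_le_add_left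
    (Nat.mul_le_mul_right _ ?_) 1)
  · rw [List.mem_range] at hb
    rw [sz_nat, sz_nat]; omega
  · rw [List.length_range, sz_nat]; omega

@[fun_prop]
theorem PTF.drop {f : α → ℕ} {l : α → List β} (hf : PTF f) (hl : PTF l) :
    PTF fun a => (l a).drop (f a) := by
  have e : ∀ (n : ℕ) (l : List β), List.tail^[n] l = l.drop n := by
    intro n
    induction n with
    | zero => simp
    | succ n ih => intro l; rw [Function.iterate_succ_apply', ih, List.tail_drop]
  refine (PTF.iterate (g := fun _ l => l.tail) hf hl (by fun_prop) hl.polyBd_sz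
    fun a i _ => ?_).congr_enc fun a => by rw [← e]
  exact (congrArg sz (e i (l a))).trans_le (sz_le_of_sublist (List.drop_sublist _ _))

@[fun_prop]
theorem PTF.getD [Inhabited β] {f : α → ℕ} {l : α → List β} (hf : PTF f) (hl : PTF l) :
    PTF fun a => (l a).getD (f a) default :=
  (hf.drop hl).headD.congr_enc fun a => by
    congr 1
    simp [List.headD_eq_head?_getD]

end

/-- An entry of a Boolean matrix; `false` outside of the matrix. -/
def look (M : List (List Bool)) (i j : ℕ) : Bool := (M.getD i default).getD j default

@[fun_prop]
theorem PTF.look {α : Type} [Enc α] {M : α → List (List Bool)} {i j : α → ℕ} (hM : PTF M)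
    (hi : PTF i) (hj : PTF j) : PTF fun a => look (M a) (i a) (j a) :=
  hj.getD (hi.getD hM)

end EnumKernel

/-! ### Enumeration with polynomial delay. -/

namespace EnumKernel
open Enc (enc)

/-! ## Idle periods of a trace -/

/-- After `c` idle units of time the run may proceed with the trace `t`, ending with at most `e`
idle units of time, without ever being idle for more than `D` units of time. -/
def Paced (D : ℕ) : ℕ → Trace → ℕ → Prop
  | c, [], e => c ≤ e
  | c, none :: t, e => c + 1 ≤ D ∧ Paced D (c + 1) t e
  | _, some _ :: t, e => Paced D 0 t e

theorem Paced.mono {D : ℕ} {t : Trace} {c c' e e' : ℕ} (h : Paced D c t e) (hc : c' ≤ c)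
    (he : e ≤ e') : Paced D c' t e' := by
  induction t generalizing c c' with
  | nil => exact (hc.trans h).trans he
  | cons o t ih =>
    cases o with
    | none => exact ⟨by have := h.1; omega, ih h.2 (by omega)⟩
    | some d => exact ih (c := 0) h le_rfl

theorem Paced.append {D : ℕ} {t u : Trace} {c e f : ℕ} (h : Paced D c t e) (h' : Paced D e u f) :
    Paced D c (t ++ u) f := by
  induction t generalizing c with
  | nil => exact h'.mono h le_rfl
  | cons o t ih =>
    cases o with
    | none => exact ⟨h.1, ih h.2⟩
    | some d => exact ih (c := 0) h

theorem Paced.ticks {D c m : ℕ} (h : c + m ≤ D) : Paced D c (ticks m) (c + m) := by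
  induction m generalizing c with
  | zero => exact le_rfl
  | succ m ih => exact ⟨by omega, (ih (c := c + 1) (by omega)).mono le_rfl (by omega)⟩

theorem Paced.ticks_emit {D c m e : ℕ} (d : Data) (h : c + m ≤ D) :
    Paced D c (EnumKernel.ticks m ++ [some d]) e :=
  (Paced.ticks h).append (Nat.zero_le e)

theorem Paced.of_append {D : ℕ} {t u : Trace} {c e : ℕ} (h : Paced D c (t ++ u) e) :
    ∃ c', Paced D c' u e := by
  induction t generalizing c with
  | nil => exact ⟨c, h⟩
  | cons o t ih =>
    cases o with
    | none => exact ih h.2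
    | some d => exact ih (c := 0) h

/-- Whatever the idle counter is when the block of ticks begins, it must stay at most `D` throughout
the block. -/
theorem Paced.le_of_infix {D : ℕ} {t : Trace} {c e m : ℕ} (h : Paced D c t e)
    (hm : EnumKernel.ticks m <:+: t) : m ≤ D := by
  obtain ⟨s, u, rfl⟩ := hm
  rw [List.append_assoc] at h
  obtain ⟨c', h'⟩ := h.of_append
  have : ∀ m c', Paced D c' (EnumKernel.ticks m ++ u) e → m = 0 ∨ c' + m ≤ D := by
    intro m
    induction m with
    | zero => intros; exact .inl rfl
    | succ m ih =>
      intro c' hc'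
      have h2 : c' + 1 ≤ D ∧ Paced D (c' + 1) (EnumKernel.ticks m ++ u) e := hc'
      have := ih _ h2.2
      omega
  have := this m c' h'
  omega

theorem filterMap_ticks (m : ℕ) : (ticks m).filterMap id = [] := by
  simp [ticks]

/-! ## Depth-first enumeration -/

section
variable {α ε ρ : Type} [Enc α] [Enc ε] [Enc ρ]

/-- The leaves of the tree whose nodes at height `L.length` are expanded by means of the first
element of `L`. -/
def leaves (ex : ε → ρ → List ρ) : List ε → ρ → List ρ
  | [], r => [r]
  | e :: L, r => (ex e r).flatMap (leaves ex L)

/-- One step of the depth-first search. -/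
def dfsStep [Inhabited ε] [Inhabited ρ] (ex : α → ε → ρ → List ρ) (a : α)
    (st : List (List ε × ρ)) : List (List ε × ρ) :=
  (if (st.headD default).1.isEmpty = true then [] else
    (ex a ((st.headD default).1.headD default) (st.headD default).2).map
      fun r => ((st.headD default).1.tail, r)) ++ st.tail

theorem PTF.dfsStep [Inhabited ε] [Inhabited ρ] {ex : α → ε → ρ → List ρ}
    (hex : PTF fun p : α × ε × ρ => ex p.1 p.2.1 p.2.2) :
    PTF fun p : α × List (List ε × ρ) => dfsStep ex p.1 p.2 := by
  have h : PTF fun p : α × List (List ε × ρ) =>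
      ex p.1 ((p.2.headD default).1.headD default) (p.2.headD default).2 :=
    hex.comp (f := fun p : α × List (List ε × ρ) =>
      (p.1, (p.2.headD default).1.headD default, (p.2.headD default).2)) (by fun_prop)
  unfold EnumKernel.dfsStep
  fun_prop

/-- A program that enumerates the leaves of a tree of polynomially bounded depth without dead ends,
whose nodes can be expanded in polynomial time. -/
theorem exists_enumerator [Inhabited ε] [Inhabited ρ] {init : α → List ε × ρ}
    {ex : α → ε → ρ → List ρ} (hinit : PTF init) (hex : PTF fun p : α × ε × ρ => ex p.1 p.2.1 p.2.2)
    {Inv : α → List ε → ρ → Prop} {B : α → ℕ} (hB : PolyBd B)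
    (hsz : ∀ a L r, Inv a L r → sz (L, r) ≤ B a)
    (hstep : ∀ a e L r, Inv a (e :: L) r → ex a e r ≠ [] ∧ ∀ r' ∈ ex a e r, Inv a L r') :
    ∃ (c : Prog) (D : α → ℕ), PolyBd D ∧ ∀ a, Inv a (init a).1 (init a).2 →
      ∃ t τ, Run c (initStore (enc a)) t τ ∧
        t.filterMap id = (leaves (ex a) (init a).1 (init a).2).map enc ∧
        ∀ m, ticks m <:+: t → m ≤ D a := by
  obtain ⟨q, hq⟩ := hex.polyBd_sz
  have hsi := hinit.polyBd_sz
  obtain ⟨Ti, hTi, hi⟩ := hinit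
  obtain ⟨Ts, ⟨ps, hps⟩, hs⟩ := PTF.dfsStep hex
  obtain ⟨ci, hci⟩ := hi 1
  obtain ⟨cs, hcs⟩ := hs 2
  -- Room for the list of all children of a node, whose number is at most the size of the output of
  -- `ex`, and for one more stack entry.
  let Cb : α → ℕ := fun a => 1 + q.eval (2 + sz a + 2 * B a) * (1 + B a) + (1 + B a)
  have hCb : PolyBd Cb := ((PolyBd.const 1).add ((PolyBd.eval q (((PolyBd.const 2).add .sz).add
    ((PolyBd.const 2).mul hB))).mul ((PolyBd.const 1).add hB))).add ((PolyBd.const 1).add hB)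
  -- The stack holds at most one batch of siblings for each level, and `B a` bounds the depth.
  let S : α → ℕ := fun a => 1 + (B a + 1) * Cb a
  have hS : PolyBd S := (PolyBd.const 1).add ((hB.add (PolyBd.const 1)).mul hCb)
  let W : α → ℕ := fun a => 20 + 10 * S a + 2 * sz a + ps.eval (1 + sz a + S a)
  have hW : PolyBd W := (((PolyBd.const 20).add ((PolyBd.const 10).mul hS)).add
    ((PolyBd.const 2).mul .sz)).add (PolyBd.eval ps (((PolyBd.const 1).add .sz).add hS))
  -- The preparation plus `B a + 1` rounds for a descent to a leaf; two further rounds leave room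
  -- for the idle time after the previous output and for the beginning and end of the run.
  let D : α → ℕ := fun a => (1 + sz a + Ti a + (2 + sz (init a))) + (B a + 3) * W a
  have hD : PolyBd D := ((((PolyBd.const 1).add .sz).add hTi).add ((PolyBd.const 2).add hsi)).add
    ((hB.add (PolyBd.const 3)).mul hW)
  -- Variable `0` keeps the input, `1` the stack, `2` is scratch. A top entry without remaining
  -- levels is a leaf and is emitted before it is popped.
  let body : Prog := .seq
    (.ite (.head (.head (.var 1))) (.assign 2 .nil) (.emit (.tail (.head (.var 1)))))
    (.seq (.assign 2 (.cons (.var 0) (.var 1))) (.seq cs (.assign 1 (.var 2))))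
  -- the second half of the body
  have half : ∀ a (st : List (List ε × ρ)) (σ : Store), sz st ≤ S a → σ 0 = enc a →
      σ 1 = enc st → sz (dfsStep ex a st) ≤ S a → ∃ τ k, k + 4 * S a + 10 ≤ W a ∧
        Run (.seq (.assign 2 (.cons (.var 0) (.var 1))) (.seq cs (.assign 1 (.var 2)))) σ
          (ticks k) τ ∧ τ 0 = enc a ∧ τ 1 = enc (dfsStep ex a st) := by
    intro a st σ h1 h2 h3 h4
    have s1 := Silent.assign 2 (.cons (.var 0) (.var 1)) σ
    obtain ⟨τ, h5, h6, h7⟩ := hcs (Function.update σ 2 ((Expr.cons (.var 0) (.var 1)).eval σ))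
      (a, st) (by simp [Expr.eval, h2, h3, enc_mk])
    have s3 := Silent.assign 1 (.var 2) τ
    obtain ⟨k, hk, hr⟩ := s1.seq (h5.seq s3)
    refine ⟨_, k, ?_, hr, ?_, ?_⟩
    · have e1 : Ts (a, st) ≤ ps.eval (1 + sz a + S a) := (hps _).trans (eval_mono ps (by
        rw [sz_mk]; omega))
      simp only [Expr.cost, h2, h3, h6] at hk
      simp only [sz, W] at *
      omega
    · rw [Function.update_of_ne (by omega), h7 _ (by omega)]; simp [h2]
    · simp [Expr.eval, h6]
  -- Processing the subtree on top of the stack. The run is stated as a prefix of every run of the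
  -- loop from the resulting store, since only complete loops have a `Run`. It may start after `c`
  -- idle units and leaves at most `W a`; the bound on `(L.length + 2) * W a` lets a sibling start
  -- with this remainder.
  have inner : ∀ a L r (R : List (List ε × ρ)) (σ : Store) (c : ℕ), Inv a L r → σ 0 = enc a →
      σ 1 = enc ((L, r) :: R) → sz R + (L.length + 1) * Cb a ≤ S a →
      c + (L.length + 1) * W a ≤ D a → (L.length + 2) * W a ≤ D a → 
      ∃ t τ, (∀ u υ, Run (.loop (.var 1) body) τ u υ → Run (.loop (.var 1) body) σ (t ++ u) υ) ∧
        τ 0 = enc a ∧ τ 1 = enc R ∧ t.filterMap id = (leaves (ex a) L r).map enc ∧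
        Paced (D a) c t (W a) := by
    intro a L
    induction L with
    | nil =>
      intro r R σ c hI h0 h1 hR hc hW'
      have hn := hsz _ _ _ hI
      have hst : sz (([], r) :: R) ≤ S a := by
        rw [sz_cons]; simp only [List.length_nil, Cb] at hR; omega
      have hstep : dfsStep ex a (([], r) :: R) = R := by simp [dfsStep]
      obtain ⟨τ, k, hk, hr, hτ0, hτ1⟩ := half a (([], r) :: R) σ hst h0 h1 (by
        rw [hstep]; omega)
      rw [hstep] at hτ1
      have g1 : (Expr.var 1).eval σ ≠ .nil := by simp [Expr.eval, h1, enc_cons]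
      have g2 : (Expr.head (.head (.var 1))).eval σ = .nil := by
        simp [Expr.eval, h1, enc_cons, enc_mk, Data.head, enc_nil]
      have em := (Run.emit (.tail (.head (.var 1))) σ).iteFalse (c := .assign 2 .nil) g2
      have g3 : (Expr.tail (.head (.var 1))).eval σ = enc r := by
        simp [Expr.eval, h1, enc_cons, enc_mk, Data.head, Data.tail]
      rw [g3] at em
      let m : ℕ := 1 + (Expr.var 1).cost σ + (1 + (Expr.head (.head (.var 1))).cost σ +
        (1 + (Expr.tail (.head (.var 1))).cost σ))
      have hm : m ≤ 4 * S a + 10 := by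
        simp only [m, Expr.cost, h1]
        simp only [sz] at hst
        omega
      refine ⟨ticks m ++ [some (enc r)] ++ ticks k, τ, ?_, hτ0, hτ1, ?_, ?_⟩
      · intro u υ hu
        have := Run.loopTrue (c := body) g1 (em.seq hr) hu
        simpa [m, ticks_add, List.append_assoc] using this
      · rw [List.filterMap_append, List.filterMap_append, filterMap_ticks, filterMap_ticks]; rfl
      · simp only [List.length_nil] at hc hW'
        refine ((Paced.ticks_emit (e := 0) _ (by omega)).append (Paced.ticks (by omega))).mono le_rfl
          (by omega)
    | cons e L ih =>
      -- a list of siblings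
      have sib : ∀ (rs : List ρ) (R : List (List ε × ρ)) (σ : Store) (c : ℕ),
          (∀ r ∈ rs, Inv a L r) → σ 0 = enc a → σ 1 = enc (rs.map (fun r => (L, r)) ++ R) →
          sz (rs.map (fun r => (L, r)) ++ R) + (L.length + 1) * Cb a ≤ S a → (rs = [] → c ≤ W a) →
          c + (L.length + 1) * W a ≤ D a → (L.length + 2) * W a ≤ D a →
          ∃ t τ, (∀ u υ, Run (.loop (.var 1) body) τ u υ →
            Run (.loop (.var 1) body) σ (t ++ u) υ) ∧ τ 0 = enc a ∧ τ 1 = enc R ∧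
            t.filterMap id = (rs.flatMap (leaves (ex a) L)).map enc ∧ Paced (D a) c t (W a) := by
        intro rs
        induction rs with
        | nil =>
          intro R σ c _ h0 h1 hR hc0 hc hW'
          exact ⟨[], σ, fun u υ hu => hu, h0, by simpa using h1, rfl, hc0 rfl⟩
        | cons r rs ihr =>
          intro R σ c hI h0 h1 hR hc0 hc hW'
          obtain ⟨t, τ, h2, h3, h4, h5, h6⟩ := ih r (rs.map (fun r => (L, r)) ++ R) σ c
            (hI r List.mem_cons_self) h0 h1 (by
              rw [List.map_cons, List.cons_append, sz_cons] at hR; omega) hc hW'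
          obtain ⟨t', τ', h2', h3', h4', h5', h6'⟩ := ihr R τ (W a)
            (fun r hr => hI r (List.mem_cons_of_mem _ hr)) h3 h4 (by
              rw [List.map_cons, List.cons_append, sz_cons] at hR; omega) (fun _ => le_rfl)
              (by rw [Nat.add_mul] at hW' ⊢; omega) hW'
          refine ⟨t ++ t', τ', fun u υ hu => ?_, h3', h4', ?_, h6.append h6'⟩
          · rw [List.append_assoc]; exact h2 _ _ (h2' _ _ hu)
          · rw [List.filterMap_append, h5, h5', List.flatMap_cons, List.map_append]
      intro r R σ c hI h0 h1 hR hc hW'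
      have hn := hsz _ _ _ hI
      obtain ⟨hne, hch⟩ := hstep _ _ _ _ hI
      have hst : sz ((e :: L, r) :: R) ≤ S a := by
        have : Cb a ≤ ((e :: L).length + 1) * Cb a := Nat.le_mul_of_pos_left _ (by omega)
        rw [sz_cons]; simp only [Cb] at hR this; omega
      have hstp : dfsStep ex a ((e :: L, r) :: R) = (ex a e r).map (fun r => (L, r)) ++ R := by
        simp [dfsStep]
      have hchsz : sz ((ex a e r).map (fun r => (L, r))) ≤ Cb a := by
        refine (sz_le_of_forall (B := B a) fun x hx => ?_).trans ?_
        · obtain ⟨r', hr', rfl⟩ := List.mem_map.1 hx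
          exact hsz _ _ _ (hch r' hr')
        · rw [List.length_map]
          have : (ex a e r).length ≤ q.eval (2 + sz a + 2 * B a) := by
            refine (length_lt_sz _).le.trans ((hq (a, e, r)).trans (eval_mono q ?_))
            rw [sz_mk, sz_cons] at hn
            rw [sz_mk, sz_mk]; omega
          have := Nat.mul_le_mul_right (1 + B a) this
          simp only [Cb]; omega
      have hsz2 : sz ((ex a e r).map (fun r => (L, r)) ++ R) + (L.length + 1) * Cb a ≤ S a := by
        have := sz_append ((ex a e r).map (fun r => (L, r))) R
        rw [List.length_cons, Nat.add_mul _ 1] at hR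
        omega
      obtain ⟨τ, k, hk, hr, hτ0, hτ1⟩ := half a ((e :: L, r) :: R)
        (Function.update σ 2 (Expr.nil.eval σ)) hst (by simp [h0]) (by simp [h1]) (by
          rw [hstp]; omega)
      rw [hstp] at hτ1
      have g1 : (Expr.var 1).eval σ ≠ .nil := by simp [Expr.eval, h1, enc_cons]
      have g2 : (Expr.head (.head (.var 1))).eval σ ≠ .nil := by
        simp [Expr.eval, h1, enc_cons, enc_mk, Data.head]
      have em := (Run.assign 2 .nil σ).iteTrue (d := .emit (.tail (.head (.var 1)))) g2
      let m : ℕ := 1 + (Expr.var 1).cost σ + (1 + (Expr.head (.head (.var 1))).cost σ +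
        (1 + Expr.nil.cost σ))
      have hm : m ≤ 4 * S a + 10 := by
        simp only [m, Expr.cost, h1]
        simp only [sz] at hst
        omega
      have hWk : m + k ≤ W a := by omega
      rw [List.length_cons] at hc hW'
      obtain ⟨t, υ, h2, h3, h4, h5, h6⟩ := sib (ex a e r) R τ (c + (m + k)) hch hτ0 hτ1 hsz2
        -- The absence of dead ends is used here: without children, the accumulated idle time would
        -- be passed on without an output.
        (fun h => absurd h hne) (by rw [Nat.add_mul (L.length + 1) 1] at hc; omega)
        (by
          rw [Nat.add_mul (L.length + 1) 2, Nat.add_mul L.length 1] at hW'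
          rw [Nat.add_mul L.length 2]
          omega)
      refine ⟨ticks (m + k) ++ t, υ, fun u ξ hu => ?_, h3, h4, ?_, ?_⟩
      · have := Run.loopTrue (c := body) g1 (em.seq hr) (h2 u ξ hu)
        simpa [m, ticks_add, List.append_assoc] using this
      · rw [List.filterMap_append, filterMap_ticks, h5]; rfl
      · exact (Paced.ticks (by rw [Nat.add_mul (L.length + 1) 1] at hc; omega)).append h6
  refine ⟨.seq (.seq (.assign 1 (.var 0)) (.seq ci (.assign 1 (.cons (.var 1) .nil))))
    (.loop (.var 1) body), D, hD, fun a hI => ?_⟩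
  have s1 := Silent.assign 1 (.var 0) (initStore (enc a))
  obtain ⟨τ, h1, h2, h3⟩ := hci (Function.update (initStore (enc a)) 1
    ((Expr.var 0).eval (initStore (enc a)))) a (by simp [Expr.eval, initStore])
  have s2 := Silent.assign 1 (.cons (.var 1) .nil) τ
  obtain ⟨k, hk, hr⟩ := s1.seq (h1.seq s2)
  have hkD : k ≤ 1 + sz a + Ti a + (2 + sz (init a) + 1) := by
    have : initStore (enc a) 0 = enc a := rfl
    simp only [Expr.cost, h2, this] at hk
    simp only [sz]
    omega
  have hn := hsz _ _ _ hI
  have hlen : (init a).1.length ≤ B a := by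
    have := length_lt_sz (init a).1
    rw [sz_mk] at hn; omega
  have hW1 : 1 ≤ W a := by simp only [W]; omega
  have m1 : ((init a).1.length + 1) * W a ≤ (B a + 1) * W a := Nat.mul_le_mul_right _ (by omega)
  have m2 : ((init a).1.length + 2) * W a ≤ (B a + 2) * W a := Nat.mul_le_mul_right _ (by omega)
  have m3 : (B a + 3) * W a = (B a + 1) * W a + 2 * W a := by ring
  have m4 : (B a + 3) * W a = (B a + 2) * W a + W a := by ring
  obtain ⟨t, υ, h4, h5, h6, h7, h8⟩ := inner a (init a).1 (init a).2 []
    (Function.update τ 1 ((Expr.cons (.var 1) .nil).eval τ)) k hI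
    (by rw [Function.update_of_ne (by omega), h3 _ (by omega)]; simp [initStore])
    (by simp [Expr.eval, h2, enc_cons, enc_nil]) (by
      have : ((init a).1.length + 1) * Cb a ≤ (B a + 1) * Cb a := Nat.mul_le_mul_right _ (by omega)
      rw [sz_nil]; simp only [S]; omega)
    (by simp only [D]; omega) (by simp only [D]; omega)
  have hlast := Run.loopFalse (e := .var 1) (c := body) (σ := υ) h6
  refine ⟨_, υ, hr.seq (h4 _ _ hlast), ?_, fun m hm => ?_⟩
  · rw [List.filterMap_append, List.filterMap_append, filterMap_ticks, filterMap_ticks, h7]; simp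
  · have hc2 : 1 + (Expr.var 1).cost υ = 2 := by simp [Expr.cost, h6, enc_nil, Data.size]
    have p1 : Paced (D a) 0 (ticks k) k := (Paced.ticks (by simp only [D]; omega)).mono le_rfl (by omega)
    have hW2 : 2 ≤ W a := by simp only [W]; omega
    have p3 : Paced (D a) (W a) (ticks (1 + (Expr.var 1).cost υ)) (W a + 2) := by
      rw [hc2]; exact Paced.ticks (by simp only [D]; omega)
    exact (p1.append (h8.append p3)).le_of_infix hm

end
end EnumKernel

/-! ### The compressor and the lifting algorithm as polynomial-time maps. -/

namespace EnumKernel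
open Enc (enc)

/-! ## Binary numbers -/

/-- The minimum of `c` and the number with the given binary digits. -/
def truncVal (l : List Bool) (c : ℕ) : ℕ :=
  l.foldr (fun b n => min (if b = true then n + n + 1 else n + n) c) 0

/-- Truncating after each digit is harmless, because doubling and adding a digit is monotone and
never decreases a number. -/
theorem truncVal_bits (n c : ℕ) : truncVal n.bits c = min n c := by
  induction n using Nat.binaryRec' with
  | zero => simp [truncVal]
  | bit b n h ih =>
    rw [Nat.bits_append_bit n b h, truncVal, List.foldr_cons, ← truncVal, ih]
    cases b <;> simp only [Nat.bit_val, Bool.toNat] <;> simp <;> omega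

/-- A binary number cannot be converted to unary in polynomial time; the cap keeps the accumulator
small. -/
theorem PTF.truncVal {α : Type} [Enc α] {f : α → List Bool} {g : α → ℕ} (hf : PTF f) (hg : PTF g) :
    PTF fun a => truncVal (f a) (g a) := by
  refine (PTF.foldl (g := fun a n b => Min.min (if b = true then n + n + 1 else n + n) (g a))
    hf.reverse (PTF.const 0) ?_ (hg.polyBd_sz) ?_).congr_enc fun a => by
      rw [EnumKernel.truncVal, List.foldr_eq_foldl_reverse]
  · have : PTF fun p : α × ℕ × Bool => g p.1 := hg.comp (f := fun p : α × ℕ × Bool => p.1)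
      (by fun_prop)
    fun_prop
  · intro a l₁ _
    rw [sz_nat, sz_nat]
    induction l₁ using List.reverseRecOn with
    | nil => simp
    | append_singleton l b => rw [List.foldl_append]; simp

/-- Binary increment. -/
def incBits : List Bool → List Bool
  | [] => [true]
  | false :: l => true :: l
  | true :: l => false :: incBits l

theorem incBits_bits (n : ℕ) : incBits n.bits = (n + 1).bits := by
  induction n using Nat.binaryRec' with
  | zero => rfl
  | bit b n h ih =>
    rw [Nat.bits_append_bit n b h]
    cases b with
    | false =>
      rw [show Nat.bit false n + 1 = Nat.bit true n by simp [Nat.bit_val],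
        Nat.bits_append_bit n true (by simp)]
      rfl
    | true =>
      rw [show Nat.bit true n + 1 = Nat.bit false (n + 1) by simp [Nat.bit_val]; omega,
        Nat.bits_append_bit (n + 1) false (by simp), ← ih]
      rfl

/-- One digit of the binary increment: the carry and the reversed digits so far. -/
def incStep (s : Bool × List Bool) (b : Bool) : Bool × List Bool :=
  (s.1 && b, Bool.xor s.1 b :: s.2)

/-- The fold with an arbitrary carry and output so far; a carry left at the end becomes the leading
digit. -/
theorem foldl_incStep (l : List Bool) (s : Bool × List Bool) :
    ((if (l.foldl incStep s).1 = true then true :: (l.foldl incStep s).2 else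
      (l.foldl incStep s).2).reverse) = s.2.reverse ++ if s.1 = true then incBits l else l := by
  induction l generalizing s with
  | nil => cases h : s.1 <;> simp [h, incBits]
  | cons b l ih =>
    obtain ⟨c, o⟩ := s
    rw [List.foldl_cons, ih]
    cases c <;> cases b <;> simp [incStep, incBits]

theorem PTF.incBits' : PTF incBits := by
  have h : PTF fun l : List Bool => l.foldl incStep (true, []) := by
    refine PTF.foldl (g := fun _ => incStep) PTF.id (PTF.const _) (by unfold incStep; fun_prop)
      (B := fun l => 5 + 4 * sz l) ((PolyBd.const 5).add ((PolyBd.const 4).mul .sz)) ?_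
    intro l l₁ h₁
    have : ∀ (l₁ : List Bool) s, sz (l₁.foldl incStep s).2 ≤ sz s.2 + 4 * l₁.length := by
      intro l₁
      induction l₁ with
      | nil => simp
      | cons b l₁ ih =>
        intro s
        refine (ih _).trans ?_
        have := sz_bool (Bool.xor s.1 b)
        simp only [incStep, sz_cons, List.length_cons]; omega
    have h2 := this l₁ (true, [])
    have h3 := sz_bool (l₁.foldl incStep (true, [])).1
    have h4 := h₁.length_le
    have h5 := length_lt_sz l
    rw [sz_nil] at h2
    rw [sz_mk]; omega
  have h' : PTF fun l : List Bool => (if (l.foldl incStep (true, [])).1 = true then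
      true :: (l.foldl incStep (true, [])).2 else (l.foldl incStep (true, [])).2).reverse := by
    fun_prop
  exact h'.congr_enc fun l => by rw [foldl_incStep]; simp

theorem sz_bits_le (n : ℕ) : sz n.bits ≤ 1 + 4 * n := by
  refine (sz_le_of_forall (B := 3) fun b _ => sz_bool b).trans ?_
  have : n.bits.length ≤ n := by
    rw [Nat.size_eq_bits_len, Nat.size_le]; exact Nat.lt_two_pow_self
  omega

/-- Counting up from zero takes as many increments as the value, which is affordable for a unary
argument. -/
theorem PTF.bits {α : Type} [Enc α] {f : α → ℕ} (hf : PTF f) : PTF fun a => (f a).bits := by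
  have e : ∀ n : ℕ, incBits^[n] [] = n.bits := by
    intro n
    induction n with
    | zero => simp
    | succ n ih => rw [Function.iterate_succ_apply', ih, incBits_bits]
  refine (PTF.iterate (g := fun _ l => incBits l) hf (PTF.const []) (PTF.incBits'.comp (by fun_prop))
    (B := fun a => 1 + 4 * sz (f a)) ((PolyBd.const 1).add ((PolyBd.const 4).mul hf.polyBd_sz))
    fun a i hi => ?_).congr_enc fun a => by rw [← e]
  refine (congrArg sz (e i)).trans_le ((sz_bits_le i).trans ?_)
  rw [sz_nat]; omega

/-! ## The algorithms -/

/-- Boolean matrices. -/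
abbrev Mat : Type := List (List Bool)

/-- The neighbours of `v` in `K`. -/
def nbrs (M : Mat) (K : List ℕ) (v : ℕ) : List ℕ := K.filter fun w => look M v w

/-- The pendant vertices of `K` at `u`. -/
def pend (M : Mat) (K : List ℕ) (u : ℕ) : List ℕ :=
  K.filter fun p => look M p u && (nbrs M K p).length == 1

/-- The common neighbours of `u` and `w` in `K`. -/
def common (M : Mat) (K : List ℕ) (u w : ℕ) : List ℕ := K.filter fun z => look M u z && look M w z

/-- The vertex `v` may be removed from the graph on `v` and `K`: it is isolated, or pendant at a
vertex with another pendant neighbour, or its neighbours pairwise have three more common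
neighbours. -/
def removable (M : Mat) (K : List ℕ) (v : ℕ) : Bool :=
  (!((nbrs M K v).length == 1) || !(pend M K ((nbrs M K v).headD default)).isEmpty) &&
    (nbrs M K v).all fun u => (nbrs M K v).all fun w =>
      u == w || decide (3 ≤ (common M K u w).length)

/-- The vertices other than `v`. -/
def without (K : List ℕ) (v : ℕ) : List ℕ := K.filter fun w => !(w == v)

/-- Remove `v` if possible. The state consists of the remaining vertices, the required number of
parts, and the log of the removed vertices with the former required numbers of parts. -/
def passStep (M : Mat) (s : List ℕ × ℕ × List (ℕ × ℕ)) (v : ℕ) : List ℕ × ℕ × List (ℕ × ℕ) :=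
  if removable M (without s.1 v) v = true then
    (without s.1 v, (if (nbrs M (without s.1 v) v).isEmpty = true then s.2.1 - 1 else s.2.1),
      (v, s.2.1) :: s.2.2)
  else s

/-- Remove vertices from the graph with the adjacency matrix `M`. -/
def pass (M : Mat) (l : ℕ) : List ℕ × ℕ × List (ℕ × ℕ) :=
  (List.range M.length).foldl (passStep M) (List.range M.length, l, [])

/-- The first elements of the classes of `r` on `K`. -/
def reps (r : Mat) (K : List ℕ) : List ℕ :=
  K.filter fun w => K.all fun j => !(look r j w) || decide (w ≤ j)

/-- The domain of `r`. -/
def supp (n : ℕ) (r : Mat) : List ℕ := (List.range n).filter fun i => look r i i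

/-- The ways to extend `r` to `v`, where `K` is the domain of `r`. -/
def descs (M : Mat) (K : List ℕ) (v l : ℕ) (r : Mat) : List (ℕ × ℕ × ℕ) :=
  if (nbrs M K v).isEmpty = true then
    (v, v, v) :: if decide (l ≤ (reps r K).length) = true then (reps r K).map fun w => (w, v, v)
      else []
  else
    ((nbrs M K v).headD default, v, v) ::
      if ((nbrs M K v).length == 1 && !(look r ((pend M K ((nbrs M K v).headD default)).headD default)
        ((nbrs M K v).headD default))) = true then
        [((pend M K ((nbrs M K v).headD default)).headD default,
          (pend M K ((nbrs M K v).headD default)).headD default, (nbrs M K v).headD default)]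
      else []

/-- The map that sends `v` to `a`, `p` to `b`, and fixes everything else. -/
def move (v a p b i : ℕ) : ℕ := if (i == v) = true then a else if (i == p) = true then b else i

/-- Pull back `r` along `move v a p b`, and put `v` into a class. -/
def pullMat (n v a p b : ℕ) (r : Mat) : Mat :=
  (List.range n).map fun i => (List.range n).map fun j =>
    look r (move v a p b i) (move v a p b j) || (i == v && j == v)

/-- The extensions of `r` to the vertex `e.1`, where at least `e.2` parts are required. -/
def children (M : Mat) (e : ℕ × ℕ) (r : Mat) : List Mat :=
  (descs M (supp M.length r) e.1 e.2 r).map fun d => pullMat M.length e.1 d.1 d.2.1 d.2.2 r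

/-- The vertices of the clique that is attached to a graph with `m` vertices. -/
def gadget (m i : ℕ) : Bool := i == 0 || decide (m ≤ i)

/-- The adjacency matrix of the graph induced on `K` with a clique attached to its first vertex. -/
def kerMat (M : Mat) (K : List ℕ) : Mat :=
  (List.range (K.length + K.length + K.length)).map fun i =>
    (List.range (K.length + K.length + K.length)).map fun j =>
      !(i == j) && ((decide (i + 1 ≤ K.length) && decide (j + 1 ≤ K.length) &&
        look M (K.getD i default) (K.getD j default)) || (gadget K.length i && gadget K.length j))

/-- The relation on `K` given by a relation on the indices of `K`. -/
def unker (n : ℕ) (K : List ℕ) (s : Mat) : Mat :=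
  (List.range n).map fun i => (List.range n).map fun j =>
    (List.range K.length).any fun a => (List.range K.length).any fun b =>
      K.getD a default == i && K.getD b default == j && look s a b

/-- The result of the removals for a matrix and a required number of parts in binary. -/
def passBits (p : Mat × List Bool) : List ℕ × ℕ × List (ℕ × ℕ) :=
  pass p.1 (truncVal p.2 (p.1.length + 1))

/-- The compressor. -/
def compressFun (p : (Mat × List Bool) × List Bool) : (Mat × List Bool) × List Bool :=
  ((kerMat p.1.1 (passBits p.1).1,
    (min (passBits p.1).2.1 ((passBits p.1).1.length + 1)).bits),
    ((passBits p.1).1.length - 1).bits)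

/-- The type of the inputs of the lifting algorithm. -/
abbrev LiftInput : Type :=
  ((Mat × List Bool) × List Bool) × ((Mat × List Bool) × List Bool) × Mat

/-- The root of the search tree of the lifting algorithm. -/
def liftInit (p : LiftInput) : List (ℕ × ℕ) × Mat :=
  ((passBits p.1.1).2.2, unker p.1.1.1.length (passBits p.1.1).1 p.2.2)

section
variable {α : Type} [Enc α]

@[fun_prop]
theorem PTF.nbrs {M : α → Mat} {K : α → List ℕ} {v : α → ℕ} (hM : PTF M) (hK : PTF K)
    (hv : PTF v) : PTF fun a => nbrs (M a) (K a) (v a) := by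
  unfold EnumKernel.nbrs; fun_prop

@[fun_prop]
theorem PTF.pend {M : α → Mat} {K : α → List ℕ} {v : α → ℕ} (hM : PTF M) (hK : PTF K)
    (hv : PTF v) : PTF fun a => pend (M a) (K a) (v a) := by
  unfold EnumKernel.pend; fun_prop

@[fun_prop]
theorem PTF.common {M : α → Mat} {K : α → List ℕ} {v w : α → ℕ} (hM : PTF M) (hK : PTF K)
    (hv : PTF v) (hw : PTF w) : PTF fun a => common (M a) (K a) (v a) (w a) := by
  unfold EnumKernel.common; fun_prop

@[fun_prop]
theorem PTF.removable {M : α → Mat} {K : α → List ℕ} {v : α → ℕ} (hM : PTF M) (hK : PTF K)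
    (hv : PTF v) : PTF fun a => removable (M a) (K a) (v a) := by
  unfold EnumKernel.removable; fun_prop

@[fun_prop]
theorem PTF.without {K : α → List ℕ} {v : α → ℕ} (hK : PTF K)
    (hv : PTF v) : PTF fun a => without (K a) (v a) := by
  unfold EnumKernel.without; fun_prop

@[fun_prop]
theorem PTF.passStep {M : α → Mat} {s : α → List ℕ × ℕ × List (ℕ × ℕ)} {v : α → ℕ} (hM : PTF M)
    (hs : PTF s) (hv : PTF v) : PTF fun a => passStep (M a) (s a) (v a) := by
  unfold EnumKernel.passStep; fun_prop

/-- The invariant that keeps the state of the pass small; together with the length of the log it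
supplies the accumulator bound for the fold. -/
theorem passStep_bounds {M : Mat} {s : List ℕ × ℕ × List (ℕ × ℕ)} {v n l : ℕ} (hv : v < n)
    (h : s.1.Sublist (List.range n) ∧ s.2.1 ≤ l ∧ ∀ e ∈ s.2.2, e.1 < n ∧ e.2 ≤ l) :
    (passStep M s v).1.Sublist (List.range n) ∧ (passStep M s v).2.1 ≤ l ∧
      ∀ e ∈ (passStep M s v).2.2, e.1 < n ∧ e.2 ≤ l := by
  unfold passStep
  split
  · refine ⟨List.filter_sublist.trans h.1, ?_, ?_⟩
    · have := h.2.1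
      simp only
      split <;> omega
    · intro e he
      rcases List.mem_cons.1 he with rfl | he
      · exact ⟨hv, h.2.1⟩
      · exact h.2.2 e he
  · exact h

theorem passStep_log_length (M : Mat) (s : List ℕ × ℕ × List (ℕ × ℕ)) (v : ℕ) :
    (passStep M s v).2.2.length ≤ s.2.2.length + 1 := by
  unfold passStep
  split <;> simp

theorem foldl_passStep_bounds {M : Mat} {n l : ℕ} {L : List ℕ} (hL : ∀ v ∈ L, v < n) :
    (L.foldl (passStep M) (List.range n, l, [])).1.Sublist (List.range n) ∧
      (L.foldl (passStep M) (List.range n, l, [])).2.1 ≤ l ∧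
      (∀ e ∈ (L.foldl (passStep M) (List.range n, l, [])).2.2, e.1 < n ∧ e.2 ≤ l) ∧
      (L.foldl (passStep M) (List.range n, l, [])).2.2.length ≤ L.length := by
  induction L using List.reverseRecOn with
  | nil => simp
  | append_singleton L v ih =>
    obtain ⟨h1, h2, h3, h4⟩ := ih fun w hw => hL w (List.mem_append_left _ hw)
    rw [List.foldl_append, List.foldl_cons, List.foldl_nil]
    have := passStep_bounds (M := M) (hL v (by simp)) ⟨h1, h2, h3⟩
    refine ⟨this.1, this.2.1, this.2.2, ?_⟩
    rw [List.length_append, List.length_singleton]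
    exact (passStep_log_length M _ v).trans (by omega)

theorem sz_range_le (n : ℕ) : sz (List.range n) ≤ 1 + n * (2 * n + 2) := by
  refine (sz_le_of_forall (B := 2 * n + 1) fun b hb => ?_).trans (by
    rw [List.length_range, show 1 + (2 * n + 1) = 2 * n + 2 by ring])
  rw [List.mem_range] at hb; rw [sz_nat]; omega

theorem sz_log_le {L : List (ℕ × ℕ)} {n l : ℕ} (h : ∀ e ∈ L, e.1 < n ∧ e.2 ≤ l) :
    sz L ≤ 1 + L.length * (2 * n + 2 * l + 4) := by
  refine (sz_le_of_forall (B := 2 * n + 2 * l + 3) fun e he => ?_).trans (by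
    rw [show 1 + (2 * n + 2 * l + 3) = 2 * n + 2 * l + 4 by ring])
  have := h e he
  rw [show sz e = 1 + sz e.1 + sz e.2 from rfl, sz_nat, sz_nat]; omega

theorem PTF.pass {M : α → Mat} {l : α → ℕ} (hM : PTF M) (hl : PTF l) :
    PTF fun a => pass (M a) (l a) := by
  have hn := hM.length.polyBd_sz.mono (S := fun a => (M a).length) fun a => by rw [sz_nat]; omega
  have hl' := hl.polyBd_sz.mono (S := l) fun a => by rw [sz_nat]; omega
  refine PTF.foldl (l := fun a => List.range (M a).length)
    (g := fun a => EnumKernel.passStep (M a)) (by fun_prop) (by fun_prop) (by fun_prop)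
    (B := fun a => 2 + (1 + (M a).length * (2 * (M a).length + 2)) + (1 + 2 * l a) +
      (1 + (M a).length * (2 * (M a).length + 2 * l a + 4))) ?_ ?_
  · exact (((PolyBd.const 2).add ((PolyBd.const 1).add (hn.mul (((PolyBd.const 2).mul hn).add
      (PolyBd.const 2))))).add ((PolyBd.const 1).add ((PolyBd.const 2).mul hl'))).add
      ((PolyBd.const 1).add (hn.mul ((((PolyBd.const 2).mul hn).add
        ((PolyBd.const 2).mul hl')).add (PolyBd.const 4))))
  · intro a l₁ h₁
    obtain ⟨h1, h2, h3, h4⟩ := foldl_passStep_bounds (M := M a) (n := (M a).length) (l := l a)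
      (L := l₁) fun v hv => List.mem_range.1 (h₁.subset hv)
    have e1 := (sz_le_of_sublist h1).trans (sz_range_le _)
    have e2 := sz_log_le h3
    have e3 : l₁.length ≤ (M a).length := by simpa using h₁.length_le
    have e4 := Nat.mul_le_mul_right (2 * (M a).length + 2 * l a + 4) (h4.trans e3)
    rw [show ∀ s : List ℕ × ℕ × List (ℕ × ℕ), sz s = 1 + sz s.1 + (1 + sz s.2.1 + sz s.2.2) from
      fun _ => rfl, sz_nat]
    omega

@[fun_prop]
theorem PTF.reps {r : α → Mat} {K : α → List ℕ} (hr : PTF r) (hK : PTF K) :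
    PTF fun a => reps (r a) (K a) := by
  unfold EnumKernel.reps; fun_prop

@[fun_prop]
theorem PTF.supp {n : α → ℕ} {r : α → Mat} (hn : PTF n) (hr : PTF r) :
    PTF fun a => supp (n a) (r a) := by
  unfold EnumKernel.supp; fun_prop

@[fun_prop]
theorem PTF.descs {M : α → Mat} {K : α → List ℕ} {v l : α → ℕ} {r : α → Mat} (hM : PTF M)
    (hK : PTF K) (hv : PTF v) (hl : PTF l) (hr : PTF r) :
    PTF fun a => descs (M a) (K a) (v a) (l a) (r a) := by
  unfold EnumKernel.descs; fun_prop

@[fun_prop]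
theorem PTF.move {v a p b i : α → ℕ} (hv : PTF v) (ha : PTF a) (hp : PTF p) (hb : PTF b)
    (hi : PTF i) : PTF fun x => move (v x) (a x) (p x) (b x) (i x) := by
  unfold EnumKernel.move; fun_prop

@[fun_prop]
theorem PTF.pullMat {n v a p b : α → ℕ} {r : α → Mat} (hn : PTF n) (hv : PTF v) (ha : PTF a)
    (hp : PTF p) (hb : PTF b) (hr : PTF r) :
    PTF fun x => pullMat (n x) (v x) (a x) (p x) (b x) (r x) := by
  unfold EnumKernel.pullMat; fun_prop

@[fun_prop]
theorem PTF.children {M : α → Mat} {e : α → ℕ × ℕ} {r : α → Mat} (hM : PTF M) (he : PTF e)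
    (hr : PTF r) : PTF fun a => children (M a) (e a) (r a) := by
  unfold EnumKernel.children; fun_prop

@[fun_prop]
theorem PTF.kerMat {M : α → Mat} {K : α → List ℕ} (hM : PTF M) (hK : PTF K) :
    PTF fun a => kerMat (M a) (K a) := by
  unfold EnumKernel.kerMat EnumKernel.gadget; fun_prop

@[fun_prop]
theorem PTF.unker {n : α → ℕ} {K : α → List ℕ} {s : α → Mat} (hn : PTF n) (hK : PTF K)
    (hs : PTF s) : PTF fun a => unker (n a) (K a) (s a) := by
  unfold EnumKernel.unker; fun_prop

@[fun_prop]
theorem PTF.passBits {f : α → Mat × List Bool} (hf : PTF f) : PTF fun a => passBits (f a) :=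
  PTF.pass hf.fst (PTF.truncVal hf.snd hf.fst.length.succ)

end

theorem PTF.compressFun : PTF compressFun := by
  have h1 : PTF fun p : (Mat × List Bool) × List Bool =>
      Min.min (EnumKernel.passBits p.1).2.1 ((EnumKernel.passBits p.1).1.length + 1) := by fun_prop
  have h2 : PTF fun p : (Mat × List Bool) × List Bool =>
      (EnumKernel.passBits p.1).1.length - 1 := by fun_prop
  exact ((show PTF fun p : (Mat × List Bool) × List Bool =>
    EnumKernel.kerMat p.1.1 (EnumKernel.passBits p.1).1 by fun_prop).prodMk h1.bits).prodMk h2.bits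

theorem PTF.liftInit : PTF liftInit := by
  unfold EnumKernel.liftInit; fun_prop

end EnumKernel

/-! ### Extending and restricting matching multicuts by one vertex. -/

namespace EnumKernel
open Enc (enc)

/-! ## Matching multicuts as partial equivalence relations -/

/-- `R` is an equivalence relation on `K`, and its classes form a matching multicut of the graph
that `A` induces on `K`. -/
structure IsMM (A : ℕ → ℕ → Bool) (K : Finset ℕ) (R : ℕ → ℕ → Bool) : Prop where
  refl_iff : ∀ i, R i i ↔ i ∈ K
  symm : ∀ i j, R i j → R j i
  trans : ∀ i j k, R i j → R j k → R i k
  cut : ∀ y ∈ K, ∀ a ∈ K, ∀ b ∈ K, A y a → A y b → ¬ R y a → ¬ R y b → a = b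

/-- The class of `i`. -/
def cls (K : Finset ℕ) (R : ℕ → ℕ → Bool) (i : ℕ) : Finset ℕ := K.filter fun j => R i j

/-- The number of classes. -/
def ncls (K : Finset ℕ) (R : ℕ → ℕ → Bool) : ℕ := (K.image (cls K R)).card

section
variable {A : ℕ → ℕ → Bool} {K : Finset ℕ} {R : ℕ → ℕ → Bool}

theorem IsMM.mem_left (h : IsMM A K R) {i j : ℕ} (hij : R i j) : i ∈ K :=
  (h.refl_iff i).1 (h.trans _ _ _ hij (h.symm _ _ hij))

theorem IsMM.mem_right (h : IsMM A K R) {i j : ℕ} (hij : R i j) : j ∈ K :=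
  h.mem_left (h.symm _ _ hij)

theorem IsMM.cls_eq_iff (h : IsMM A K R) {i j : ℕ} (_hi : i ∈ K) (hj : j ∈ K) :
    cls K R i = cls K R j ↔ R i j := by
  constructor
  · intro e
    have : j ∈ cls K R j := Finset.mem_filter.2 ⟨hj, (h.refl_iff j).2 hj⟩
    rw [← e] at this
    exact (Finset.mem_filter.1 this).2
  · intro e
    ext k
    simp only [cls, Finset.mem_filter]
    exact and_congr_right fun _ => ⟨h.trans _ _ _ (h.symm _ _ e), h.trans _ _ _ e⟩

theorem card_image_le_of_imp {α β γ : Type} [DecidableEq β] [DecidableEq γ] {f : α → β} {g : α → γ}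
    {s : Finset α} (h : ∀ a ∈ s, ∀ b ∈ s, g a = g b → f a = f b) :
    (s.image f).card ≤ (s.image g).card := by
  rcases s.eq_empty_or_nonempty with rfl | ⟨x, -⟩
  · simp
  have : Nonempty α := ⟨x⟩
  have h' : ∀ y ∈ s.image f, ∃ a ∈ s, f a = y := fun y hy => Finset.mem_image.1 hy
  choose! c hc hfc using h'
  refine Finset.card_le_card_of_injOn (fun y => g (c y))
    (fun y hy => Finset.mem_image_of_mem g (hc y hy)) fun y hy z hz e => ?_
  rw [← hfc y hy, ← hfc z hz]
  exact h _ (hc y hy) _ (hc z hz) e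

theorem card_image_eq_of_iff {α β γ : Type} [DecidableEq β] [DecidableEq γ] {f : α → β} {g : α → γ}
    {s : Finset α} (h : ∀ a ∈ s, ∀ b ∈ s, f a = f b ↔ g a = g b) :
    (s.image f).card = (s.image g).card :=
  le_antisymm (card_image_le_of_imp fun a ha b hb => (h a ha b hb).2)
    (card_image_le_of_imp fun a ha b hb => (h a ha b hb).1)

/-- Pulling back along a map that meets every class keeps the number of classes. -/
theorem IsMM.ncls_eq {A' : ℕ → ℕ → Bool} {K' : Finset ℕ} {R' : ℕ → ℕ → Bool} {ρ : ℕ → ℕ}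
    (h : IsMM A K R) (h' : IsMM A' K' R') (hρ : ∀ i ∈ K', ρ i ∈ K) (hR : ∀ i ∈ K', ∀ j ∈ K', R' i j = R (ρ i) (ρ j))
    (hs : ∀ i ∈ K, ∃ j ∈ K', R (ρ j) i) : ncls K' R' = ncls K R := by
  have e : (K'.image fun i => cls K R (ρ i)) = K.image (cls K R) := by
    ext c
    simp only [Finset.mem_image]
    constructor
    · rintro ⟨i, hi, rfl⟩
      exact ⟨ρ i, hρ i hi, rfl⟩
    · rintro ⟨i, hi, rfl⟩
      obtain ⟨j, hj, hji⟩ := hs i hi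
      exact ⟨j, hj, (h.cls_eq_iff (hρ j hj) hi).2 hji⟩
  rw [ncls, ncls, ← e]
  refine card_image_eq_of_iff fun i hi j hj => ?_
  rw [h'.cls_eq_iff hi hj, h.cls_eq_iff (hρ i hi) (hρ j hj), hR i hi j hj]

/-- The restriction of a relation to a set. -/
def restr (K : Finset ℕ) (R : ℕ → ℕ → Bool) (i j : ℕ) : Bool := R i j && decide (i ∈ K ∧ j ∈ K)

theorem restr_iff {i j : ℕ} : restr K R i j ↔ R i j ∧ i ∈ K ∧ j ∈ K := by
  simp [restr]

theorem IsMM.restr {K' : Finset ℕ} (h : IsMM A K R) (hK : K' ⊆ K) : IsMM A K' (restr K' R) where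
  refl_iff i := by
    rw [restr_iff, h.refl_iff]
    exact ⟨fun hi => hi.2.1, fun hi => ⟨hK hi, hi, hi⟩⟩
  symm i j hij := by
    rw [restr_iff] at hij ⊢
    exact ⟨h.symm _ _ hij.1, hij.2.2, hij.2.1⟩
  trans i j k hij hjk := by
    rw [restr_iff] at hij hjk ⊢
    exact ⟨h.trans _ _ _ hij.1 hjk.1, hij.2.1, hjk.2.2⟩
  cut y hy a ha b hb hya hyb h1 h2 := by
    rw [restr_iff] at h1 h2
    exact h.cut y (hK hy) a (hK ha) b (hK hb) hya hyb (fun h => h1 ⟨h, hy, ha⟩)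
      fun h => h2 ⟨h, hy, hb⟩

/-- Two vertices with three common neighbours belong to the same class. -/
theorem IsMM.of_common (h : IsMM A K R) {u w : ℕ} (hu : u ∈ K)
    (hw : w ∈ K) (h3 : 3 ≤ (K.filter fun z => A u z ∧ A w z).card) : R u w := by
  obtain ⟨x, y, z, hx, hy, hz, hxy, hxz, hyz⟩ := Finset.two_lt_card_iff.1 h3
  simp only [Finset.mem_filter] at hx hy hz
  by_contra huw
  -- No vertex lies in both classes, so each of the three common neighbours is cut off from `u` or
  -- from `w`. Two of them are cut off from the same vertex, which is forbidden.
  have key : ∀ x ∈ K, R u x → ¬ R w x := fun x _ h1 h2 => huw (h.trans _ _ _ h1 (h.symm _ _ h2))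
  have cu := h.cut u hu
  have cw := h.cut w hw
  by_cases h1 : R u x
  · by_cases h2 : R u y
    · exact hxy (cw x hx.1 y hy.1 hx.2.2 hy.2.2 (key x hx.1 h1) (key y hy.1 h2))
    · by_cases h3 : R u z
      · exact hxz (cw x hx.1 z hz.1 hx.2.2 hz.2.2 (key x hx.1 h1) (key z hz.1 h3))
      · exact hyz (cu y hy.1 z hz.1 hy.2.1 hz.2.1 h2 h3)
  · by_cases h2 : R u y
    · by_cases h3 : R u z
      · exact hyz (cw y hy.1 z hz.1 hy.2.2 hz.2.2 (key y hy.1 h2) (key z hz.1 h3))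
      · exact hxz (cu x hx.1 z hz.1 hx.2.1 hz.2.1 h1 h3)
    · exact hxy (cu x hx.1 y hy.1 hx.2.1 hy.2.1 h1 h2)

/-- The relation that `pullMat` computes. -/
def pullRel (v a p b : ℕ) (R : ℕ → ℕ → Bool) (i j : ℕ) : Bool :=
  R (move v a p b i) (move v a p b j) || (i == v && j == v)

theorem move_self (v a p b : ℕ) : move v a p b v = a := by simp [move]

theorem move_second {v a p b : ℕ} (h : p ≠ v) : move v a p b p = b := by simp [move, h]

theorem move_other {v a p b i : ℕ} (h : i ≠ v) (h' : i ≠ p) : move v a p b i = i := by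
  simp [move, h, h']

theorem move_one {v a b i : ℕ} (h : i ≠ v) : move v a v b i = i := move_other h h

end

section
variable {A : ℕ → ℕ → Bool} {K : Finset ℕ} {R : ℕ → ℕ → Bool} {v : ℕ}

/-! ### A new part -/

theorem pullRel_new (v : ℕ) (R : ℕ → ℕ → Bool) (i j : ℕ) :
    pullRel v v v v R i j ↔ R i j ∨ i = v ∧ j = v := by
  have : ∀ i, move v v v v i = i := fun i => by simp only [move]; split <;> simp_all
  simp [pullRel, this]

/-- An isolated vertex is an endpoint of no edge, so the cut condition only concerns the old
vertices. -/
theorem IsMM.new (h : IsMM A K R) (hv : v ∉ K) (hAv : ∀ w ∈ K, ¬ A v w)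
    (hA : ∀ i j, A i j → A j i) (hA' : ∀ i, ¬ A i i) : IsMM A (insert v K) (pullRel v v v v R) where
  refl_iff i := by rw [pullRel_new, h.refl_iff, Finset.mem_insert]; tauto
  symm i j := by
    rw [pullRel_new, pullRel_new]
    rintro (h1 | h1)
    · exact .inl (h.symm _ _ h1)
    · exact .inr h1.symm
  trans i j k := by
    simp only [pullRel_new]
    rintro (h1 | ⟨rfl, rfl⟩) (h2 | ⟨h2, rfl⟩)
    · exact .inl (h.trans _ _ _ h1 h2)
    · subst h2; exact absurd (h.mem_right h1) hv
    · exact absurd (h.mem_left h2) hv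
    · exact .inr ⟨rfl, rfl⟩
  cut y hy a ha b hb hya hyb h1 h2 := by
    simp only [pullRel_new, not_or] at h1 h2
    have hvn : ∀ w ∈ insert v K, ¬ A v w := by
      intro w hw
      rcases Finset.mem_insert.1 hw with rfl | hw
      · exact hA' w
      · exact hAv w hw
    have aux : ∀ {x}, x ∈ insert v K → x ≠ v → x ∈ K := fun hx hne =>
      (Finset.mem_insert.1 hx).resolve_left hne
    exact h.cut y (aux hy fun e => hvn a ha (e ▸ hya)) a
      (aux ha fun e => hvn y hy (e ▸ hA _ _ hya)) b (aux hb fun e => hvn y hy (e ▸ hA _ _ hyb))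
      hya hyb h1.1 h2.1

/-- The old classes are unchanged, and `{v}` is none of them because `v` is not in `K`. -/
theorem IsMM.ncls_new (h : IsMM A K R) (hv : v ∉ K) :
    ncls (insert v K) (pullRel v v v v R) = ncls K R + 1 := by
  have e1 : cls (insert v K) (pullRel v v v v R) v = {v} := by
    ext j
    simp only [cls, Finset.mem_filter, Finset.mem_insert, pullRel_new, Finset.mem_singleton]
    constructor
    · rintro ⟨-, h1 | h1⟩
      · exact absurd (h.mem_left h1) hv
      · exact h1.2
    · rintro rfl; simp
  have e2 : ∀ i ∈ K, cls (insert v K) (pullRel v v v v R) i = cls K R i := by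
    intro i hi
    have hiv : i ≠ v := (ne_of_mem_of_not_mem hi hv)
    ext j
    simp only [cls, Finset.mem_filter, Finset.mem_insert, pullRel_new]
    constructor
    · rintro ⟨-, h1 | h1⟩
      · exact ⟨h.mem_right h1, h1⟩
      · exact absurd h1.1 hiv
    · rintro ⟨h1, h2⟩; exact ⟨.inr h1, .inl h2⟩
  rw [ncls, Finset.image_insert, e1, Finset.image_congr (g := cls K R) (fun i hi => e2 i hi),
    Finset.card_insert_of_notMem, ncls]
  rintro h1
  obtain ⟨i, hi, h2⟩ := Finset.mem_image.1 h1
  have : v ∈ cls K R i := h2 ▸ Finset.mem_singleton_self v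
  exact hv (Finset.mem_filter.1 this).1

/-! ### Joining an existing part -/

section
variable {w : ℕ}

theorem pullRel_home (h : IsMM A K R) (hw : w ∈ K) (i j : ℕ) :
    pullRel v w v v R i j = R (move v w v v i) (move v w v v j) := by
  rw [pullRel, Bool.eq_iff_iff]
  simp only [Bool.or_eq_true, Bool.and_eq_true, beq_iff_eq, or_iff_left_iff_imp]
  rintro ⟨rfl, rfl⟩
  rw [move_self]; exact (h.refl_iff w).2 hw

/-- All neighbours of `v` lie in the class that it joins, so no edge at `v` is cut. -/
theorem IsMM.home (h : IsMM A K R) (hv : v ∉ K) (hw : w ∈ K) (hAw : ∀ x ∈ K, A v x → R w x)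
    (hA : ∀ i j, A i j → A j i) (hA' : ∀ i, ¬ A i i) :
    IsMM A (insert v K) (pullRel v w v v R) where
  refl_iff i := by
    rw [pullRel_home h hw, h.refl_iff, Finset.mem_insert]
    by_cases hi : i = v
    · subst hi; simp [move_self, hw]
    · simp [move_one hi, hi]
  symm i j := by rw [pullRel_home h hw, pullRel_home h hw]; exact h.symm _ _
  trans i j k := by simp only [pullRel_home h hw]; exact h.trans _ _ _
  cut y hy a ha b hb hya hyb h1 h2 := by
    simp only [pullRel_home h hw] at h1 h2
    have aux : ∀ {x}, x ∈ insert v K → x ≠ v → x ∈ K := fun hx hne =>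
      (Finset.mem_insert.1 hx).resolve_left hne
    have hyv : y ≠ v := by
      rintro rfl
      have hay : a ≠ y := fun e => hA' y (by rwa [e] at hya)
      rw [move_self, move_one hay] at h1
      exact h1 (hAw a (aux ha hay) hya)
    have side : ∀ x ∈ insert v K, A y x → ¬ R (move v w v v y) (move v w v v x) → x ≠ v := by
      rintro x hx hyx h3 rfl
      rw [move_self, move_one hyv] at h3
      exact h3 (h.symm _ _ (hAw y (aux hy hyv) (hA _ _ hyx)))
    have hav := side a ha hya h1
    have hbv := side b hb hyb h2
    rw [move_one hyv, move_one hav] at h1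
    rw [move_one hyv, move_one hbv] at h2
    exact h.cut y (aux hy hyv) a (aux ha hav) b (aux hb hbv) hya hyb h1 h2

theorem IsMM.ncls_home (h : IsMM A K R) (h' : IsMM A (insert v K) (pullRel v w v v R))
    (hv : v ∉ K) (hw : w ∈ K) : ncls (insert v K) (pullRel v w v v R) = ncls K R := by
  refine h.ncls_eq h' (ρ := move v w v v) (fun i hi => ?_) (fun i _ j _ => pullRel_home h hw i j)
    fun i hi => ⟨i, Finset.mem_insert_of_mem hi, ?_⟩
  · by_cases hiv : i = v
    · rw [hiv, move_self]; exact hw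
    · rw [move_one hiv]; exact (Finset.mem_insert.1 hi).resolve_left hiv
  · rw [move_one (ne_of_mem_of_not_mem hi hv)]; exact (h.refl_iff i).2 hi

/-- A relation in which `v` belongs to the class of another vertex `w` arises from its
restriction. -/
theorem IsMM.eq_home {R' : ℕ → ℕ → Bool} (h : IsMM A (insert v K) R') (hw : w ∈ K)
    (hvw : R' v w) : pullRel v w v v (EnumKernel.restr K R') = R' := by
  have hr := h.restr (Finset.subset_insert v K)
  funext i j
  rw [pullRel_home hr hw, Bool.eq_iff_iff, restr_iff]
  have hm : ∀ i, i ∈ insert v K → move v w v v i ∈ K ∧ R' i (move v w v v i) := by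
    intro i hi
    by_cases hiv : i = v
    · rw [hiv, move_self]; exact ⟨hw, hvw⟩
    · rw [move_one hiv]
      exact ⟨(Finset.mem_insert.1 hi).resolve_left hiv, (h.refl_iff i).2 hi⟩
  have hm' : ∀ i, move v w v v i ∈ K → i ∈ insert v K := by
    intro i hi
    by_cases hiv : i = v
    · rw [hiv]; exact Finset.mem_insert_self _ _
    · rw [move_one hiv] at hi; exact Finset.mem_insert_of_mem hi
  constructor
  · rintro ⟨h1, h2, h3⟩
    exact h.trans _ _ _ (hm i (hm' i h2)).2
      (h.trans _ _ _ h1 (h.symm _ _ (hm j (hm' j h3)).2))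
  · intro h1
    obtain ⟨h2, h3⟩ := hm i (h.mem_left h1)
    obtain ⟨h4, h5⟩ := hm j (h.mem_right h1)
    exact ⟨h.trans _ _ _ (h.symm _ _ h3) (h.trans _ _ _ h1 h5), h2, h4⟩

theorem IsMM.restr_home (h : IsMM A K R) (hv : v ∉ K) (hw : w ∈ K) :
    EnumKernel.restr K (pullRel v w v v R) = R := by
  funext i j
  rw [Bool.eq_iff_iff, restr_iff, pullRel_home h hw]
  constructor
  · rintro ⟨h1, h2, h3⟩
    rwa [move_one (ne_of_mem_of_not_mem h2 hv), move_one (ne_of_mem_of_not_mem h3 hv)] at h1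
  · intro h1
    have h2 := h.mem_left h1
    have h3 := h.mem_right h1
    rw [move_one (ne_of_mem_of_not_mem h2 hv), move_one (ne_of_mem_of_not_mem h3 hv)]
    exact ⟨h1, h2, h3⟩

end

theorem IsMM.restr_new (h : IsMM A K R) (hv : v ∉ K) :
    EnumKernel.restr K (pullRel v v v v R) = R := by
  funext i j
  rw [Bool.eq_iff_iff, restr_iff, pullRel_new]
  constructor
  · rintro ⟨h1 | h1, h2, h3⟩
    · exact h1
    · exact absurd (h1.1 ▸ h2) hv
  · intro h1; exact ⟨.inl h1, h.mem_left h1, h.mem_right h1⟩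

/-- A relation in which `v` forms a part of its own arises from its restriction. -/
theorem IsMM.eq_new {R' : ℕ → ℕ → Bool} (h : IsMM A (insert v K) R')
    (hs : ∀ w ∈ K, ¬ R' v w) : pullRel v v v v (EnumKernel.restr K R') = R' := by
  funext i j
  rw [Bool.eq_iff_iff, pullRel_new, restr_iff]
  constructor
  · rintro (h1 | ⟨rfl, rfl⟩)
    · exact h1.1
    · exact (h.refl_iff _).2 (Finset.mem_insert_self _ _)
  · intro h1
    rcases Finset.mem_insert.1 (h.mem_left h1) with rfl | hi
    · rcases Finset.mem_insert.1 (h.mem_right h1) with rfl | hj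
      · exact .inr ⟨rfl, rfl⟩
      · exact absurd h1 (hs j hj)
    · rcases Finset.mem_insert.1 (h.mem_right h1) with rfl | hj
      · exact absurd (h.symm _ _ h1) (hs i hi)
      · exact .inl ⟨h1, hi, hj⟩

/-! ### Exchanging two pendant vertices -/

section
variable {p u : ℕ}

theorem pullRel_swap (h : IsMM A K R) (hp : p ∈ K) (i j : ℕ) :
    pullRel v p p u R i j = R (move v p p u i) (move v p p u j) := by
  rw [pullRel, Bool.eq_iff_iff]
  simp only [Bool.or_eq_true, Bool.and_eq_true, beq_iff_eq, or_iff_left_iff_imp]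
  rintro ⟨rfl, rfl⟩
  rw [move_self]; exact (h.refl_iff p).2 hp

theorem move_swap_mem (hv : v ∉ K) (hp : p ∈ K) (hu : u ∈ K) (i : ℕ) :
    move v p p u i ∈ K ↔ i ∈ insert v K := by
  rw [Finset.mem_insert]
  by_cases hiv : i = v
  · subst hiv; simp [move_self, hp]
  · by_cases hip : i = p
    · subst hip; simp [move_second hiv, hu, hp]
    · simp [move_other hiv hip, hiv]

/-- At `u`, the cut edge to `p` is traded for a cut edge to `v`, so `u` still has at most one
neighbour outside of its class. The vertices `v` and `p` themselves have only one neighbour. -/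
theorem IsMM.swap (h : IsMM A K R) (hv : v ∉ K) (hp : p ∈ K) (hu : u ∈ K)
    (hAv : ∀ x ∈ K, A v x → x = u) (hAp : ∀ x ∈ K, A p x → x = u) (hup : A u p)
    (hpu : ¬ R p u) (hA : ∀ i j, A i j → A j i) (hA' : ∀ i, ¬ A i i) :
    IsMM A (insert v K) (pullRel v p p u R) where
  refl_iff i := by rw [pullRel_swap h hp, h.refl_iff, move_swap_mem hv hp hu]
  symm i j := by rw [pullRel_swap h hp, pullRel_swap h hp]; exact h.symm _ _
  trans i j k := by simp only [pullRel_swap h hp]; exact h.trans _ _ _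
  cut y hy a ha b hb hya hyb h1 h2 := by
    simp only [pullRel_swap h hp] at h1 h2
    have hpv : p ≠ v := (ne_of_mem_of_not_mem hp hv)
    have huv : u ≠ v := (ne_of_mem_of_not_mem hu hv)
    have hup' : u ≠ p := fun e => hA' u (by rwa [← e] at hup)
    have aux : ∀ {x}, x ∈ insert v K → x ≠ v → x ∈ K := fun hx hne =>
      (Finset.mem_insert.1 hx).resolve_left hne
    have nv : ∀ x ∈ insert v K, A v x → x = u := fun x hx hvx =>
      hAv x (aux hx fun e => hA' v (by rwa [e] at hvx)) hvx
    have np : ∀ x ∈ insert v K, A p x → x = u := by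
      intro x hx hpx
      refine hAp x (aux hx fun e => ?_) hpx
      subst e
      exact hup' (hAv p hp (hA _ _ hpx)).symm
    by_cases hyv : y = v
    · subst hyv; exact (nv a ha hya).trans (nv b hb hyb).symm
    by_cases hyp : y = p
    · subst hyp; exact (np a ha hya).trans (np b hb hyb).symm
    have hyK := aux hy hyv
    rw [move_other hyv hyp] at h1 h2
    -- the pendant vertex `p` is not cut off, and if `v` is, then nothing else is
    have notp : ∀ x ∈ insert v K, A y x → ¬ R y (move v p p u x) → x ≠ p := by
      rintro x hx hyx h3 rfl
      have := hAp y hyK (hA _ _ hyx)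
      rw [move_second hpv, this] at h3
      exact h3 ((h.refl_iff u).2 hu)
    have key : ∀ x ∈ insert v K, A y x → ¬ R y (move v p p u x) → x ≠ v → A y v → False := by
      intro x hx hyx h3 hxv hyv'
      have hxp := notp x hx hyx h3
      have := hAv y hyK (hA _ _ hyv')
      subst this
      rw [move_other hxv hxp] at h3
      exact hxp (h.cut y hu x (aux hx hxv) p hp hyx hup h3 fun h4 => hpu (h.symm _ _ h4))
    by_cases hav : a = v
    · subst hav
      by_contra hne
      exact key b hb hyb h2 (fun e => hne e.symm) hya
    by_cases hbv : b = v
    · subst hbv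
      exact (key a ha hya h1 hav hyb).elim
    have hap := notp a ha hya h1
    have hbp := notp b hb hyb h2
    rw [move_other hav hap] at h1
    rw [move_other hbv hbp] at h2
    exact h.cut y hyK a (aux ha hav) b (aux hb hbv) hya hyb h1 h2

theorem IsMM.ncls_swap (h : IsMM A K R) (h' : IsMM A (insert v K) (pullRel v p p u R))
    (hv : v ∉ K) (hp : p ∈ K) (hu : u ∈ K) : ncls (insert v K) (pullRel v p p u R) = ncls K R := by
  refine h.ncls_eq h' (ρ := move v p p u) (fun i hi => (move_swap_mem hv hp hu i).2 hi)
    (fun i _ j _ => pullRel_swap h hp i j) fun i hi => ?_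
  by_cases hip : i = p
  · exact ⟨v, Finset.mem_insert_self _ _, by rw [move_self, hip]; exact (h.refl_iff p).2 hp⟩
  · exact ⟨i, Finset.mem_insert_of_mem hi, by
      rw [move_other (ne_of_mem_of_not_mem hi hv) hip]; exact (h.refl_iff i).2 hi⟩

/-- The inverse of the exchange of pendant vertices. -/
def unswap (K : Finset ℕ) (v p : ℕ) (R : ℕ → ℕ → Bool) (i j : ℕ) : Bool :=
  R (if i = p then v else i) (if j = p then v else j) && decide (i ∈ K ∧ j ∈ K)

theorem unswap_iff {i j : ℕ} : unswap K v p R i j ↔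
    R (if i = p then v else i) (if j = p then v else j) ∧ i ∈ K ∧ j ∈ K := by
  simp [unswap]

/-- The same trade backwards: `p` takes the place of `v`, and the edge from `u` to `p` uses the
allowance that the edge to `v` used before. -/
theorem IsMM.unswap {R' : ℕ → ℕ → Bool} (h : IsMM A (insert v K) R') (hp : p ∈ K)
    (hu : u ∈ K) (hv : v ∉ K) (hAv : A u v) (hAp : ∀ x ∈ K, A p x → x = u)
    (hvu : ¬ R' v u) (hA : ∀ i j, A i j → A j i) : IsMM A K (unswap K v p R') where
  refl_iff i := by
    rw [unswap_iff, h.refl_iff]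
    refine ⟨fun hi => hi.2.1, fun hi => ⟨?_, hi, hi⟩⟩
    split
    · exact Finset.mem_insert_self _ _
    · exact Finset.mem_insert_of_mem hi
  symm i j hij := by
    rw [unswap_iff] at hij ⊢
    exact ⟨h.symm _ _ hij.1, hij.2.2, hij.2.1⟩
  trans i j k hij hjk := by
    rw [unswap_iff] at hij hjk ⊢
    exact ⟨h.trans _ _ _ hij.1 hjk.1, hij.2.1, hjk.2.2⟩
  cut y hy a ha b hb hya hyb h1 h2 := by
    rw [unswap_iff] at h1 h2
    have ins : ∀ {x}, x ∈ K → x ∈ insert v K := Finset.mem_insert_of_mem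
    by_cases hyp : y = p
    · subst hyp; exact (hAp a ha hya).trans (hAp b hb hyb).symm
    rw [if_neg hyp] at h1 h2
    have key : ∀ x ∈ K, A y x → ¬ (R' y x) → A y p → False := by
      intro x hx hyx h3 hyp'
      have := hAp y hy (hA _ _ hyp')
      subst this
      exact hv ((h.cut y (ins hy) x (ins hx) v (Finset.mem_insert_self _ _) hyx hAv h3
        fun h4 => hvu (h.symm _ _ h4)) ▸ hx)
    by_cases hap : a = p
    · by_contra hne
      have hbp : b ≠ p := fun e => hne (hap.trans e.symm)
      rw [if_neg hbp] at h2
      exact key b hb hyb (fun h3 => h2 ⟨h3, hy, hb⟩) (hap ▸ hya)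
    · rw [if_neg hap] at h1
      by_cases hbp : b = p
      · exact (key a ha hya (fun h3 => h1 ⟨h3, hy, ha⟩) (hbp ▸ hyb)).elim
      · rw [if_neg hbp] at h2
        exact h.cut y (ins hy) a (ins ha) b (ins hb) hya hyb (fun h3 => h1 ⟨h3, hy, ha⟩)
          fun h3 => h2 ⟨h3, hy, hb⟩

/-- A relation that cuts `v` off from its neighbour arises by exchanging pendant vertices. -/
theorem IsMM.eq_swap {R' : ℕ → ℕ → Bool} (h : IsMM A (insert v K) R')
    (h' : IsMM A K (EnumKernel.unswap K v p R')) (hp : p ∈ K)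
    (hu : u ∈ K) (hv : v ∉ K) (hAv : A u v) (hup : A u p) (hup' : u ≠ p) (hvu : ¬ R' v u) :
    pullRel v p p u (EnumKernel.unswap K v p R') = R' := by
  have hpv : p ≠ v := (ne_of_mem_of_not_mem hp hv)
  have huv : u ≠ v := (ne_of_mem_of_not_mem hu hv)
  -- The vertex `u` is already separated from its neighbour `v`, so it must share its class with
  -- `p`.
  have hR : R' u p := by
    by_contra hc
    exact hpv (h.cut u (Finset.mem_insert_of_mem hu) p (Finset.mem_insert_of_mem hp) v
      (Finset.mem_insert_self _ _) hup hAv hc fun h4 => hvu (h.symm _ _ h4))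
  have hm : ∀ i ∈ insert v K, R' i (if move v p p u i = p then v else move v p p u i) := by
    intro i hi
    by_cases hiv : i = v
    · subst hiv; rw [move_self, if_pos rfl]; exact (h.refl_iff i).2 hi
    · by_cases hip : i = p
      · subst hip; rw [move_second hiv, if_neg hup']; exact h.symm _ _ hR
      · rw [move_other hiv hip, if_neg hip]; exact (h.refl_iff i).2 hi
  funext i j
  rw [pullRel_swap h' hp, Bool.eq_iff_iff, unswap_iff, move_swap_mem hv hp hu,
    move_swap_mem hv hp hu]
  constructor
  · rintro ⟨h1, h2, h3⟩
    exact h.trans _ _ _ (hm i h2) (h.trans _ _ _ h1 (h.symm _ _ (hm j h3)))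
  · intro h1
    have h2 := h.mem_left h1
    have h3 := h.mem_right h1
    exact ⟨h.trans _ _ _ (h.symm _ _ (hm i h2)) (h.trans _ _ _ h1 (hm j h3)), h2, h3⟩

theorem IsMM.unswap_swap (h : IsMM A K R) (hv : v ∉ K) (hp : p ∈ K) :
    EnumKernel.unswap K v p (pullRel v p p u R) = R := by
  have hm : ∀ i ∈ K, move v p p u (if i = p then v else i) = i := by
    intro i hi
    split
    · rename_i e; rw [move_self, e]
    · rename_i e; exact move_other (ne_of_mem_of_not_mem hi hv) e
  funext i j
  rw [Bool.eq_iff_iff, unswap_iff, pullRel_swap h hp]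
  constructor
  · rintro ⟨h1, h2, h3⟩
    rwa [hm i h2, hm j h3] at h1
  · intro h1
    have h2 := h.mem_left h1
    have h3 := h.mem_right h1
    rw [hm i h2, hm j h3]
    exact ⟨h1, h2, h3⟩

end
end
end EnumKernel

/-! ### Solutions as matrices, and partitioned lifts across one deletion. -/

namespace EnumKernel
open Enc (enc)

/-! ## Relations as matrices -/

/-- The matrix of a relation. -/
def mat (n : ℕ) (f : ℕ → ℕ → Bool) : Mat :=
  (List.range n).map fun i => (List.range n).map fun j => f i j

theorem look_mat (n : ℕ) (f : ℕ → ℕ → Bool) (i j : ℕ) :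
    look (mat n f) i j = (decide (i < n ∧ j < n) && f i j) := by
  unfold look mat
  by_cases hi : i < n
  · by_cases hj : j < n
    · simp [hi, hj, List.getD_eq_getElem?_getD]
    · simp [hi, hj, List.getD_eq_getElem?_getD]
  · simp [hi, List.getD_eq_getElem?_getD, show (default : List Bool) = [] from rfl]

/-- The elements of `K` below `n`, in increasing order. -/
def lst (n : ℕ) (K : Finset ℕ) : List ℕ := (List.range n).filter fun i => decide (i ∈ K)

theorem mem_lst {n : ℕ} {K : Finset ℕ} (hK : ∀ i ∈ K, i < n) {i : ℕ} : i ∈ lst n K ↔ i ∈ K := by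
  simp only [lst, List.mem_filter, List.mem_range, decide_eq_true_eq]
  exact ⟨fun h => h.2, fun h => ⟨hK i h, h⟩⟩

theorem nodup_lst (n : ℕ) (K : Finset ℕ) : (lst n K).Nodup := List.nodup_range.filter _

theorem length_filter_lst {n : ℕ} {K : Finset ℕ} (hK : ∀ i ∈ K, i < n) (p : ℕ → Bool) :
    ((lst n K).filter p).length = (K.filter fun i => p i).card := by
  rw [← List.toFinset_card_of_nodup ((nodup_lst n K).filter p)]
  congr 1
  ext i
  rw [List.mem_toFinset, List.mem_filter, mem_lst hK, Finset.mem_filter]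

theorem headD_mem {α : Type} [Inhabited α] {l : List α} (h : l ≠ []) : l.headD default ∈ l := by
  cases l with
  | nil => exact absurd rfl h
  | cons a l => exact List.mem_cons_self

section
variable {A : ℕ → ℕ → Bool} {n : ℕ} {K : Finset ℕ} {R : ℕ → ℕ → Bool}

theorem IsMM.look_mat (h : IsMM A K R) (hK : ∀ i ∈ K, i < n) : look (mat n R) = R := by
  funext i j
  rw [EnumKernel.look_mat, Bool.eq_iff_iff]
  simp only [Bool.and_eq_true, decide_eq_true_eq, and_iff_right_iff_imp]
  exact fun hij => ⟨hK i (h.mem_left hij), hK j (h.mem_right hij)⟩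

theorem IsMM.mat_inj {R' : ℕ → ℕ → Bool} (h : IsMM A K R) (h' : IsMM A K R')
    (hK : ∀ i ∈ K, i < n) (e : mat n R = mat n R') : R = R' := by
  rw [← h.look_mat hK, e, h'.look_mat hK]

theorem mem_reps {r : Mat} (hK : ∀ i ∈ K, i < n) {w : ℕ} :
    w ∈ reps r (lst n K) ↔ w ∈ K ∧ ∀ j ∈ K, look r j w → w ≤ j := by
  rw [reps, List.mem_filter, mem_lst hK, List.all_eq_true]
  refine and_congr_right fun _ => ?_
  simp only [mem_lst hK, Bool.or_eq_true, Bool.not_eq_true', decide_eq_true_eq]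
  refine forall₂_congr fun j _ => ?_
  cases look r j w <;> simp

theorem IsMM.exists_rep {r : Mat} (h : IsMM A K (look r)) (hK : ∀ i ∈ K, i < n) {i : ℕ}
    (hi : i ∈ K) : ∃ w ∈ reps r (lst n K), look r i w := by
  have hne : (cls K (look r) i).Nonempty := ⟨i, Finset.mem_filter.2 ⟨hi, (h.refl_iff i).2 hi⟩⟩
  have hm := Finset.mem_filter.1 ((cls K (look r) i).min'_mem hne)
  refine ⟨_, (mem_reps hK).2 ⟨hm.1, fun j hj hjw => ?_⟩, hm.2⟩
  exact Finset.min'_le _ _ (Finset.mem_filter.2 ⟨hj, h.trans _ _ _ hm.2 (h.symm _ _ hjw)⟩)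

theorem IsMM.rep_unique {r : Mat} (h : IsMM A K (look r)) (hK : ∀ i ∈ K, i < n) {w w' : ℕ}
    (hw : w ∈ reps r (lst n K)) (hw' : w' ∈ reps r (lst n K)) (e : look r w w') : w = w' := by
  rw [mem_reps hK] at hw hw'
  exact le_antisymm (hw.2 w' hw'.1 (h.symm _ _ e)) (hw'.2 w hw.1 e)

theorem IsMM.length_reps {r : Mat} (h : IsMM A K (look r)) (hK : ∀ i ∈ K, i < n) :
    (reps r (lst n K)).length = ncls K (look r) := by
  have hmem : ∀ {w}, w ∈ reps r (lst n K) → w ∈ K := fun hw => ((mem_reps hK).1 hw).1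
  have hnd : (reps r (lst n K)).Nodup := (nodup_lst n K).filter _
  rw [← List.toFinset_card_of_nodup hnd, ncls]
  have : (reps r (lst n K)).toFinset.image (cls K (look r)) = K.image (cls K (look r)) := by
    ext c
    simp only [Finset.mem_image, List.mem_toFinset]
    constructor
    · rintro ⟨w, hw, rfl⟩
      exact ⟨w, hmem hw, rfl⟩
    · rintro ⟨i, hi, rfl⟩
      obtain ⟨w, hw, hiw⟩ := h.exists_rep hK hi
      exact ⟨w, hw, ((h.cls_eq_iff hi (hmem hw)).2 hiw).symm⟩
  rw [← this, Finset.card_image_of_injOn]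
  intro w hw w' hw' e
  rw [Finset.mem_coe, List.mem_toFinset] at hw hw'
  exact h.rep_unique hK hw hw' ((h.cls_eq_iff (hmem hw) (hmem hw')).1 e)

/-- The matrix `m` represents a matching multicut of the graph that `A` induces on `K`, with at
least `l` parts. -/
structure IsSol (A : ℕ → ℕ → Bool) (n : ℕ) (K : Finset ℕ) (l : ℕ) (m : Mat) : Prop where
  wf : m = mat n (look m)
  mm : IsMM A K (look m)
  card : l ≤ ncls K (look m)

theorem IsMM.isSol (h : IsMM A K R) (hK : ∀ i ∈ K, i < n) {l : ℕ} (hl : l ≤ ncls K R) :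
    IsSol A n K l (mat n R) := by
  have e := h.look_mat hK
  exact ⟨by rw [e], by rwa [e], by rwa [e]⟩

theorem IsMM.supp_eq {r : Mat} (h : IsMM A K (look r)) : supp n r = lst n K := by
  unfold supp lst
  refine List.filter_congr fun i _ => ?_
  rw [Bool.eq_iff_iff, h.refl_iff, decide_eq_true_eq]

end

/-! ## Partitioned lifts -/

/-- The lists `f r`, for `r` satisfying `P`, are non-empty, have no repetitions, and form a partition
of the set of objects satisfying `Q`. -/
structure IsLift {α : Type} (P Q : α → Prop) (f : α → List α) : Prop where
  ne_nil : ∀ r, P r → f r ≠ []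
  nodup : ∀ r, P r → (f r).Nodup
  sol : ∀ r, P r → ∀ c ∈ f r, Q c
  disj : ∀ r r' c, P r → P r' → c ∈ f r → c ∈ f r' → r = r'
  surj : ∀ c, Q c → ∃ r, P r ∧ c ∈ f r

theorem IsLift.single {α : Type} (P : α → Prop) : IsLift P P fun r => [r] where
  ne_nil := by simp
  nodup := by simp
  sol := by simp
  disj := by simp; rintro r r' c _ _ rfl rfl; rfl
  surj c hc := ⟨c, hc, by simp⟩

/-- A final object determines its intermediate object by the disjointness of `g`, and this one
determines the initial object by the disjointness of `f`. Thus neither repetitions nor overlaps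
arise. -/
theorem IsLift.flatMap {α : Type} {P Q S : α → Prop} {f g : α → List α} (hf : IsLift P Q f)
    (hg : IsLift Q S g) : IsLift P S fun r => (f r).flatMap g where
  ne_nil r hr := by
    obtain ⟨c, hc⟩ := List.exists_mem_of_ne_nil _ (hf.ne_nil r hr)
    obtain ⟨d, hd⟩ := List.exists_mem_of_ne_nil _ (hg.ne_nil c (hf.sol r hr c hc))
    exact List.ne_nil_of_mem (List.mem_flatMap.2 ⟨c, hc, hd⟩)
  nodup r hr := by
    refine List.nodup_flatMap.2 ⟨fun c hc => hg.nodup c (hf.sol r hr c hc), ?_⟩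
    refine (hf.nodup r hr).imp_of_mem fun {c c'} hc hc' hne => ?_
    intro d hd hd'
    exact hne (hg.disj c c' d (hf.sol r hr c hc) (hf.sol r hr c' hc') hd hd')
  sol r hr d hd := by
    obtain ⟨c, hc, hd⟩ := List.mem_flatMap.1 hd
    exact hg.sol c (hf.sol r hr c hc) d hd
  disj r r' d hr hr' hd hd' := by
    obtain ⟨c, hc, hd⟩ := List.mem_flatMap.1 hd
    obtain ⟨c', hc', hd'⟩ := List.mem_flatMap.1 hd'
    have := hg.disj c c' d (hf.sol r hr c hc) (hf.sol r' hr' c' hc') hd hd'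
    subst this
    exact hf.disj r r' c hr hr' hc hc'
  surj d hd := by
    obtain ⟨c, hc, hd⟩ := hg.surj d hd
    obtain ⟨r, hr, hc⟩ := hf.surj c hc
    exact ⟨r, hr, List.mem_flatMap.2 ⟨c, hc, hd⟩⟩

/-- A bijection is a partitioned lift. -/
theorem IsLift.of_bij {α : Type} {P Q : α → Prop} {f g : α → α} (hf : ∀ r, P r → Q (f r))
    (hgf : ∀ r, P r → g (f r) = r) (hg : ∀ c, Q c → P (g c)) (hfg : ∀ c, Q c → f (g c) = c) :
    IsLift P Q fun r => [f r] where
  ne_nil := by simp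
  nodup := by simp
  sol r hr c hc := by rw [List.mem_singleton.1 hc]; exact hf r hr
  disj r r' c hr hr' hc hc' := by
    rw [List.mem_singleton] at hc hc'
    rw [← hgf r hr, ← hgf r' hr', ← hc, ← hc']
  surj c hc := ⟨g c, hg c hc, by rw [hfg c hc]; simp⟩

section
variable {A : ℕ → ℕ → Bool} {n : ℕ} {K K' : Finset ℕ} {l l' : ℕ}

/-- Partitioned lifts of relations given by lists `D` of descriptors. -/
theorem IsLift.of_descriptors {δ : Type} {D : Mat → List δ}
    {F : δ → (ℕ → ℕ → Bool) → ℕ → ℕ → Bool} (hK : ∀ i ∈ K, i < n) (hK' : ∀ i ∈ K', i < n)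
    (hne : ∀ r, IsMM A K (look r) → D r ≠ [])
    (hnd : ∀ r, IsMM A K (look r) → (D r).Nodup)
    (hinj : ∀ r, IsMM A K (look r) → ∀ d ∈ D r, ∀ d' ∈ D r,
      F d (look r) = F d' (look r) → d = d')
    (hsol : ∀ r, IsMM A K (look r) → l ≤ ncls K (look r) → ∀ d ∈ D r,
      IsMM A K' (F d (look r)) ∧ l' ≤ ncls K' (F d (look r)))
    (hdisj : ∀ r r' d d', IsMM A K (look r) → IsMM A K (look r') → d ∈ D r → d' ∈ D r' →
      F d (look r) = F d' (look r') → look r = look r')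
    (hsurj : ∀ R', IsMM A K' R' → l' ≤ ncls K' R' → ∃ R, IsMM A K R ∧ l ≤ ncls K R ∧
      ∀ r, look r = R → ∃ d ∈ D r, F d R = R') :
    IsLift (IsSol A n K l) (IsSol A n K' l') fun r => (D r).map fun d => mat n (F d (look r)) where
  ne_nil r hr := by simpa using hne r hr.mm
  nodup r hr := by
    refine (hnd r hr.mm).map_on fun d hd d' hd' e => ?_
    exact hinj r hr.mm d hd d' hd' ((hsol r hr.mm hr.card d hd).1.mat_inj
      (hsol r hr.mm hr.card d' hd').1 hK' e)
  sol r hr c hc := by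
    obtain ⟨d, hd, rfl⟩ := List.mem_map.1 hc
    exact (hsol r hr.mm hr.card d hd).1.isSol hK' (hsol r hr.mm hr.card d hd).2
  disj r r' c hr hr' hc hc' := by
    obtain ⟨d, hd, rfl⟩ := List.mem_map.1 hc
    obtain ⟨d', hd', e⟩ := List.mem_map.1 hc'
    have := (hsol r' hr'.mm hr'.card d' hd').1.mat_inj (hsol r hr.mm hr.card d hd).1 hK' e
    rw [hr.wf, hr'.wf, hdisj r r' d d' hr.mm hr'.mm hd hd' this.symm]
  surj c hc := by
    obtain ⟨R, h1, h2, h3⟩ := hsurj _ hc.mm hc.card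
    have e := h1.look_mat hK
    obtain ⟨d, hd, h4⟩ := h3 (mat n R) e
    refine ⟨mat n R, h1.isSol hK h2, List.mem_map.2 ⟨d, hd, ?_⟩⟩
    rw [e, h4]; exact hc.wf.symm

end

/-! ## Lifting one removed vertex -/

/-- The required number of parts after the removal of `v`. -/
def nextReq (M : Mat) (K : List ℕ) (v l : ℕ) : ℕ :=
  if (nbrs M K v).isEmpty = true then l - 1 else l

/-- `M` is the adjacency matrix of a graph. -/
def IsGraph (M : Mat) : Prop := (∀ i j, look M i j → look M j i) ∧ ∀ i, ¬ look M i i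

section
variable {M : Mat} {n : ℕ} {K : Finset ℕ} {v l : ℕ}

theorem mem_nbrs (hK : ∀ i ∈ K, i < n) {w : ℕ} :
    w ∈ nbrs M (lst n K) v ↔ w ∈ K ∧ look M v w := by
  rw [nbrs, List.mem_filter, mem_lst hK]

theorem length_nbrs_eq_one (hK : ∀ i ∈ K, i < n) :
    (nbrs M (lst n K) v).length = 1 ↔ ∃ u ∈ K, look M v u ∧ ∀ x ∈ K, look M v x → x = u := by
  rw [nbrs, length_filter_lst hK, Finset.card_eq_one]
  refine exists_congr fun u => ?_
  rw [Finset.eq_singleton_iff_unique_mem]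
  simp only [Finset.mem_filter]
  grind

theorem mem_pend (hK : ∀ i ∈ K, i < n) {u p : ℕ} (hu : u ∈ K) :
    p ∈ pend M (lst n K) u ↔ p ∈ K ∧ look M p u ∧ ∀ x ∈ K, look M p x → x = u := by
  rw [pend, List.mem_filter, mem_lst hK, Bool.and_eq_true, beq_iff_eq, length_nbrs_eq_one hK]
  grind

theorem isEmpty_nbrs (hK : ∀ i ∈ K, i < n) :
    (nbrs M (lst n K) v).isEmpty = true ↔ ∀ w ∈ K, ¬ look M v w := by
  rw [List.isEmpty_iff, List.eq_nil_iff_forall_not_mem]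
  exact ⟨fun h w hw hvw => h w ((mem_nbrs hK).2 ⟨hw, hvw⟩),
    fun h w hw => h w ((mem_nbrs hK).1 hw).1 ((mem_nbrs hK).1 hw).2⟩

theorem removable_iff (hK : ∀ i ∈ K, i < n) : removable M (lst n K) v = true ↔
    ((nbrs M (lst n K) v).length = 1 →
      pend M (lst n K) ((nbrs M (lst n K) v).headD default) ≠ []) ∧
    ∀ u ∈ K, look M v u → ∀ w ∈ K, look M v w → u ≠ w →
      3 ≤ (K.filter fun z => look M u z ∧ look M w z).card := by
  have hc : ∀ u w, (common M (lst n K) u w).length =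
      (K.filter fun z => look M u z ∧ look M w z).card := by
    intro u w
    rw [common, length_filter_lst hK]
    simp only [Bool.and_eq_true]
  rw [removable, Bool.and_eq_true, List.all_eq_true]
  simp only [List.all_eq_true, mem_nbrs hK, Bool.or_eq_true, Bool.not_eq_true', beq_iff_eq, hc,
    decide_eq_true_eq, beq_eq_false_iff_ne, List.isEmpty_eq_false_iff]
  refine and_congr ?_ ?_
  · tauto
  · constructor
    · intro h u hu hvu w hw hvw hne
      exact (h u ⟨hu, hvu⟩ w ⟨hw, hvw⟩).resolve_left hne
    · intro h u hu w hw
      by_cases e : u = w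
      · exact .inl e
      · exact .inr (h u hu.1 hu.2 w hw.1 hw.2 e)

theorem IsLift.congr {α : Type} {P Q : α → Prop} {f g : α → List α} (hf : IsLift P Q f)
    (h : ∀ r, P r → g r = f r) : IsLift P Q g where
  ne_nil r hr := h r hr ▸ hf.ne_nil r hr
  nodup r hr := h r hr ▸ hf.nodup r hr
  sol r hr := h r hr ▸ hf.sol r hr
  disj r r' c hr hr' := h r hr ▸ h r' hr' ▸ hf.disj r r' c hr hr'
  surj c hc := by
    obtain ⟨r, hr, hc⟩ := hf.surj c hc
    exact ⟨r, hr, h r hr ▸ hc⟩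

/-- The relation described by a descriptor. -/
def descRel (v : ℕ) (d : ℕ × ℕ × ℕ) (R : ℕ → ℕ → Bool) : ℕ → ℕ → Bool :=
  pullRel v d.1 d.2.1 d.2.2 R

/-- Restriction to `K` recovers the smaller solution, which gives disjointness. A new part is always
possible because it replaces the missing one in `l - 1`; joining an old part is offered only if
there are `l` classes already. One representative for each class avoids repetitions. -/
theorem isLift_isolated (hM : IsGraph M) (hK : ∀ i ∈ K, i < n) (hv : v < n) (hvK : v ∉ K)
    (h0 : ∀ w ∈ K, ¬ look M v w) :
    IsLift (IsSol (look M) n K (l - 1)) (IsSol (look M) n (insert v K) l) fun r =>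
      (descs M (lst n K) v l r).map fun d => mat n (descRel v d (look r)) := by
  have hD : ∀ r, descs M (lst n K) v l r = (v, v, v) ::
      if decide (l ≤ (reps r (lst n K)).length) = true then
        (reps r (lst n K)).map fun w => (w, v, v) else [] := fun r => by
    rw [descs, if_pos ((isEmpty_nbrs hK).2 h0)]
  have hmem : ∀ {r} d, IsMM (look M) K (look r) → (d ∈ descs M (lst n K) v l r ↔
      d = (v, v, v) ∨ l ≤ ncls K (look r) ∧ ∃ w ∈ reps r (lst n K), d = (w, v, v)) := by
    intro r d hr
    rw [hD, List.mem_cons, hr.length_reps hK]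
    refine or_congr_right ?_
    by_cases hl : l ≤ ncls K (look r)
    · simp only [hl, decide_true, if_true, List.mem_map, true_and]
      exact exists_congr fun w => and_congr_right fun _ => eq_comm
    · simp [hl]
  have hrepK : ∀ {r w}, w ∈ reps r (lst n K) → w ∈ K := fun hw => ((mem_reps hK).1 hw).1
  have hnew : ∀ {R}, IsMM (look M) K R → ∀ w ∈ K, ¬ descRel v (v, v, v) R v w := by
    intro R hR w hw h
    rw [descRel, pullRel_new] at h
    rcases h with h | h
    · exact hvK (hR.mem_left h)
    · exact hvK (h.2 ▸ hw)
  have hhome : ∀ {R}, IsMM (look M) K R → ∀ w ∈ K, ∀ w' ∈ K,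
      descRel v (w, v, v) R v w' = R w w' := by
    intro R hR w hw w' hw'
    rw [descRel, pullRel_home hR hw, move_self, move_one (ne_of_mem_of_not_mem hw' hvK)]
  have hrestr : ∀ {r} d, IsMM (look M) K (look r) → d ∈ descs M (lst n K) v l r →
      restr K (descRel v d (look r)) = look r := by
    intro r d hr hd
    rcases (hmem d hr).1 hd with rfl | ⟨-, w, hw, rfl⟩
    · exact hr.restr_new hvK
    · exact hr.restr_home hvK (hrepK hw)
  have hK' : ∀ i ∈ insert v K, i < n := by
    intro i hi
    rcases Finset.mem_insert.1 hi with rfl | hi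
    exacts [hv, hK i hi]
  refine IsLift.of_descriptors hK hK' (fun r _ => by rw [hD]; simp) (fun r hr => ?_)
    (fun r hr d hd d' hd' e => ?_) (fun r hr hl d hd => ?_) (fun r r' d d' hr hr' hd hd' e => ?_)
    (fun R' hR' hl => ?_)
  · rw [hD, List.nodup_cons]
    constructor
    · split
      · rw [List.mem_map]
        rintro ⟨w, hw, e⟩
        have e1 : w = v := (Prod.ext_iff.1 e).1
        exact hvK (e1 ▸ hrepK hw)
      · simp
    · split
      · exact ((nodup_lst n K).filter _).map fun a b e => (Prod.ext_iff.1 e).1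
      · exact List.nodup_nil
  · rcases (hmem d hr).1 hd with rfl | ⟨-, w, hw, rfl⟩ <;>
      rcases (hmem d' hr).1 hd' with rfl | ⟨-, w', hw', rfl⟩
    · rfl
    · have := hnew hr w' (hrepK hw')
      rw [e, hhome hr _ (hrepK hw') _ (hrepK hw')] at this
      exact absurd ((hr.refl_iff w').2 (hrepK hw')) this
    · have := hnew hr w (hrepK hw)
      rw [← e, hhome hr _ (hrepK hw) _ (hrepK hw)] at this
      exact absurd ((hr.refl_iff w).2 (hrepK hw)) this
    · have h1 := hhome hr w (hrepK hw) w' (hrepK hw')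
      rw [e, hhome hr _ (hrepK hw') _ (hrepK hw')] at h1
      rw [hr.rep_unique hK hw hw' (h1 ▸ (hr.refl_iff w').2 (hrepK hw'))]
  · rcases (hmem d hr).1 hd with rfl | ⟨hl', w, hw, rfl⟩
    · refine ⟨hr.new hvK h0 hM.1 hM.2, ?_⟩
      rw [descRel, hr.ncls_new hvK]; omega
    · have := hr.home hvK (hrepK hw) (fun x hx hvx => absurd hvx (h0 x hx)) hM.1 hM.2
      refine ⟨this, ?_⟩
      rw [descRel, hr.ncls_home this hvK (hrepK hw)]; exact hl'
  · rw [← hrestr d hr hd, e, hrestr d' hr' hd']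
  · have hR := hR'.restr (Finset.subset_insert v K)
    by_cases hw : ∃ w ∈ K, R' v w
    · obtain ⟨w, hw, hvw⟩ := hw
      -- No class disappears under restriction, since the class of `v` also contains `w`.
      have hnc : ncls (insert v K) R' = ncls K (restr K R') := by
        have e := hR'.eq_home hw hvw
        rw [← hR.ncls_home (v := v) (w := w) (e.symm ▸ hR') hvK hw, e]
      refine ⟨restr K R', hR, by omega, fun r hr => ?_⟩
      have hR2 : IsMM (look M) K (look r) := hr ▸ hR
      -- Only representatives are offered as descriptors, so `w` is replaced by the representative
      -- of its class.
      obtain ⟨w₀, hw₀, hww₀⟩ := hR2.exists_rep hK hw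
      rw [hr, restr_iff] at hww₀
      exact ⟨(w₀, v, v), (hmem _ hR2).2 (.inr ⟨by rw [hr]; omega, w₀, hw₀, rfl⟩),
        hR'.eq_home hww₀.2.2 (hR'.trans _ _ _ hvw hww₀.1)⟩
    · push Not at hw
      have e := hR'.eq_new fun w hw' => by simpa using hw w hw'
      refine ⟨restr K R', hR, ?_, fun r hr => ⟨(v, v, v), ?_, e⟩⟩
      · have := hR.ncls_new hvK
        rw [e] at this; omega
      · exact (hmem _ (hr ▸ hR)).2 (.inl rfl)

/-- The lift for a vertex that has to join the part of a neighbour. -/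
theorem isLift_home (hM : IsGraph M) (hK : ∀ i ∈ K, i < n) (hv : v < n) (hvK : v ∉ K) {u : ℕ}
    (hu : u ∈ K) (h1 : ∀ R, IsMM (look M) K R → ∀ x ∈ K, look M v x → R u x)
    (h2 : ∀ R', IsMM (look M) (insert v K) R' → R' v u) {D : Mat → List (ℕ × ℕ × ℕ)}
    (hD : ∀ r, D r = [(u, v, v)]) :
    IsLift (IsSol (look M) n K l) (IsSol (look M) n (insert v K) l) fun r =>
      (D r).map fun d => mat n (descRel v d (look r)) := by
  have hK' : ∀ i ∈ insert v K, i < n := by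
    intro i hi
    rcases Finset.mem_insert.1 hi with rfl | hi
    exacts [hv, hK i hi]
  refine IsLift.of_descriptors hK hK' (fun r _ => by simp [hD]) (fun r hr => by simp [hD])
    (fun r hr d hd d' hd' e => ?_) (fun r hr hl d hd => ?_) (fun r r' d d' hr hr' hd hd' e => ?_)
    (fun R' hR' hl => ?_)
  · rw [hD, List.mem_singleton] at hd hd'
    rw [hd, hd']
  · rw [hD, List.mem_singleton] at hd
    subst hd
    have := hr.home hvK hu (h1 _ hr) hM.1 hM.2
    exact ⟨this, by rw [descRel, hr.ncls_home this hvK hu]; exact hl⟩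
  · rw [hD, List.mem_singleton] at hd hd'
    subst hd hd'
    rw [← hr.restr_home hvK hu, ← hr'.restr_home hvK hu]
    exact congrArg _ e
  · have hR := hR'.restr (Finset.subset_insert v K)
    have e := hR'.eq_home hu (h2 R' hR')
    refine ⟨restr K R', hR, ?_, fun r hr => ⟨(u, v, v), by rw [hD]; simp, e⟩⟩
    rw [← hR.ncls_home (v := v) (w := u) (e.symm ▸ hR') hvK hu, e]; exact hl

/-- Whether `v` lies with `u` tells the two descriptors apart. If it does, restriction recovers the
smaller solution; if not, `unswap` does. In the second case `p` was separated from `u` in the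
smaller solution, which is exactly when that descriptor is offered. -/
theorem isLift_pendant (hM : IsGraph M) (hK : ∀ i ∈ K, i < n) (hv : v < n) (hvK : v ∉ K)
    {u p : ℕ} (hu : u ∈ K) (hp : p ∈ K) (hvu : look M v u) (hpu : look M p u)
    (hv1 : ∀ x ∈ K, look M v x → x = u) (hp1 : ∀ x ∈ K, look M p x → x = u)
    {D : Mat → List (ℕ × ℕ × ℕ)}
    (hD : ∀ r, D r = (u, v, v) :: if (!(look r p u)) = true then [(p, p, u)] else []) :
    IsLift (IsSol (look M) n K l) (IsSol (look M) n (insert v K) l) fun r =>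
      (D r).map fun d => mat n (descRel v d (look r)) := by
  have hK' : ∀ i ∈ insert v K, i < n := by
    intro i hi
    rcases Finset.mem_insert.1 hi with rfl | hi
    exacts [hv, hK i hi]
  have hup := hM.1 _ _ hpu
  have huv := hM.1 _ _ hvu
  have hup' : u ≠ p := fun e => hM.2 u (by rwa [← e] at hup)
  have huvne : u ≠ v := ne_of_mem_of_not_mem hu hvK
  have hmem : ∀ {r} d, d ∈ D r ↔ d = (u, v, v) ∨ ¬ look r p u ∧ d = (p, p, u) := by
    intro r d
    rw [hD, List.mem_cons]
    cases look r p u <;> simp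
  have hvu1 : ∀ {R}, IsMM (look M) K R → descRel v (u, v, v) R v u := by
    intro R hR
    rw [descRel, pullRel_home hR hu, move_self, move_one huvne]
    exact (hR.refl_iff u).2 hu
  have hvu2 : ∀ {R}, IsMM (look M) K R → descRel v (p, p, u) R v u = R p u := by
    intro R hR
    rw [descRel, pullRel_swap hR hp, move_self, move_other huvne hup']
  refine IsLift.of_descriptors hK hK' (fun r _ => by simp [hD]) (fun r hr => ?_)
    (fun r hr d hd d' hd' e => ?_) (fun r hr hl d hd => ?_) (fun r r' d d' hr hr' hd hd' e => ?_)
    (fun R' hR' hl => ?_)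
  · rw [hD]
    split <;> simp [hup']
  · rcases (hmem d).1 hd with rfl | ⟨h3, rfl⟩ <;> rcases (hmem d').1 hd' with rfl | ⟨h4, rfl⟩
    · rfl
    · have := hvu1 hr; rw [e, hvu2 hr] at this; exact absurd this h4
    · have := hvu1 hr; rw [← e, hvu2 hr] at this; exact absurd this h3
    · rfl
  · rcases (hmem d).1 hd with rfl | ⟨h3, rfl⟩
    · have := hr.home hvK hu (fun x hx hvx => hv1 x hx hvx ▸ (hr.refl_iff u).2 hu) hM.1 hM.2
      exact ⟨this, by rw [descRel, hr.ncls_home this hvK hu]; exact hl⟩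
    · have := hr.swap hvK hp hu hv1 hp1 hup h3 hM.1 hM.2
      exact ⟨this, by rw [descRel, hr.ncls_swap this hvK hp hu]; exact hl⟩
  · rcases (hmem d).1 hd with rfl | ⟨h3, rfl⟩ <;> rcases (hmem d').1 hd' with rfl | ⟨h4, rfl⟩
    · rw [← hr.restr_home hvK hu, ← hr'.restr_home hvK hu]
      exact congrArg _ e
    · have := hvu1 hr; rw [e, hvu2 hr'] at this; exact absurd this h4
    · have := hvu1 hr'; rw [← e, hvu2 hr] at this; exact absurd this h3
    · rw [← hr.unswap_swap (u := u) hvK hp, ← hr'.unswap_swap (u := u) hvK hp]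
      exact congrArg _ e
  · by_cases h3 : R' v u
    · have hR := hR'.restr (Finset.subset_insert v K)
      have e := hR'.eq_home hu h3
      refine ⟨restr K R', hR, ?_, fun r hr => ⟨(u, v, v), (hmem _).2 (.inl rfl), e⟩⟩
      rw [← hR.ncls_home (v := v) (w := u) (e.symm ▸ hR') hvK hu, e]; exact hl
    · have hR := hR'.unswap hp hu hvK huv hp1 h3 hM.1
      have e := hR'.eq_swap hR hp hu hvK huv hup hup' h3
      refine ⟨unswap K v p R', hR, ?_, fun r hr => ⟨(p, p, u), (hmem _).2 (.inr ⟨?_, rfl⟩), e⟩⟩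
      · rw [← hR.ncls_swap (v := v) (p := p) (u := u) (e.symm ▸ hR') hvK hp hu, e]; exact hl
      · rw [hr, ← hvu2 hR, descRel, e]; exact h3

theorem isLift_children (hM : IsGraph M) (hK : ∀ i ∈ K, i < M.length) (hv : v < M.length)
    (hvK : v ∉ K) (hr : removable M (lst M.length K) v = true) (l : ℕ) :
    IsLift (IsSol (look M) M.length K (nextReq M (lst M.length K) v l))
      (IsSol (look M) M.length (insert v K) l) (children M (v, l)) := by
  rw [removable_iff hK] at hr
  have hcongr : ∀ r, IsSol (look M) M.length K (nextReq M (lst M.length K) v l) r →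
      children M (v, l) r = (descs M (lst M.length K) v l r).map
        fun d => mat M.length (descRel v d (look r)) := by
    intro r hr
    rw [children, hr.mm.supp_eq]
    rfl
  refine IsLift.congr ?_ hcongr
  by_cases h0 : (nbrs M (lst M.length K) v).isEmpty = true
  · rw [nextReq, if_pos h0]
    exact isLift_isolated hM hK hv hvK ((isEmpty_nbrs hK).1 h0)
  rw [nextReq, if_neg h0]
  have hu := headD_mem (mt List.isEmpty_iff.2 h0)
  rw [mem_nbrs hK] at hu
  have hD : ∀ r, descs M (lst M.length K) v l r = _ := fun r => by rw [descs, if_neg h0]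
  by_cases h1 : (nbrs M (lst M.length K) v).length = 1
  · have hp := headD_mem (hr.1 h1)
    rw [mem_pend hK hu.1] at hp
    obtain ⟨u', hu', hvu', hv1⟩ := (length_nbrs_eq_one hK).1 h1
    have := hv1 _ hu.1 hu.2
    subst this
    refine isLift_pendant hM hK hv hvK hu' hp.1 hu.2 hp.2.1 hv1 hp.2.2 fun r => ?_
    rw [hD, h1]
    simp
  -- Stated for any larger set, as it is needed before the insertion of `v` and after it; common
  -- neighbours in `K` persist.
  · have hforced : ∀ {K' R}, K ⊆ K' → IsMM (look M) K' R → ∀ x ∈ K, ∀ y ∈ K, look M v x →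
        look M v y → R x y := by
      intro K' R hKK' hR x hx y hy hvx hvy
      by_cases hxy : x = y
      · subst hxy; exact (hR.refl_iff x).2 (hKK' hx)
      · refine hR.of_common (hKK' hx) (hKK' hy) ((hr.2 x hx hvx y hy hvy hxy).trans ?_)
        exact Finset.card_le_card (Finset.filter_subset_filter _ hKK')
    refine isLift_home hM hK hv hvK hu.1
      (fun R hR x hx hvx => hforced subset_rfl hR _ hu.1 x hx hu.2 hvx) (fun R' hR' => ?_)
      fun r => ?_
    · by_contra hvu
      -- With a second neighbour in the same class as the first, a `v` outside of this class would
      -- have two neighbours cut off.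
      obtain ⟨w, hw, hvw, hne⟩ : ∃ w ∈ K, look M v w ∧
          w ≠ (nbrs M (lst M.length K) v).headD default := by
        by_contra hcon
        push Not at hcon
        exact h1 ((length_nbrs_eq_one hK).2 ⟨_, hu.1, hu.2, hcon⟩)
      have hwu := hforced (Finset.subset_insert v K) hR' _ hw _ hu.1 hvw hu.2
      exact hne (hR'.cut v (Finset.mem_insert_self _ _) w (Finset.mem_insert_of_mem hw) _
        (Finset.mem_insert_of_mem hu.1) hvw hu.2
        (fun h => hvu (hR'.trans _ _ _ h hwu)) hvu)
    · rw [hD]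
      have : ((nbrs M (lst M.length K) v).length == 1) = false := by simpa using h1
      rw [this]
      simp

end

end EnumKernel

/-! ### Reversing all deletions, and attaching the clique. -/

namespace EnumKernel
open Enc (enc)

/-! ## The chain of removals -/

/-- The log `L` records removals that lead from the whole graph, with `l₀` required parts, to the
graph on `K`, with `l` required parts. -/
def Chain (M : Mat) (l₀ : ℕ) : List (ℕ × ℕ) → Finset ℕ → ℕ → Prop
  | [], K, l => K = Finset.range M.length ∧ l = l₀
  | e :: L, K, l => (∀ i ∈ K, i < M.length) ∧ e.1 < M.length ∧ e.1 ∉ K ∧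
      removable M (lst M.length K) e.1 = true ∧ l = nextReq M (lst M.length K) e.1 e.2 ∧
      Chain M l₀ L (insert e.1 K) e.2

/-- The head of the log is the latest deletion, so reading the log from its head reinserts the
vertices in reverse order and composes the single lifts. -/
theorem Chain.isLift {M : Mat} (hM : IsGraph M) {l₀ : ℕ} {L : List (ℕ × ℕ)} {K : Finset ℕ} {l : ℕ}
    (h : Chain M l₀ L K l) :
    IsLift (IsSol (look M) M.length K l) (IsSol (look M) M.length (Finset.range M.length) l₀)
      (leaves (children M) L) := by
  induction L generalizing K l with
  | nil =>
    obtain ⟨rfl, rfl⟩ := h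
    exact IsLift.single _
  | cons e L ih =>
    obtain ⟨h1, h2, h3, h4, rfl, h5⟩ := h
    exact (isLift_children hM h1 h2 h3 h4 e.2).flatMap (ih h5)

/-- The vertices that remain when the first `m` vertices have been processed. -/
def passK (M : Mat) : ℕ → Finset ℕ
  | 0 => Finset.range M.length
  | m + 1 => if removable M (lst M.length ((passK M m).erase m)) m = true then (passK M m).erase m
      else passK M m

theorem passK_succ_subset (M : Mat) (m : ℕ) : passK M (m + 1) ⊆ passK M m := by
  rw [passK]
  split
  · exact Finset.erase_subset _ _
  · exact subset_rfl

theorem passK_anti (M : Mat) {i j : ℕ} (h : i ≤ j) : passK M j ⊆ passK M i := by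
  induction j, h using Nat.le_induction with
  | base => exact subset_rfl
  | succ j _ ih => exact (passK_succ_subset M j).trans ih

theorem lt_of_mem_passK {M : Mat} {m i : ℕ} (h : i ∈ passK M m) : i < M.length :=
  Finset.mem_range.1 (passK_anti M (Nat.zero_le m) h)

theorem mem_passK_of_le {M : Mat} {m i : ℕ} (hi : i < M.length) (hm : m ≤ i) : i ∈ passK M m := by
  induction m with
  | zero => exact Finset.mem_range.2 hi
  | succ m ih =>
    rw [passK]
    split
    · exact Finset.mem_erase.2 ⟨by omega, ih (by omega)⟩
    · exact ih (by omega)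

theorem without_lst (n : ℕ) (K : Finset ℕ) (v : ℕ) : without (lst n K) v = lst n (K.erase v) := by
  rw [without, lst, lst, List.filter_filter]
  refine List.filter_congr fun i _ => ?_
  rw [Bool.eq_iff_iff]
  simp

/-- The computed state is matched with `passK`. The surviving vertices do not depend on the required
number of parts, which is recorded only in the log and the counter. -/
theorem foldl_passStep_spec (M : Mat) (l : ℕ) {m : ℕ} (hm : m ≤ M.length) :
    ((List.range m).foldl (passStep M) (List.range M.length, l, [])).1 =
        lst M.length (passK M m) ∧
      Chain M l ((List.range m).foldl (passStep M) (List.range M.length, l, [])).2.2 (passK M m)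
        ((List.range m).foldl (passStep M) (List.range M.length, l, [])).2.1 := by
  induction m with
  | zero =>
    refine ⟨?_, rfl, rfl⟩
    rw [lst, passK, List.filter_eq_self.2]
    · rfl
    · intro i hi
      simpa using hi
  | succ m ih =>
    obtain ⟨h1, h2⟩ := ih (by omega)
    rw [List.range_succ, List.foldl_append, List.foldl_cons, List.foldl_nil]
    generalize (List.range m).foldl (passStep M) (List.range M.length, l, []) = s at h1 h2
    rw [passStep, h1, without_lst, passK]
    split
    · refine ⟨rfl, fun i hi => lt_of_mem_passK (Finset.mem_of_mem_erase hi), by simpa using hm,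
        Finset.notMem_erase _ _, by assumption, rfl, ?_⟩
      change Chain M l s.2.2 (insert m ((passK M m).erase m)) s.2.1
      rwa [Finset.insert_erase (mem_passK_of_le (by omega) le_rfl)]
    · exact ⟨h1, h2⟩

/-- The vertices of the kernel. -/
def kerSet (M : Mat) : Finset ℕ := passK M M.length

theorem pass_fst (M : Mat) (l : ℕ) : (pass M l).1 = lst M.length (kerSet M) :=
  (foldl_passStep_spec M l le_rfl).1

theorem pass_chain (M : Mat) (l : ℕ) : Chain M l (pass M l).2.2 (kerSet M) (pass M l).2.1 :=
  (foldl_passStep_spec M l le_rfl).2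

/-! ## The graph with the attached clique -/

section
variable {M : Mat} {K : Finset ℕ}

/-- The vertex with index `i` in `K`. -/
def idx (n : ℕ) (K : Finset ℕ) (i : ℕ) : ℕ := (lst n K).getD i default

variable (hK : ∀ i ∈ K, i < M.length)
include hK

theorem length_lst : (lst M.length K).length = K.card := by
  rw [← List.toFinset_card_of_nodup (nodup_lst _ K)]
  congr 1
  ext i
  rw [List.mem_toFinset, mem_lst hK]

theorem idx_mem {i : ℕ} (hi : i < K.card) : idx M.length K i ∈ K := by
  rw [← length_lst hK] at hi
  rw [idx, List.getD_eq_getElem _ _ hi, ← mem_lst hK]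
  exact List.getElem_mem hi

theorem idx_inj {i j : ℕ} (hi : i < K.card) (hj : j < K.card)
    (h : idx M.length K i = idx M.length K j) : i = j := by
  rw [← length_lst hK] at hi hj
  rw [idx, idx, List.getD_eq_getElem _ _ hi, List.getD_eq_getElem _ _ hj] at h
  exact (nodup_lst _ K).getElem_inj_iff.1 h

theorem exists_idx {v : ℕ} (hv : v ∈ K) : ∃ i < K.card, idx M.length K i = v := by
  rw [← mem_lst hK] at hv
  obtain ⟨i, hi, e⟩ := List.mem_iff_getElem.1 hv
  exact ⟨i, length_lst hK ▸ hi, by rw [idx, List.getD_eq_getElem _ _ hi, e]⟩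

theorem look_kerMat {i j : ℕ} : look (kerMat M (lst M.length K)) i j ↔
    (i < 3 * K.card ∧ j < 3 * K.card) ∧ i ≠ j ∧
      ((i < K.card ∧ j < K.card ∧ look M (idx M.length K i) (idx M.length K j)) ∨
        (i = 0 ∨ K.card ≤ i) ∧ (j = 0 ∨ K.card ≤ j)) := by
  rw [kerMat, length_lst hK, ← mat, look_mat]
  simp only [gadget, idx, Bool.and_eq_true, Bool.or_eq_true, decide_eq_true_eq, beq_iff_eq,
    Bool.not_eq_true', beq_eq_false_iff_ne, Nat.succ_le_iff, and_assoc]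
  rw [show K.card + K.card + K.card = 3 * K.card by ring]

theorem look_unker {s : Mat} {i j : ℕ} : look (unker M.length (lst M.length K) s) i j ↔
    ∃ a < K.card, ∃ b < K.card, idx M.length K a = i ∧ idx M.length K b = j ∧ look s a b := by
  rw [unker, length_lst hK, ← mat, look_mat]
  simp only [Bool.and_eq_true, decide_eq_true_eq, beq_iff_eq, List.any_eq_true, List.mem_range]
  constructor
  · rintro ⟨-, a, ha, b, hb, ⟨h1, h2⟩, h3⟩
    exact ⟨a, ha, b, hb, h1, h2, h3⟩
  · rintro ⟨a, ha, b, hb, rfl, rfl, h3⟩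
    exact ⟨⟨hK _ (idx_mem hK ha), hK _ (idx_mem hK hb)⟩, a, ha, b, hb, ⟨rfl, rfl⟩, h3⟩

theorem isGraph_kerMat (hM : IsGraph M) : IsGraph (kerMat M (lst M.length K)) := by
  constructor
  · intro i j
    rw [look_kerMat hK, look_kerMat hK]
    rintro ⟨⟨h1, h2⟩, h3, h4⟩
    refine ⟨⟨h2, h1⟩, h3.symm, ?_⟩
    rcases h4 with ⟨h4, h5, h6⟩ | ⟨h4, h5⟩
    · exact .inl ⟨h5, h4, hM.1 _ _ h6⟩
    · exact .inr ⟨h5, h4⟩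
  · intro i h
    rw [look_kerMat hK] at h
    exact h.2.1 rfl

omit hK in
/-- Every vertex of the clique is mapped to the first vertex of `K`. -/
def proj (n : ℕ) (K : Finset ℕ) (i : ℕ) : ℕ := idx n K (if i < K.card then i else 0)

theorem proj_mem {i : ℕ} (hi : i < 3 * K.card) : proj M.length K i ∈ K := by
  unfold proj
  split
  · exact idx_mem hK (by assumption)
  · exact idx_mem hK (by omega)

/-- Edges of the attached clique are contracted to one vertex and are never cut; a cut edge
therefore joins two vertices of `K`, where the original condition applies. -/
theorem IsMM.pull_proj {R S : ℕ → ℕ → Bool} (h : IsMM (look M) K R)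
    (hS : ∀ i j, S i j ↔ (i < 3 * K.card ∧ j < 3 * K.card) ∧
      R (proj M.length K i) (proj M.length K j)) :
    IsMM (look (kerMat M (lst M.length K))) (Finset.range (3 * K.card)) S where
  refl_iff i := by
    rw [hS, Finset.mem_range, h.refl_iff]
    exact ⟨fun h => h.1.1, fun hi => ⟨⟨hi, hi⟩, proj_mem hK hi⟩⟩
  symm i j := by
    rw [hS, hS]
    exact fun h1 => ⟨h1.1.symm, h.symm _ _ h1.2⟩
  trans i j k := by
    simp only [hS]
    exact fun h1 h2 => ⟨⟨h1.1.1, h2.1.2⟩, h.trans _ _ _ h1.2 h2.2⟩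
  cut y hy a ha b hb hya hyb h1 h2 := by
    rw [look_kerMat hK] at hya hyb
    rw [hS] at h1 h2
    have hp0 : ∀ {x}, x = 0 ∨ K.card ≤ x → proj M.length K x = idx M.length K 0 := by
      intro x hx
      unfold proj
      split
      · rcases hx with rfl | hx
        · rfl
        · omega
      · rfl
    have old : ∀ x, ((y < 3 * K.card ∧ x < 3 * K.card) ∧ y ≠ x ∧
        ((y < K.card ∧ x < K.card ∧ look M (idx M.length K y) (idx M.length K x)) ∨
        (y = 0 ∨ K.card ≤ y) ∧ (x = 0 ∨ K.card ≤ x))) →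
        ¬ ((y < 3 * K.card ∧ x < 3 * K.card) ∧ R (proj M.length K y) (proj M.length K x)) →
        y < K.card ∧ x < K.card ∧ look M (idx M.length K y) (idx M.length K x) ∧
          ¬ R (idx M.length K y) (idx M.length K x) := by
      rintro x ⟨h3, -, h4 | ⟨h4, h5⟩⟩ h6
      · refine ⟨h4.1, h4.2.1, h4.2.2, fun h7 => h6 ⟨h3, ?_⟩⟩
        rw [proj, proj, if_pos h4.1, if_pos h4.2.1]; exact h7
      · refine absurd ⟨h3, ?_⟩ h6
        have h7 := proj_mem hK h3.2
        rw [hp0 h4, hp0 h5]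
        rw [hp0 h5] at h7
        exact (h.refl_iff _).2 h7
    obtain ⟨hy', ha', h3, h4⟩ := old a hya h1
    obtain ⟨-, hb', h5, h6⟩ := old b hyb h2
    exact idx_inj hK ha' hb' (h.cut _ (idx_mem hK hy') _ (idx_mem hK ha') _ (idx_mem hK hb')
      h3 h5 h4 h6)

/-- The graph on `K` sits inside the larger graph, and the cut condition is inherited by subgraphs.
-/
theorem IsMM.push_idx {R S : ℕ → ℕ → Bool}
    (h : IsMM (look (kerMat M (lst M.length K))) (Finset.range (3 * K.card)) S)
    (hM : IsGraph M)
    (hR : ∀ i j, R i j ↔ ∃ a < K.card, ∃ b < K.card,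
      idx M.length K a = i ∧ idx M.length K b = j ∧ S a b) : IsMM (look M) K R where
  refl_iff i := by
    rw [hR]
    constructor
    · rintro ⟨a, ha, b, hb, rfl, -, -⟩
      exact idx_mem hK ha
    · intro hi
      obtain ⟨a, ha, rfl⟩ := exists_idx hK hi
      exact ⟨a, ha, a, ha, rfl, rfl, (h.refl_iff a).2 (Finset.mem_range.2 (by omega))⟩
  symm i j := by
    rw [hR, hR]
    rintro ⟨a, ha, b, hb, e1, e2, h1⟩
    exact ⟨b, hb, a, ha, e2, e1, h.symm _ _ h1⟩
  trans i j k := by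
    simp only [hR]
    rintro ⟨a, ha, b, hb, e1, e2, h1⟩ ⟨b', hb', c, hc, e3, e4, h2⟩
    have := idx_inj hK hb hb' (e2.trans e3.symm)
    subst this
    exact ⟨a, ha, c, hc, e1, e4, h.trans _ _ _ h1 h2⟩
  cut y hy a ha b hb hya hyb h1 h2 := by
    obtain ⟨y, hy', rfl⟩ := exists_idx hK hy
    obtain ⟨a, ha', rfl⟩ := exists_idx hK ha
    obtain ⟨b, hb', rfl⟩ := exists_idx hK hb
    clear hy ha hb
    have adj : ∀ x < K.card, look M (idx M.length K y) (idx M.length K x) →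
        look (kerMat M (lst M.length K)) y x := by
      intro x hx hyx
      rw [look_kerMat hK]
      exact ⟨⟨by omega, by omega⟩, fun e => hM.2 _ (by rwa [e] at hyx), .inl ⟨hy', hx, hyx⟩⟩
    rw [h.cut y (Finset.mem_range.2 (by omega)) a (Finset.mem_range.2 (by omega)) b
      (Finset.mem_range.2 (by omega)) (adj a ha' hya) (adj b hb' hyb)
      (fun h3 => h1 ((hR _ _).2 ⟨y, hy', a, ha', rfl, rfl, h3⟩))
      fun h3 => h2 ((hR _ _).2 ⟨y, hy', b, hb', rfl, rfl, h3⟩)]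

/-- The attached clique is contained in one part. -/
theorem IsMM.gadget {S : ℕ → ℕ → Bool}
    (h : IsMM (look (kerMat M (lst M.length K))) (Finset.range (3 * K.card)) S) {x : ℕ}
    (hx : x < 3 * K.card) (hx' : K.card ≤ x) : S x 0 := by
  have hx0 : x ≠ 0 := by omega
  -- There are `2 * K.card` new vertices, hence one besides `x`. In the triangle on `0`, `x` and
  -- `z`, a vertex separated from both others would violate the cut condition.
  obtain ⟨z, hz, hz', hzx⟩ : ∃ z < 3 * K.card, K.card ≤ z ∧ z ≠ x := by
    by_cases e : x = K.card
    · exact ⟨K.card + 1, by omega, by omega, by omega⟩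
    · exact ⟨K.card, by omega, by omega, fun e' => e e'.symm⟩
  have hz0 : z ≠ 0 := by omega
  have mem : ∀ {i}, i < 3 * K.card → i ∈ Finset.range (3 * K.card) := Finset.mem_range.2
  have adj : ∀ i j, i < 3 * K.card → j < 3 * K.card → i ≠ j → (i = 0 ∨ K.card ≤ i) →
      (j = 0 ∨ K.card ≤ j) → look (kerMat M (lst M.length K)) i j :=
    fun i j h1 h2 h3 h4 h5 => (look_kerMat hK).2 ⟨⟨h1, h2⟩, h3, .inr ⟨h4, h5⟩⟩
  by_contra hc
  by_cases h1 : S z x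
  · exact hzx (h.cut 0 (mem (by omega)) z (mem hz) x (mem hx)
      (adj _ _ (by omega) hz hz0.symm (.inl rfl) (.inr hz'))
      (adj _ _ (by omega) hx hx0.symm (.inl rfl) (.inr hx'))
      (fun h2 => hc (h.trans _ _ _ (h.symm _ _ h1) (h.symm _ _ h2)))
      fun h2 => hc (h.symm _ _ h2))
  · by_cases h2 : S z 0
    · exact hz0 (h.cut x (mem hx) z (mem hz) 0 (mem (by omega))
        (adj _ _ hx hz hzx.symm (.inr hx') (.inr hz'))
        (adj _ _ hx (by omega) hx0 (.inr hx') (.inl rfl))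
        (fun h3 => h1 (h.symm _ _ h3)) hc)
    · exact hx0 (h.cut z (mem hz) x (mem hx) 0 (mem (by omega))
        (adj _ _ hz hx hzx (.inr hz') (.inr hx'))
        (adj _ _ hz (by omega) hz0 (.inr hz') (.inl rfl)) h1 h2)

theorem IsMM.ncls_pull_proj {R S : ℕ → ℕ → Bool} (h : IsMM (look M) K R)
    (h' : IsMM (look (kerMat M (lst M.length K))) (Finset.range (3 * K.card)) S)
    (hS : ∀ i j, S i j ↔ (i < 3 * K.card ∧ j < 3 * K.card) ∧
      R (proj M.length K i) (proj M.length K j)) :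
    ncls (Finset.range (3 * K.card)) S = ncls K R := by
  refine h.ncls_eq h' (ρ := proj M.length K) (fun i hi => proj_mem hK (Finset.mem_range.1 hi))
    (fun i hi j hj => ?_) fun i hi => ?_
  · rw [Bool.eq_iff_iff, hS, and_iff_right]
    exact ⟨Finset.mem_range.1 hi, Finset.mem_range.1 hj⟩
  · obtain ⟨a, ha, rfl⟩ := exists_idx hK hi
    exact ⟨a, Finset.mem_range.2 (by omega), by
      rw [proj, if_pos ha]; exact (h.refl_iff _).2 (idx_mem hK ha)⟩

/-- The relation on the graph with the attached clique is determined by its restriction. -/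
theorem IsMM.pull_push {R S : ℕ → ℕ → Bool}
    (h : IsMM (look (kerMat M (lst M.length K))) (Finset.range (3 * K.card)) S)
    (hR : ∀ i j, R i j ↔ ∃ a < K.card, ∃ b < K.card,
      idx M.length K a = i ∧ idx M.length K b = j ∧ S a b) (i j : ℕ) :
    S i j ↔ (i < 3 * K.card ∧ j < 3 * K.card) ∧ R (proj M.length K i) (proj M.length K j) := by
  have hm : ∀ i, i < 3 * K.card → S i (if i < K.card then i else 0) := by
    intro i hi
    split
    · exact (h.refl_iff i).2 (Finset.mem_range.2 hi)
    · exact h.gadget hK hi (by omega)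
  have hlt : ∀ i, i < 3 * K.card → (if i < K.card then i else 0) < K.card := by
    intro i hi
    split <;> omega
  rw [hR]
  constructor
  · intro h1
    have hi := Finset.mem_range.1 (h.mem_left h1)
    have hj := Finset.mem_range.1 (h.mem_right h1)
    exact ⟨⟨hi, hj⟩, _, hlt i hi, _, hlt j hj, rfl, rfl,
      h.trans _ _ _ (h.symm _ _ (hm i hi)) (h.trans _ _ _ h1 (hm j hj))⟩
  · rintro ⟨⟨hi, hj⟩, a, ha, b, hb, e1, e2, h1⟩
    have ea := idx_inj hK ha (hlt i hi) e1
    have eb := idx_inj hK hb (hlt j hj) e2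
    subst ea eb
    exact h.trans _ _ _ (hm i hi) (h.trans _ _ _ h1 (h.symm _ _ (hm j hj)))

/-- Matching multicuts of the graph with the attached clique correspond to those of the graph
on `K`. -/
theorem isLift_unker (hM : IsGraph M) (l : ℕ) :
    IsLift (IsSol (look (kerMat M (lst M.length K))) (3 * K.card) (Finset.range (3 * K.card)) l)
      (IsSol (look M) M.length K l) fun s => [unker M.length (lst M.length K) s] := by
  let S : Mat → ℕ → ℕ → Bool := fun r i j => decide (i < 3 * K.card ∧ j < 3 * K.card) &&
    look r (proj M.length K i) (proj M.length K j)
  have hS : ∀ r i j, S r i j ↔ (i < 3 * K.card ∧ j < 3 * K.card) ∧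
      look r (proj M.length K i) (proj M.length K j) := fun r i j => by
    simp only [S, Bool.and_eq_true, decide_eq_true_eq]
  have hN : ∀ i ∈ Finset.range (3 * K.card), i < 3 * K.card := fun i => Finset.mem_range.1
  have wfu : ∀ s, unker M.length (lst M.length K) s =
      mat M.length (look (unker M.length (lst M.length K) s)) := by
    intro s
    conv_lhs => unfold unker
    rw [← mat]
    unfold mat
    refine List.map_congr_left fun i hi => List.map_congr_left fun j hj => ?_
    rw [List.mem_range] at hi hj
    conv_rhs => unfold unker
    rw [← mat, look_mat]
    simp [hi, hj]
  refine IsLift.of_bij (g := fun r => mat (3 * K.card) (S r)) (fun s hs => ?_) (fun s hs => ?_)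
    (fun r hr => ?_) (fun r hr => ?_)
  · have h := hs.mm.push_idx hK hM (fun i j => look_unker hK (s := s))
    refine ⟨wfu s, h, ?_⟩
    rw [← h.ncls_pull_proj hK hs.mm (hs.mm.pull_push hK fun i j => look_unker hK (s := s))]
    exact hs.card
  · conv_rhs => rw [hs.wf]
    congr 1
    funext i j
    rw [Bool.eq_iff_iff, hS, ← hs.mm.pull_push hK fun i j => look_unker hK (s := s)]
  · have h := hr.mm.pull_proj hK (hS r)
    exact h.isSol hN (by rw [hr.mm.ncls_pull_proj hK h (hS r)]; exact hr.card)
  · have h := hr.mm.pull_proj hK (hS r)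
    conv_rhs => rw [hr.wf]
    rw [wfu]
    congr 1
    funext i j
    rw [Bool.eq_iff_iff, look_unker hK, h.look_mat hN]
    simp only [hS]
    constructor
    · rintro ⟨a, ha, b, hb, rfl, rfl, -, h1⟩
      rwa [proj, proj, if_pos ha, if_pos hb] at h1
    · intro h1
      obtain ⟨a, ha, rfl⟩ := exists_idx hK (hr.mm.mem_left h1)
      obtain ⟨b, hb, rfl⟩ := exists_idx hK (hr.mm.mem_right h1)
      exact ⟨a, ha, b, hb, rfl, rfl, ⟨by omega, by omega⟩, by
        rwa [proj, proj, if_pos ha, if_pos hb]⟩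

end

theorem ncls_le_card (K : Finset ℕ) (R : ℕ → ℕ → Bool) : ncls K R ≤ K.card :=
  Finset.card_image_le

/-- More than `K.card` parts are never possible, so larger demands are equivalent. The cap is used
to read the input demand in unary and to bound the length of the output demand. -/
theorem isSol_min {A : ℕ → ℕ → Bool} {n : ℕ} {K : Finset ℕ} {l c : ℕ} {m : Mat} (hc : K.card < c) :
    IsSol A n K (min l c) m ↔ IsSol A n K l m := by
  have := ncls_le_card K (look m)
  exact ⟨fun h => ⟨h.wf, h.mm, by have := h.card; omega⟩,
    fun h => ⟨h.wf, h.mm, (min_le_left _ _).trans h.card⟩⟩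

end EnumKernel

/-! ### Counting the kept vertices against a modulator. -/

namespace EnumKernel
open Enc (enc)

/-! ## The size of the kernel -/

section
variable {M : Mat} {U : Finset ℕ}

/-- The vertices outside of `U` induce a complete multipartite graph. -/
def IsModulator (M : Mat) (U : Finset ℕ) : Prop :=
  ∀ a b c, a < M.length → b < M.length → c < M.length → a ∉ U → b ∉ U → c ∉ U →
    ¬ look M a b → ¬ look M b c → ¬ look M a c

/-- The vertices of the kernel that are present when `v` is processed. -/
def stage (M : Mat) (v : ℕ) : Finset ℕ := (passK M v).erase v

theorem not_removable_of_mem {v : ℕ} (hv : v ∈ kerSet M) :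
    removable M (lst M.length (stage M v)) v ≠ true := by
  intro h
  have h1 : v ∈ passK M (v + 1) :=
    passK_anti M (Nat.succ_le_of_lt (lt_of_mem_passK hv)) hv
  rw [passK, ← stage, if_pos h] at h1
  exact Finset.notMem_erase _ _ h1

theorem mem_stage {v w : ℕ} (hv : v ∈ kerSet M) (hw : w ∈ kerSet M) (hne : w ≠ v) :
    w ∈ stage M v :=
  Finset.mem_erase.2 ⟨hne, passK_anti M (lt_of_mem_passK hv).le hw⟩

theorem lt_of_mem_stage {v w : ℕ} (hw : w ∈ stage M v) : w < M.length :=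
  lt_of_mem_passK (Finset.mem_of_mem_erase hw)

theorem stage_subset {v w x : ℕ} (hvw : v ≤ w) (hx : x ∈ stage M w) (hne : x ≠ v) :
    x ∈ stage M v :=
  Finset.mem_erase.2 ⟨hne, passK_anti M hvw (Finset.mem_of_mem_erase hx)⟩

/-- The common neighbours of `u` and `w` in the kernel outside of `U`. -/
def kerCommon (M : Mat) (U : Finset ℕ) (u w : ℕ) : Finset ℕ :=
  (kerSet M \ U).filter fun z => look M u z ∧ look M w z

/-- `v` is kept as the only pendant vertex at `u`. -/
def KeptPendant (M : Mat) (v u : ℕ) : Prop :=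
  u ∈ stage M v ∧ look M v u ∧ (∀ x ∈ stage M v, look M v x → x = u) ∧
    ∀ p ∈ stage M v, look M p u → ∃ x ∈ stage M v, look M p x ∧ x ≠ u

/-- `v` is kept because of its neighbours `u` and `w`. -/
def KeptPair (M : Mat) (U : Finset ℕ) (v u w : ℕ) : Prop :=
  (u < M.length ∧ w < M.length) ∧ (look M u v ∧ look M w v) ∧ (kerCommon M U u w).card ≤ 3

theorem KeptPair.swap {v u w : ℕ} (h : KeptPair M U v u w) : KeptPair M U v w u := by
  refine ⟨h.1.symm, h.2.1.symm, ?_⟩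
  have : kerCommon M U w u = kerCommon M U u w := Finset.filter_congr fun _ _ => and_comm
  rw [this]; exact h.2.2

/-- The two alternatives are the negations of the two clauses of removability at the time when `v`
was examined. -/
theorem kept (hM : IsGraph M) {v : ℕ} (hv : v ∈ kerSet M) :
    (∃ u, KeptPendant M v u) ∨ ∃ u w, KeptPair M U v u w := by
  have hK : ∀ i ∈ stage M v, i < M.length := fun i => lt_of_mem_stage
  have h := not_removable_of_mem hv
  rw [Ne, removable_iff hK, not_and_or] at h
  rcases h with h | h
  · left
    push Not at h
    obtain ⟨h1, h2⟩ := h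
    have hu := headD_mem (l := nbrs M (lst M.length (stage M v)) v)
      (List.length_pos_iff.1 (by omega))
    rw [mem_nbrs hK] at hu
    obtain ⟨u, hu', hvu, hv1⟩ := (length_nbrs_eq_one hK).1 h1
    have e := hv1 _ hu.1 hu.2
    rw [e] at h2
    refine ⟨u, hu', hvu, hv1, fun p hp hpu => ?_⟩
    by_contra hcon
    push Not at hcon
    have := (mem_pend hK hu').2 ⟨hp, hpu, hcon⟩
    rw [h2] at this
    exact absurd this List.not_mem_nil
  · right
    push Not at h
    obtain ⟨u, hu, hvu, w, hw, hvw, -, h3⟩ := h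
    refine ⟨u, w, ⟨hK u hu, hK w hw⟩, ⟨hM.1 _ _ hvu, hM.1 _ _ hvw⟩, ?_⟩
    -- When `v` was examined, at most two common neighbours were present besides `v`; all vertices
    -- of the kernel were, and `v` itself brings the bound to three.
    have : kerCommon M U u w ⊆ insert v ((stage M v).filter fun z => look M u z ∧ look M w z) := by
      intro z hz
      obtain ⟨hz, hz2⟩ := Finset.mem_filter.1 hz
      by_cases e : z = v
      · exact e ▸ Finset.mem_insert_self _ _
      · exact Finset.mem_insert_of_mem (Finset.mem_filter.2
          ⟨mem_stage hv (Finset.mem_sdiff.1 hz).1 e, hz2⟩)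
    have h4 := (Finset.card_le_card this).trans (Finset.card_insert_le _ _)
    omega

/-- If `v < w`, then keeping `w` requires a second neighbour of `v` at the later stage. Stages
shrink, so `v` would have had it at its own stage, where `u` was its only neighbour. -/
theorem KeptPendant.inj (hM : IsGraph M) {v w u : ℕ} (hv : v ∈ kerSet M) (hw : w ∈ kerSet M)
    (h1 : KeptPendant M v u) (h2 : KeptPendant M w u) : v = w := by
  have key : ∀ {v w}, v ∈ kerSet M → w ∈ kerSet M → KeptPendant M v u → KeptPendant M w u →
      ¬ v < w := by
    intro v w hv hw h1 h2 hlt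
    obtain ⟨x, hx, hvx, hne⟩ := h2.2.2.2 v (mem_stage hw hv hlt.ne) h1.2.1
    refine hne (h1.2.2.1 x (stage_subset hlt.le hx fun e => ?_) hvx)
    exact hM.2 v (by rwa [e] at hvx)
  exact le_antisymm (not_lt.1 (key hw hv h2 h1)) (not_lt.1 (key hv hw h1 h2))

open Classical in
theorem card_keptPendant_mem (hM : IsGraph M) :
    ((kerSet M \ U).filter fun v => ∃ u ∈ U, KeptPendant M v u).card ≤ U.card := by
  have h : ∀ v ∈ (kerSet M \ U).filter fun v => ∃ u ∈ U, KeptPendant M v u,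
      ∃ u, u ∈ U ∧ KeptPendant M v u := fun v hv => (Finset.mem_filter.1 hv).2
  choose! f hf using h
  refine Finset.card_le_card_of_injOn f (fun v hv => (hf v hv).1) fun v hv w hw e => ?_
  refine KeptPendant.inj hM ?_ ?_ (hf v hv).2 (e ▸ (hf w hw).2)
  · exact (Finset.mem_sdiff.1 (Finset.mem_filter.1 hv).1).1
  · exact (Finset.mem_sdiff.1 (Finset.mem_filter.1 hw).1).1

open Classical in
-- Let `v`, pendant at `u`, be the first such vertex. Any other one, except possibly `u`, is not
-- adjacent to `v` and hence a twin of `v` outside `U`. It then hangs at `u` as well, which is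
-- excluded.
theorem card_keptPendant_notMem (hM : IsGraph M) (hU : IsModulator M U) :
    ((kerSet M \ U).filter fun v => ∃ u ∉ U, KeptPendant M v u).card ≤ 2 := by
  rcases Finset.eq_empty_or_nonempty ((kerSet M \ U).filter fun v => ∃ u ∉ U, KeptPendant M v u)
    with h | h
  · simp [h]
  obtain ⟨v, hm, hle⟩ : ∃ v ∈ (kerSet M \ U).filter fun v => ∃ u ∉ U, KeptPendant M v u,
      ∀ w ∈ (kerSet M \ U).filter fun v => ∃ u ∉ U, KeptPendant M v u, v ≤ w :=
    ⟨_, Finset.min'_mem _ h, fun w hw => Finset.min'_le _ w hw⟩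
  obtain ⟨hv, u, hu, hvu⟩ := Finset.mem_filter.1 hm
  rw [Finset.mem_sdiff] at hv
  refine (Finset.card_le_card (t := {v, u}) fun w hw => ?_).trans Finset.card_le_two
  rw [Finset.mem_insert, Finset.mem_singleton]
  by_contra hcon
  push Not at hcon
  have hlt := hle w hw
  obtain ⟨hw, u', hu', hwu⟩ := Finset.mem_filter.1 hw
  rw [Finset.mem_sdiff] at hw
  have hwv : ¬ look M v w := fun h => hcon.2 (hvu.2.2.1 w (mem_stage hv.1 hw.1 hcon.1) h)
  have hvu' : look M v u' := by
    by_contra hc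
    exact hU w v u' (lt_of_mem_passK hw.1) (lt_of_mem_passK hv.1) (lt_of_mem_stage hwu.1)
      hw.2 hv.2 hu' (fun h => hwv (hM.1 _ _ h)) hc hwu.2.1
  have e := hvu.2.2.1 u' (stage_subset hlt hwu.1 fun e => hM.2 v (by rwa [e] at hvu')) hvu'
  subst e
  exact hcon.1 (KeptPendant.inj hM hw.1 hv.1 hwu hvu)

open Classical in
-- Each `v` is itself a common neighbour of its pair, so every pair accounts for at most three
-- vertices.
theorem card_keptPair_mem_mem :
    ((kerSet M \ U).filter fun v => ∃ u ∈ U, ∃ w ∈ U, KeptPair M U v u w).card ≤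
      U.card * U.card * 3 := by
  rw [← Finset.card_product]
  refine le_trans (Finset.card_le_card (t := (U ×ˢ U).biUnion fun q =>
    if (kerCommon M U q.1 q.2).card ≤ 3 then kerCommon M U q.1 q.2 else ∅) fun v hv => ?_)
    (Finset.card_biUnion_le_card_mul _ _ _ fun q _ => ?_)
  · obtain ⟨hv, u, hu, w, hw, -, h, h3⟩ := Finset.mem_filter.1 hv
    refine Finset.mem_biUnion.2 ⟨(u, w), Finset.mem_product.2 ⟨hu, hw⟩, ?_⟩
    rw [if_pos h3]
    exact Finset.mem_filter.2 ⟨hv, h⟩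
  · split
    · assumption
    · simp

/-- Outside of `U`, non-adjacent vertices have the same neighbours. -/
theorem IsModulator.twin (hM : IsGraph M) (hU : IsModulator M U) {x y z : ℕ} (hx : x < M.length)
    (hy : y < M.length) (hz : z < M.length) (hx' : x ∉ U) (hy' : y ∉ U) (hz' : z ∉ U)
    (hxz : ¬ look M x z) (hyx : look M y x) : look M y z := by
  by_contra h
  exact hU y z x hy hz hx hy' hz' hx' h (fun h => hxz (hM.1 _ _ h)) hyx

theorem lt_of_mem_sdiff {v : ℕ} (hv : v ∈ kerSet M \ U) : v < M.length :=
  lt_of_mem_passK (Finset.mem_sdiff.1 hv).1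

open Classical in
-- For fixed `u`, take a witness `w` of one vertex. Vertices adjacent to `w` are common neighbours
-- of `u` and `w`. The remaining ones are twins of each other, so the witness `y` of one of them is
-- adjacent to all of them. This gives at most `3 + 3` vertices.
theorem card_keptPair_mem_notMem (hM : IsGraph M) (hU : IsModulator M U) :
    ((kerSet M \ U).filter fun v => ∃ u ∈ U, ∃ w ∉ U, KeptPair M U v u w).card ≤ U.card * 6 := by
  refine le_trans (Finset.card_le_card (t := U.biUnion fun u =>
    (kerSet M \ U).filter fun v => ∃ w ∉ U, KeptPair M U v u w) fun v hv => ?_)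
    (Finset.card_biUnion_le_card_mul _ _ _ fun u hu => ?_)
  · obtain ⟨hv, u, hu, h⟩ := Finset.mem_filter.1 hv
    exact Finset.mem_biUnion.2 ⟨u, hu, Finset.mem_filter.2 ⟨hv, h⟩⟩
  · rcases Finset.eq_empty_or_nonempty ((kerSet M \ U).filter fun v => ∃ w ∉ U, KeptPair M U v u w)
      with h | ⟨v, hv⟩
    · simp [h]
    obtain ⟨hv, w, hw, ⟨-, hwn⟩, -, h3⟩ := Finset.mem_filter.1 hv
    by_cases hall : ∀ z ∈ (kerSet M \ U).filter fun v => ∃ w ∉ U, KeptPair M U v u w, look M w z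
    · refine (Finset.card_le_card fun z hz => ?_).trans (h3.trans (by omega))
      have hwz := hall z hz
      obtain ⟨hz, _, _, -, h4, -⟩ := Finset.mem_filter.1 hz
      exact Finset.mem_filter.2 ⟨hz, h4.1, hwz⟩
    · push Not at hall
      obtain ⟨x, hx, hwx⟩ := hall
      obtain ⟨hx, y, hy, ⟨-, hyn⟩, h5, h6⟩ := Finset.mem_filter.1 hx
      refine (Finset.card_le_card (t := kerCommon M U u w ∪ kerCommon M U u y) fun z hz => ?_).trans
        ((Finset.card_union_le _ _).trans (by omega))
      obtain ⟨hz, _, _, -, h4, -⟩ := Finset.mem_filter.1 hz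
      by_cases hwz : look M w z
      · exact Finset.mem_union_left _ (Finset.mem_filter.2 ⟨hz, h4.1, hwz⟩)
      · refine Finset.mem_union_right _ (Finset.mem_filter.2 ⟨hz, h4.1, ?_⟩)
        have hx' := (Finset.mem_sdiff.1 hx).2
        have hz' := (Finset.mem_sdiff.1 hz).2
        refine hU.twin hM (lt_of_mem_sdiff hx) hyn (lt_of_mem_sdiff hz) hx' hy hz' ?_ h5.2
        exact hU x w z (lt_of_mem_sdiff hx) hwn (lt_of_mem_sdiff hz) hx' hw hz'
          (fun h => hwx (hM.1 _ _ h)) hwz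

open Classical in
-- Every vertex is a common neighbour of one fixed pair, or it misses `u`, or it misses `w`. Those
-- missing a given vertex are mutual twins, so they are common neighbours of the pair of any one of
-- them; each of the three sets has at most three elements.
theorem card_keptPair_notMem_notMem (hM : IsGraph M) (hU : IsModulator M U) :
    ((kerSet M \ U).filter fun v => ∃ u ∉ U, ∃ w ∉ U, KeptPair M U v u w).card ≤ 9 := by
  set T := (kerSet M \ U).filter fun v => ∃ u ∉ U, ∃ w ∉ U, KeptPair M U v u w with hT
  have cls_le : ∀ w < M.length, w ∉ U → (T.filter fun z => ¬ look M w z).card ≤ 3 := by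
    intro w hwn hw
    rcases Finset.eq_empty_or_nonempty (T.filter fun z => ¬ look M w z) with h | ⟨x, hx⟩
    · rw [h]; simp
    obtain ⟨hx, hwx⟩ := Finset.mem_filter.1 hx
    obtain ⟨hx, y, hy, y', hy', ⟨hyn, hyn'⟩, h5, h6⟩ := Finset.mem_filter.1 hx
    refine (Finset.card_le_card fun z hz => ?_).trans h6
    obtain ⟨hz, hwz⟩ := Finset.mem_filter.1 hz
    have hz := (Finset.mem_filter.1 hz).1
    have hx' := (Finset.mem_sdiff.1 hx).2
    have hz' := (Finset.mem_sdiff.1 hz).2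
    have hxz : ¬ look M x z := hU x w z (lt_of_mem_sdiff hx) hwn (lt_of_mem_sdiff hz) hx' hw hz'
      (fun h => hwx (hM.1 _ _ h)) hwz
    exact Finset.mem_filter.2 ⟨hz,
      hU.twin hM (lt_of_mem_sdiff hx) hyn (lt_of_mem_sdiff hz) hx' hy hz' hxz h5.1,
      hU.twin hM (lt_of_mem_sdiff hx) hyn' (lt_of_mem_sdiff hz) hx' hy' hz' hxz h5.2⟩
  rcases Finset.eq_empty_or_nonempty T with h | ⟨v, hv⟩
  · simp [h]
  obtain ⟨hv, u, hu, w, hw, ⟨hun, hwn⟩, -, h3⟩ := Finset.mem_filter.1 hv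
  have hsub : T ⊆ kerCommon M U u w ∪
      ((T.filter fun z => ¬ look M u z) ∪ T.filter fun z => ¬ look M w z) := by
    intro z hz
    simp only [Finset.mem_union, Finset.mem_filter, kerCommon]
    have hz' := (Finset.mem_filter.1 hz).1
    tauto
  have h1 := Finset.card_le_card hsub
  have h2 := Finset.card_union_le (kerCommon M U u w)
    ((T.filter fun z => ¬ look M u z) ∪ T.filter fun z => ¬ look M w z)
  have h4 := Finset.card_union_le (T.filter fun z => ¬ look M u z) (T.filter fun z => ¬ look M w z)
  have h5 := cls_le u hun hu
  have h6 := cls_le w hwn hw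
  omega

/-- The kernel has quadratically many vertices. -/
theorem card_kerSet_le (hM : IsGraph M) (hU : IsModulator M U) :
    (kerSet M).card ≤ 11 * (U.card ^ 2 + 1) := by
  classical
  have hsub : kerSet M ⊆ U ∪
      (((kerSet M \ U).filter fun v => ∃ u ∈ U, KeptPendant M v u) ∪
      (((kerSet M \ U).filter fun v => ∃ u ∉ U, KeptPendant M v u) ∪
      (((kerSet M \ U).filter fun v => ∃ u ∈ U, ∃ w ∈ U, KeptPair M U v u w) ∪
      (((kerSet M \ U).filter fun v => ∃ u ∈ U, ∃ w ∉ U, KeptPair M U v u w) ∪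
      ((kerSet M \ U).filter fun v => ∃ u ∉ U, ∃ w ∉ U, KeptPair M U v u w))))) := by
    intro v hv
    simp only [Finset.mem_union, Finset.mem_filter, Finset.mem_sdiff]
    by_cases hvU : v ∈ U
    · exact .inl hvU
    right
    rcases kept (U := U) hM hv with ⟨u, h⟩ | ⟨u, w, h⟩
    · by_cases hu : u ∈ U
      · exact .inl ⟨⟨hv, hvU⟩, u, hu, h⟩
      · exact .inr (.inl ⟨⟨hv, hvU⟩, u, hu, h⟩)
    · by_cases hu : u ∈ U <;> by_cases hw : w ∈ U
      · exact .inr (.inr (.inl ⟨⟨hv, hvU⟩, u, hu, w, hw, h⟩))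
      · exact .inr (.inr (.inr (.inl ⟨⟨hv, hvU⟩, u, hu, w, hw, h⟩)))
      · exact .inr (.inr (.inr (.inl ⟨⟨hv, hvU⟩, w, hw, u, hu, h.swap⟩)))
      · exact .inr (.inr (.inr (.inr ⟨⟨hv, hvU⟩, u, hu, w, hw, h⟩)))
  have h := Finset.card_le_card hsub
  have c1 := card_keptPendant_mem (U := U) hM
  have c2 := card_keptPendant_notMem hM hU
  have c3 := card_keptPair_mem_mem (M := M) (U := U)
  have c4 := card_keptPair_mem_notMem hM hU
  have c5 := card_keptPair_notMem_notMem hM hU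
  refine h.trans ?_
  refine (Finset.card_union_le _ _).trans ?_
  refine (Nat.add_le_add_left (Finset.card_union_le _ _) _).trans ?_
  refine (Nat.add_le_add_left (Nat.add_le_add_left (Finset.card_union_le _ _) _) _).trans ?_
  refine (Nat.add_le_add_left (Nat.add_le_add_left (Nat.add_le_add_left
    (Finset.card_union_le _ _) _) _) _).trans ?_
  refine (Nat.add_le_add_left (Nat.add_le_add_left (Nat.add_le_add_left (Nat.add_le_add_left
    (Finset.card_union_le _ _) _) _) _) _).trans ?_
  -- The six bounds add up to `3 * U.card ^ 2 + 8 * U.card + 11`.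
  have hk : U.card ≤ U.card * U.card := Nat.le_mul_self _
  rw [pow_two]
  omega

end
end EnumKernel

/-! ### Translation between graphs, partitions and matrices; the reduced instance. -/

namespace EnumKernel
open Enc (enc)

/-! ## Co-cluster graphs -/

section
variable {V : Type*} {G : SimpleGraph V}

/-- Components of the complement are cliques exactly when adjacency or equality in the complement is
transitive; for the converse, transitivity is propagated along a walk. -/
theorem isCoCluster_iff : IsCoCluster G ↔ ∀ a b c, ¬ G.Adj a b → ¬ G.Adj b c → ¬ G.Adj a c := by
  constructor
  · intro h a b c hab hbc hac
    by_cases e1 : a = b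
    · subst e1; exact hbc hac
    by_cases e2 : b = c
    · subst e2; exact hab hac
    have r1 : Gᶜ.Adj a b := (G.compl_adj a b).2 ⟨e1, hab⟩
    have r2 : Gᶜ.Adj b c := (G.compl_adj b c).2 ⟨e2, hbc⟩
    have hr : Gᶜ.Reachable a c := r1.reachable.trans r2.reachable
    have := h (Gᶜ.connectedComponentMk c) (SimpleGraph.ConnectedComponent.eq.2 hr)
      (rfl : Gᶜ.connectedComponentMk c = _) hac.ne
    exact ((G.compl_adj a c).1 this).2 hac
  · intro h
    have key : ∀ {a b}, Gᶜ.Walk a b → ¬ G.Adj a b := by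
      intro a b w
      induction w with
      | nil => exact G.irrefl
      | cons hab _ ih => exact h _ _ _ ((G.compl_adj _ _).1 hab).2 ih
    intro C a ha b hb hab
    obtain ⟨w⟩ := SimpleGraph.ConnectedComponent.exact (ha.trans hb.symm : _ = _)
    exact (G.compl_adj a b).2 ⟨hab, key w⟩

end

theorem exists_modulator {V : Type*} [Fintype V] (G : SimpleGraph V) :
    ∃ U : Finset V, U.card = coClusterDist G ∧
      ∀ a b c, a ∉ U → b ∉ U → c ∉ U → ¬ G.Adj a b → ¬ G.Adj b c → ¬ G.Adj a c := by
  obtain ⟨U, h1, h2⟩ := Nat.sInf_mem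
    (s := {m | ∃ U : Finset V, U.card = m ∧ IsCoCluster (G.induce {v | v ∉ U})})
    ⟨_, Finset.univ, rfl, isCoCluster_iff.2 fun a => absurd (Finset.mem_univ a.1) a.2⟩
  refine ⟨U, h1, fun a b c ha hb hc hab hbc => ?_⟩
  exact isCoCluster_iff.1 h2 ⟨a, ha⟩ ⟨b, hb⟩ ⟨c, hc⟩ hab hbc

theorem coClusterDist_le {V : Type*} [Fintype V] {G : SimpleGraph V} (U : Finset V)
    (h : ∀ a b c, a ∉ U → b ∉ U → c ∉ U → ¬ G.Adj a b → ¬ G.Adj b c → ¬ G.Adj a c) :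
    coClusterDist G ≤ U.card :=
  Nat.sInf_le ⟨U, rfl, isCoCluster_iff.2 fun a b c => h a b c a.2 b.2 c.2⟩

/-! ## Matrices of relations on `Fin n` -/

open Classical in
/-- The matrix of a relation on `Fin n`. -/
noncomputable def relMat {n : ℕ} (r : Fin n → Fin n → Prop) : Mat :=
  (List.finRange n).map fun i => (List.finRange n).map fun j => decide (r i j)

/-- Identifies the problem's own encoding with that of typed data, so that programs obtained from
`PTF` apply to actual instances. -/
theorem enc_relMat {n : ℕ} (r : Fin n → Fin n → Prop) : enc (relMat r) = encRel r := by
  change encList ((relMat r).map fun l => encList (l.map encBool)) = _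
  rw [relMat, encRel, List.map_map]
  congr 2
  funext i
  simp only [Function.comp, List.map_map]
  rfl

theorem length_relMat {n : ℕ} (r : Fin n → Fin n → Prop) : (relMat r).length = n := by
  simp [relMat]

theorem relMat_eq_mat {n : ℕ} {r : Fin n → Fin n → Prop} {f : ℕ → ℕ → Bool}
    (h : ∀ i j : Fin n, f i j ↔ r i j) : relMat r = mat n f := by
  have e : ∀ {α : Type} (g : ℕ → α), (List.range n).map g = (List.finRange n).map fun i : Fin n => g i :=
    fun g => List.ext_getElem (by simp) (by simp)
  rw [relMat, mat, e]
  refine List.map_congr_left fun i _ => ?_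
  rw [e]
  refine List.map_congr_left fun j _ => ?_
  rw [Bool.eq_iff_iff, h]
  simp only [decide_eq_true_eq]

open Classical in
theorem look_relMat {n : ℕ} (r : Fin n → Fin n → Prop) (i j : ℕ) :
    look (relMat r) i j ↔ ∃ (hi : i < n) (hj : j < n), r ⟨i, hi⟩ ⟨j, hj⟩ := by
  rw [relMat_eq_mat (f := fun i j => decide (∃ (hi : i < n) (hj : j < n), r ⟨i, hi⟩ ⟨j, hj⟩))
    (fun i j => by simp), look_mat, Bool.and_eq_true, decide_eq_true_eq, decide_eq_true_eq]
  exact ⟨fun h => h.2, fun h => ⟨⟨h.1, h.2.1⟩, h⟩⟩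

theorem relMat_wf {n : ℕ} (r : Fin n → Fin n → Prop) : relMat r = mat n (look (relMat r)) :=
  relMat_eq_mat fun i j => by rw [look_relMat]; simp

theorem enc_list_injective {α : Type} [Enc α] (h : Function.Injective (enc : α → Data)) :
    Function.Injective (enc : List α → Data) := by
  intro l
  induction l with
  | nil =>
    intro l' e
    cases l' with
    | nil => rfl
    | cons b l' => rw [enc_nil, enc_cons] at e; cases e
  | cons a l ih =>
    intro l' e
    cases l' with
    | nil => rw [enc_nil, enc_cons] at e; cases e
    | cons b l' =>
      rw [enc_cons, enc_cons] at e
      injection e with e1 e2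
      rw [h e1, ih e2]

theorem enc_mat_injective : Function.Injective (enc : Mat → Data) := by
  refine enc_list_injective (enc_list_injective fun a b e => ?_)
  cases a <;> cases b <;> first | rfl | cases e

theorem sz_mat_le (n : ℕ) (f : ℕ → ℕ → Bool) : sz (mat n f) ≤ 1 + n * (2 + 4 * n) := by
  refine (sz_le_of_forall (B := 1 + 4 * n) fun l hl => ?_).trans (le_of_eq ?_)
  · obtain ⟨i, -, rfl⟩ := List.mem_map.1 hl
    refine (sz_le_of_forall (B := 3) fun b _ => sz_bool b).trans ?_
    rw [List.length_map, List.length_range]; omega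
  · rw [mat, List.length_map, List.length_range]; ring

/-! ## Partitions -/

section
variable {n : ℕ} (G : SimpleGraph (Fin n)) (P : Finpartition (Finset.univ : Finset (Fin n)))

/-- The relation of lying in the same part. -/
def samePart (i j : Fin n) : Prop := ∃ A ∈ P.parts, i ∈ A ∧ j ∈ A

variable {P} in
theorem samePart_iff {A : Finset (Fin n)} (hA : A ∈ P.parts) {i j : Fin n} (hi : i ∈ A) :
    samePart P i j ↔ j ∈ A :=
  ⟨fun ⟨_, hB, hiB, hjB⟩ => P.eq_of_mem_parts hB hA hiB hi ▸ hjB, fun hj => ⟨A, hA, hi, hj⟩⟩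

theorem isMM_samePart_iff :
    IsMM (look (relMat G.Adj)) (Finset.range n) (look (relMat (samePart P))) ↔
      IsMatchingMulticut G P := by
  constructor
  · intro h A hA v hv
    rw [Set.ncard_le_one (Set.toFinite _)]
    rintro a ⟨hva, ha⟩ b ⟨hvb, hb⟩
    have hn : ∀ u : Fin n, u ∉ A → ¬ look (relMat (samePart P)) v u := by
      intro u hu h1
      rw [look_relMat] at h1
      obtain ⟨_, _, h1⟩ := h1
      exact hu ((samePart_iff hA hv).1 h1)
    refine Fin.ext (h.cut v ?_ a ?_ b ?_ ?_ ?_ (hn a ha) (hn b hb))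
    · simp
    · simp
    · simp
    · rw [look_relMat]; exact ⟨v.2, a.2, hva⟩
    · rw [look_relMat]; exact ⟨v.2, b.2, hvb⟩
  · intro h
    refine ⟨fun i => ?_, fun i j => ?_, fun i j k => ?_, fun y hy a ha b hb => ?_⟩
    · rw [look_relMat, Finset.mem_range]
      refine ⟨fun h => h.1, fun hi => ⟨hi, hi, ?_⟩⟩
      obtain ⟨A, hA, hiA⟩ := P.exists_mem (Finset.mem_univ (⟨i, hi⟩ : Fin n))
      exact ⟨A, hA, hiA, hiA⟩
    · rw [look_relMat, look_relMat]
      rintro ⟨hi, hj, A, hA, h1, h2⟩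
      exact ⟨hj, hi, A, hA, h2, h1⟩
    · rw [look_relMat, look_relMat, look_relMat]
      rintro ⟨hi, hj, A, hA, h1, h2⟩ ⟨_, hk, h3⟩
      exact ⟨hi, hk, A, hA, h1, (samePart_iff hA h2).1 h3⟩
    · rw [Finset.mem_range] at hy ha hb
      simp only [look_relMat]
      rintro ⟨_, _, hya⟩ ⟨_, _, hyb⟩ h1 h2
      obtain ⟨A, hA, hyA⟩ := P.exists_mem (Finset.mem_univ (⟨y, hy⟩ : Fin n))
      have := h A hA _ hyA
      rw [Set.ncard_le_one (Set.toFinite _)] at this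
      exact congrArg Fin.val (this ⟨a, ha⟩ ⟨hya, fun h3 => h1 ⟨hy, ha, A, hA, hyA, h3⟩⟩ ⟨b, hb⟩
        ⟨hyb, fun h3 => h2 ⟨hy, hb, A, hA, hyA, h3⟩⟩)

theorem ncls_samePart : ncls (Finset.range n) (look (relMat (samePart P))) = P.parts.card := by
  rw [← Finset.card_map (Finset.mapEmbedding (Fin.valEmbedding (n := n))).toEmbedding, ncls]
  congr 1
  have key : ∀ A ∈ P.parts, ∀ i : Fin n, i ∈ A →
      cls (Finset.range n) (look (relMat (samePart P))) i = A.map Fin.valEmbedding := by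
    intro A hA i hi
    ext j
    simp only [cls, Finset.mem_filter, Finset.mem_range, look_relMat, Finset.mem_map,
      Fin.valEmbedding_apply]
    constructor
    · rintro ⟨hj, _, _, h⟩
      exact ⟨⟨j, hj⟩, (samePart_iff hA hi).1 h, rfl⟩
    · rintro ⟨k, hk, rfl⟩
      exact ⟨k.2, i.2, k.2, (samePart_iff hA hi).2 hk⟩
  ext c
  simp only [Finset.mem_image, Finset.mem_range, Finset.mem_map, RelEmbedding.coe_toEmbedding,
    Finset.mapEmbedding_apply]
  constructor
  · rintro ⟨i, hi, rfl⟩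
    obtain ⟨A, hA, hiA⟩ := P.exists_mem (Finset.mem_univ (⟨i, hi⟩ : Fin n))
    exact ⟨A, hA, (key A hA _ hiA).symm⟩
  · rintro ⟨A, hA, rfl⟩
    obtain ⟨i, hi⟩ := P.nonempty_of_mem_parts hA
    exact ⟨i, i.2, key A hA i hi⟩

theorem mem_Sol_iff (x : MulticutInstance) (d : Data) : d ∈ enumMatchingMulticut.Sol x ↔
    ∃ m, IsSol (look (relMat x.graph.Adj)) x.n (Finset.range x.n) x.ℓ m ∧ enc m = d := by
  constructor
  · rintro ⟨P, h1, h2, rfl⟩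
    exact ⟨relMat (samePart P), ⟨relMat_wf _, (isMM_samePart_iff _ P).2 h1,
      by rwa [ncls_samePart]⟩, enc_relMat _⟩
  · rintro ⟨m, hm, rfl⟩
    classical
    let s : Setoid (Fin x.n) := ⟨fun i j => look m i j,
      fun i => (hm.mm.refl_iff i).2 (Finset.mem_range.2 i.2), fun h => hm.mm.symm _ _ h,
      fun h h' => hm.mm.trans _ _ _ h h'⟩
    let P := Finpartition.ofSetoid s
    have hP : ∀ i j : Fin x.n, look m i j ↔ samePart P i j := by
      intro i j
      rw [samePart_iff (P.part_mem.2 (Finset.mem_univ i)) (P.mem_part (Finset.mem_univ i)),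
        Finpartition.mem_part_ofSetoid_iff_rel]
      exact Iff.rfl
    have e : m = relMat (samePart P) := hm.wf.trans (relMat_eq_mat hP).symm
    rw [e] at hm ⊢
    exact ⟨P, (isMM_samePart_iff _ P).1 hm.mm, by rw [← ncls_samePart]; exact hm.card,
      (enc_relMat _).symm⟩

end

/-! ## The reduced instance -/

/-- The adjacency matrix of an instance. -/
noncomputable def adjMat (x : MulticutInstance) : Mat := relMat x.graph.Adj

theorem length_adjMat (x : MulticutInstance) : (adjMat x).length = x.n := length_relMat _

theorem isGraph_adjMat (x : MulticutInstance) : IsGraph (adjMat x) := by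
  constructor
  · intro i j
    rw [adjMat, look_relMat, look_relMat]
    exact fun ⟨hi, hj, h⟩ => ⟨hj, hi, h.symm⟩
  · intro i h
    rw [adjMat, look_relMat] at h
    exact x.graph.irrefl h.2.2

theorem kerSet_lt (M : Mat) : ∀ i ∈ kerSet M, i < M.length := fun _ => lt_of_mem_passK

/-- The reduced instance. -/
noncomputable def reduced (x : MulticutInstance) : MulticutInstance where
  n := 3 * (kerSet (adjMat x)).card
  graph :=
    { Adj := fun i j => look (kerMat (adjMat x) (lst (adjMat x).length (kerSet (adjMat x)))) i j
      symm := ⟨fun i j h => (isGraph_kerMat (kerSet_lt _) (isGraph_adjMat x)).1 i j h⟩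
      loopless := ⟨fun i h => (isGraph_kerMat (kerSet_lt _) (isGraph_adjMat x)).2 i h⟩ }
  ℓ := min (pass (adjMat x) (min x.ℓ (x.n + 1))).2.1 ((kerSet (adjMat x)).card + 1)

/-- Equality of matrices, not only of relations: the compressor must output the encoding of the
reduced instance literally. -/
theorem relMat_reduced (x : MulticutInstance) : relMat (reduced x).graph.Adj =
    kerMat (adjMat x) (lst (adjMat x).length (kerSet (adjMat x))) := by
  have h : ∀ i j, look (relMat (reduced x).graph.Adj) i j =
      look (kerMat (adjMat x) (lst (adjMat x).length (kerSet (adjMat x)))) i j := by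
    intro i j
    rw [Bool.eq_iff_iff, look_relMat]
    refine ⟨fun ⟨_, _, h⟩ => h, fun h => ?_⟩
    have := ((look_kerMat (kerSet_lt _)).1 h).1
    exact ⟨this.1, this.2, h⟩
  rw [relMat_wf, show look (relMat (reduced x).graph.Adj) = _ from funext₂ h]
  conv_rhs => rw [kerMat, length_lst (kerSet_lt _), ← mat]
  unfold mat
  rw [show (reduced x).n = (kerSet (adjMat x)).card + (kerSet (adjMat x)).card +
    (kerSet (adjMat x)).card by change 3 * _ = _; ring]
  refine List.map_congr_left fun i hi => List.map_congr_left fun j hj => ?_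
  rw [List.mem_range] at hi hj
  conv_lhs => rw [kerMat, length_lst (kerSet_lt _), ← mat, look_mat]
  simp [hi, hj]

theorem card_kerSet_adjMat_le (x : MulticutInstance) :
    (kerSet (adjMat x)).card ≤ 11 * (coClusterDist x.graph ^ 2 + 1) := by
  obtain ⟨U, h1, h2⟩ := exists_modulator x.graph
  rw [← h1, ← Finset.card_map Fin.valEmbedding]
  refine card_kerSet_le (isGraph_adjMat x) fun a b c ha hb hc ha' hb' hc' => ?_
  rw [length_adjMat] at ha hb hc
  have hn : ∀ {i} (hi : i < x.n), i ∉ U.map Fin.valEmbedding → (⟨i, hi⟩ : Fin x.n) ∉ U :=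
    fun hi h h' => h (Finset.mem_map.2 ⟨_, h', rfl⟩)
  have hadj : ∀ {i j} (hi : i < x.n) (hj : j < x.n),
      look (adjMat x) i j ↔ x.graph.Adj ⟨i, hi⟩ ⟨j, hj⟩ := by
    intro i j hi hj
    rw [adjMat, look_relMat]
    exact ⟨fun ⟨_, _, h⟩ => h, fun h => ⟨hi, hj, h⟩⟩
  rw [hadj ha hb, hadj hb hc, hadj ha hc]
  exact h2 _ _ _ (hn ha ha') (hn hb hb') (hn hc hc')

theorem coClusterDist_reduced (x : MulticutInstance) :
    coClusterDist (reduced x).graph = (kerSet (adjMat x)).card - 1 := by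
  have hadj : ∀ i j : Fin (reduced x).n, (reduced x).graph.Adj i j ↔ _ := fun i j =>
    look_kerMat (kerSet_lt (adjMat x)) (i := i) (j := j)
  generalize hk : (kerSet (adjMat x)).card = k at hadj ⊢
  have hn : (reduced x).n = 3 * k := by rw [← hk]; rfl
  apply le_antisymm
  -- Deleting all vertices of `K` except the one carrying the clique leaves a complete graph.
  · let U : Finset (Fin (reduced x).n) := Finset.univ.filter fun i => 0 < i.1 ∧ i.1 < k
    have hU : ∀ i : Fin (reduced x).n, i ∉ U → i.1 = 0 ∨ k ≤ i.1 := by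
      intro i hi
      simp only [U, Finset.mem_filter, Finset.mem_univ, true_and] at hi
      omega
    refine (coClusterDist_le U fun a b c ha hb hc hab hbc hac => ?_).trans ?_
    · have e : ∀ i j : Fin (reduced x).n, i ∉ U → j ∉ U → ¬ (reduced x).graph.Adj i j → i = j := by
        intro i j hi hj hij
        by_contra hne
        exact hij ((hadj i j).2 ⟨⟨hn ▸ i.2, hn ▸ j.2⟩, fun h => hne (Fin.ext h),
          .inr ⟨hU i hi, hU j hj⟩⟩)
      have e1 := e a b ha hb hab
      have e2 := e b c hb hc hbc
      subst e1 e2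
      exact (reduced x).graph.irrefl hac
    · rw [← Finset.card_map Fin.valEmbedding]
      refine (Finset.card_le_card (t := Finset.Ioo 0 k) fun i hi => ?_).trans (by simp)
      obtain ⟨j, hj, rfl⟩ := Finset.mem_map.1 hi
      exact Finset.mem_Ioo.2 (Finset.mem_filter.1 hj).2
  · obtain ⟨U, h1, h2⟩ := exists_modulator (reduced x).graph
    rw [← h1, ← Finset.card_map Fin.valEmbedding]
    -- If at most one of the `2 * k` new vertices survives, then `U` is already large enough.
    by_cases h : (Finset.Ico k (3 * k) \ U.map Fin.valEmbedding).card ≤ 1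
    · have := Finset.le_card_sdiff (U.map Fin.valEmbedding) (Finset.Ico k (3 * k))
      rw [Nat.card_Ico] at this
      omega
    -- Two surviving new vertices `a`, `b` are adjacent, while each `c` with `0 < c < k` is adjacent
    -- to neither; transitivity of non-adjacency forces every such `c` into `U`.
    · obtain ⟨a, ha, b, hb, hab⟩ := Finset.one_lt_card.1 (not_le.1 h)
      rw [Finset.mem_sdiff, Finset.mem_Ico] at ha hb
      have nm : ∀ {i} (hi : i < (reduced x).n), i ∉ U.map Fin.valEmbedding →
        (⟨i, hi⟩ : Fin (reduced x).n) ∉ U := fun hi h h' => h (Finset.mem_map.2 ⟨_, h', rfl⟩)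
      refine le_trans (by simp) (Finset.card_le_card (s := Finset.Ioo 0 k) fun c hc => ?_)
      rw [Finset.mem_Ioo] at hc
      by_contra hcU
      refine h2 ⟨a, by omega⟩ ⟨c, by omega⟩ ⟨b, by omega⟩ (nm _ ha.2) (nm _ hcU) (nm _ hb.2)
        (fun h => ?_) (fun h => ?_) ((hadj _ _).2 ⟨⟨ha.1.2, hb.1.2⟩, hab,
          .inr ⟨.inr ha.1.1, .inr hb.1.1⟩⟩)
      · have := (hadj _ _).1 h
        simp only at this
        omega
      · have := (hadj _ _).1 h
        simp only at this
        omega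

end EnumKernel

/-! ### Assembling the kernel. -/

namespace EnumKernel
open Enc (enc)

/-! ## The kernel -/

/-- The input of the compressor. -/
noncomputable def pairOf (x : MulticutInstance) : (Mat × List Bool) × List Bool :=
  ((adjMat x, x.ℓ.bits), (coClusterDist x.graph).bits)

theorem enc_pairOf (x : MulticutInstance) : enc (pairOf x) = enumMatchingMulticut.encPair x := by
  change Data.cons (.cons (enc (relMat x.graph.Adj)) _) _ = _
  rw [enc_relMat]; rfl

theorem passBits_pairOf (x : MulticutInstance) :
    passBits (pairOf x).1 = pass (adjMat x) (min x.ℓ (x.n + 1)) := by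
  rw [passBits, pairOf, truncVal_bits, length_adjMat]

theorem compressFun_pairOf (x : MulticutInstance) :
    compressFun (pairOf x) = pairOf (reduced x) := by
  rw [compressFun, passBits_pairOf, pass_fst, length_lst (kerSet_lt _), pairOf, pairOf,
    coClusterDist_reduced, show adjMat (reduced x) = _ from relMat_reduced x]
  rfl

theorem length_eq_sz (x : MulticutInstance) :
    enumMatchingMulticut.length x = sz (adjMat x, x.ℓ.bits) := by
  rw [sz, enc_mk, adjMat, enc_relMat]; rfl

theorem sz_pairOf_le (x : MulticutInstance) : sz (pairOf x) ≤
    2 + enumMatchingMulticut.length x + 4 * enumMatchingMulticut.param x := by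
  have := sz_bits_le (coClusterDist x.graph)
  rw [length_eq_sz, pairOf, sz_mk]
  change _ ≤ 2 + _ + 4 * coClusterDist x.graph
  omega

theorem compress_spec : ∃ (c : Prog) (p : Polynomial ℕ), ∀ x : MulticutInstance,
    ComputesInTime c (enumMatchingMulticut.encPair x) (enumMatchingMulticut.encPair (reduced x))
      (p.eval (enumMatchingMulticut.length x + enumMatchingMulticut.param x)) := by
  obtain ⟨T, ⟨q, hq⟩, hT⟩ := PTF.compressFun
  obtain ⟨c, hc⟩ := hT 0
  refine ⟨c, q.comp (4 * Polynomial.X + 2), fun x => ?_⟩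
  obtain ⟨τ, ⟨k, hk, hr⟩, h0, -⟩ := hc (initStore (enc (pairOf x))) (pairOf x) rfl
  rw [compressFun_pairOf, enc_pairOf] at h0
  rw [enc_pairOf] at hr
  refine ⟨_, τ, hr, h0, ?_⟩
  rw [ticks, List.length_replicate, Polynomial.eval_comp]
  refine (hk.trans (hq _)).trans (eval_mono q ((sz_pairOf_le x).trans ?_))
  simp; omega

theorem n_reduced_le (x : MulticutInstance) :
    (reduced x).n ≤ 33 * (coClusterDist x.graph ^ 2 + 1) := by
  have := card_kerSet_adjMat_le x
  change 3 * _ ≤ _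
  omega

theorem length_reduced_le (x : MulticutInstance) : enumMatchingMulticut.length (reduced x) ≤
    7 + (reduced x).n * (2 + 4 * (reduced x).n) + 4 * (reduced x).n := by
  have h1 := sz_bits_le (reduced x).ℓ
  have h2 := sz_mat_le (reduced x).n (look (adjMat (reduced x)))
  have h3 : (reduced x).ℓ ≤ (reduced x).n + 1 :=
    (min_le_right _ _).trans (by change _ ≤ 3 * _ + 1; omega)
  rw [adjMat, ← relMat_wf] at h2
  rw [length_eq_sz, sz_mk, adjMat]
  omega

theorem param_reduced_le (x : MulticutInstance) :
    enumMatchingMulticut.param (reduced x) ≤ (reduced x).n := by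
  refine (coClusterDist_reduced x).trans_le ?_
  change _ ≤ 3 * _
  omega

theorem reduced_bounded : ∃ g : ℕ → ℕ, Computable g ∧ ∀ x : MulticutInstance,
    enumMatchingMulticut.length (reduced x) ≤ g (enumMatchingMulticut.param x) ∧
      enumMatchingMulticut.param (reduced x) ≤ g (enumMatchingMulticut.param x) := by
  -- The number of vertices is at most `33 * (k * k + 1)`, since the clique triples the bound `11 *
  -- (k ^ 2 + 1)`; this is inserted into the bound on the encoding length.
  refine ⟨fun k => 7 + (33 * (k * k + 1)) * (2 + 4 * (33 * (k * k + 1))) + 4 * (33 * (k * k + 1)),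
    Primrec.to_comp ?_, fun x => ?_⟩
  · have h : Primrec fun k : ℕ => 33 * (k * k + 1) := Primrec.nat_mul.comp (.const 33)
      (Primrec.nat_add.comp (Primrec.nat_mul.comp .id .id) (.const 1))
    have h4 := Primrec.nat_mul.comp (.const 4) h
    exact Primrec.nat_add.comp (Primrec.nat_add.comp (.const 7)
      (Primrec.nat_mul.comp h (Primrec.nat_add.comp (.const 2) h4))) h4
  · have h := n_reduced_le x
    rw [sq] at h
    change (reduced x).n ≤ 33 * (enumMatchingMulticut.param x * enumMatchingMulticut.param x + 1) at h
    refine ⟨(length_reduced_le x).trans ?_, (param_reduced_le x).trans ?_⟩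
    · dsimp only
      gcongr
    · change _ ≤ 7 + _ + 4 * _
      omega

/-- The matrices of the matching multicuts of `x` that arise from a matching multicut of the
reduced instance. -/
noncomputable def lifted (x : MulticutInstance) (m : Mat) : List Mat :=
  leaves (children (adjMat x)) (pass (adjMat x) (min x.ℓ (x.n + 1))).2.2
    (unker (adjMat x).length (lst (adjMat x).length (kerSet (adjMat x))) m)

/-- Removal of the clique composed with the reinsertion of all deleted vertices; both caps on the
required number of parts disappear by `isSol_min`. -/
theorem isLift_lifted (x : MulticutInstance) :
    IsLift (IsSol (look (relMat (reduced x).graph.Adj)) (reduced x).n (Finset.range (reduced x).n)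
      (reduced x).ℓ) (IsSol (look (relMat x.graph.Adj)) x.n (Finset.range x.n) x.ℓ) (lifted x) := by
  have h1 := isLift_unker (kerSet_lt _) (isGraph_adjMat x) (reduced x).ℓ
  have h2 := (pass_chain (adjMat x) (min x.ℓ (x.n + 1))).isLift (isGraph_adjMat x)
  rw [← relMat_reduced, show IsSol (look (adjMat x)) (adjMat x).length (kerSet (adjMat x))
    (reduced x).ℓ = _ from funext fun m => propext (isSol_min (Nat.lt_succ_self _))] at h1
  have h := h1.flatMap h2
  rw [length_adjMat, show IsSol (look (adjMat x)) x.n (Finset.range x.n) (min x.ℓ (x.n + 1)) = _ from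
    funext fun m => propext (isSol_min (by simp))] at h
  exact h.congr fun m _ => by simp [lifted, length_adjMat]

/-- The lifting program. -/
theorem exists_lifting : ∃ (c : Prog) (D : LiftInput → ℕ), PolyBd D ∧
    ∀ (x : MulticutInstance) (m : Mat), IsSol (look (relMat (reduced x).graph.Adj)) (reduced x).n
      (Finset.range (reduced x).n) (reduced x).ℓ m →
      ∃ t τ, Run c (initStore (enc (pairOf x, pairOf (reduced x), m))) t τ ∧
        t.filterMap id = (lifted x m).map enc ∧
        ∀ k, ticks k <:+: t → k ≤ D (pairOf x, pairOf (reduced x), m) := by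
  -- The rest of the log is a suffix of the whole log, which bounds its size, and the current matrix
  -- solves the graph at this point of the chain, which guarantees a child.
  let Inv : LiftInput → List (ℕ × ℕ) → Mat → Prop := fun a L r => IsGraph a.1.1.1 ∧
    L <:+ (liftInit a).1 ∧ ∃ l₀ K l, Chain a.1.1.1 l₀ L K l ∧
      IsSol (look a.1.1.1) a.1.1.1.length K l r
  have hn : PolyBd fun a : LiftInput => a.1.1.1.length :=
    (show PTF fun a : LiftInput => a.1.1.1.length by fun_prop).polyBd_sz.mono
      fun a => by rw [sz_nat]; omega
  obtain ⟨c, D, hD, h⟩ := exists_enumerator (init := liftInit)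
    (ex := fun a e r => children a.1.1.1 e r) PTF.liftInit (by fun_prop) (Inv := Inv)
    (B := fun a => 2 + sz (liftInit a) +
      a.1.1.1.length * (2 + 4 * a.1.1.1.length))
    (((PolyBd.const 2).add PTF.liftInit.polyBd_sz).add
      (hn.mul ((PolyBd.const 2).add ((PolyBd.const 4).mul hn))))
    (fun a L r ⟨_, h2, _, _, _, _, h3⟩ => by
      have e1 := sz_le_of_sublist h2.sublist
      have e2 := sz_mat_le a.1.1.1.length (look r)
      rw [← h3.wf] at e2
      rw [sz_mk, show sz (liftInit a) = 1 + sz (liftInit a).1 + sz (liftInit a).2 from rfl]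
      omega)
    (fun a e L r ⟨h1, h2, l₀, K, l, ⟨h3, h4, h5, h6, h7, h8⟩, h9⟩ => by
      subst h7
      have h := isLift_children h1 h3 h4 h5 h6 e.2
      exact ⟨h.ne_nil r h9, fun r' hr' => ⟨h1, (List.suffix_cons e L).trans h2, l₀, _, _, h8,
        h.sol r h9 r' hr'⟩⟩)
  refine ⟨c, D, hD, fun x m hm => ?_⟩
  have e : liftInit (pairOf x, pairOf (reduced x), m) =
      ((pass (adjMat x) (min x.ℓ (x.n + 1))).2.2,
        unker (adjMat x).length (lst (adjMat x).length (kerSet (adjMat x))) m) := by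
    rw [liftInit, passBits_pairOf, pass_fst]; rfl
  have h1 := isLift_unker (kerSet_lt _) (isGraph_adjMat x) (reduced x).ℓ
  rw [← relMat_reduced] at h1
  have h2 := h (pairOf x, pairOf (reduced x), m) (by
    rw [e]
    refine ⟨isGraph_adjMat x, by rw [e], _, _, _, pass_chain _ _, ?_⟩
    exact (isSol_min (Nat.lt_succ_self _)).1 (h1.sol m hm _ (by simp)))
  rw [e] at h2
  exact h2

theorem lift_spec : ∃ (c : Prog) (S : MulticutInstance → Data → Set Data),
    (∀ x : MulticutInstance,
      (∀ s ∈ enumMatchingMulticut.Sol (reduced x), (S x s).Nonempty) ∧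
      (enumMatchingMulticut.Sol (reduced x)).PairwiseDisjoint (S x) ∧
      ⋃ s ∈ enumMatchingMulticut.Sol (reduced x), S x s = enumMatchingMulticut.Sol x) ∧
    ∃ p : Polynomial ℕ, ∀ x : MulticutInstance, ∀ s ∈ enumMatchingMulticut.Sol (reduced x),
      EnumeratesWithDelay c (.cons (enumMatchingMulticut.encPair x)
        (.cons (enumMatchingMulticut.encPair (reduced x)) s)) (S x s)
        (p.eval (enumMatchingMulticut.length x + enumMatchingMulticut.length (reduced x) +
          enumMatchingMulticut.param x + enumMatchingMulticut.param (reduced x))) := by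
  obtain ⟨c, D, ⟨q, hq⟩, h⟩ := exists_lifting
  let S : MulticutInstance → Data → Set Data := fun x s =>
    {d | ∃ m, enc m = s ∧ d ∈ (lifted x m).map enc}
  have hS : ∀ x m, S x (enc m) = {d | d ∈ (lifted x m).map enc} := fun x m => Set.ext fun d =>
    ⟨fun ⟨m', e, h⟩ => enc_mat_injective e ▸ h, fun h => ⟨m, rfl, h⟩⟩
  refine ⟨c, S, fun x => ⟨fun s hs => ?_, fun s hs s' hs' hne => ?_, Set.ext fun d => ?_⟩,
    -- The linear part covers the two encoded pairs, and the last summand covers the matrix of the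
    -- given solution, whose order is at most the length of the reduced instance.
    q.comp (6 + 5 * Polynomial.X + (1 + Polynomial.X * (2 + 4 * Polynomial.X))), fun x s hs => ?_⟩
  · obtain ⟨m, hm, rfl⟩ := (mem_Sol_iff _ _).1 hs
    obtain ⟨r, hr⟩ := List.exists_mem_of_ne_nil _ ((isLift_lifted x).ne_nil m hm)
    rw [hS]
    exact ⟨enc r, List.mem_map_of_mem hr⟩
  · obtain ⟨m, hm, rfl⟩ := (mem_Sol_iff _ _).1 hs
    obtain ⟨m', hm', rfl⟩ := (mem_Sol_iff _ _).1 hs'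
    change Disjoint (S x _) (S x _)
    rw [hS, hS, Set.disjoint_left]
    intro d hd hd'
    obtain ⟨r, hr, rfl⟩ := List.mem_map.1 hd
    obtain ⟨r', hr', e⟩ := List.mem_map.1 hd'
    rw [enc_mat_injective e] at hr'
    exact hne (congrArg enc ((isLift_lifted x).disj m m' r hm hm' hr hr'))
  · rw [Set.mem_iUnion₂, mem_Sol_iff]
    constructor
    · rintro ⟨s, hs, hd⟩
      obtain ⟨m, hm, rfl⟩ := (mem_Sol_iff _ _).1 hs
      rw [hS] at hd
      obtain ⟨r, hr, rfl⟩ := List.mem_map.1 hd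
      exact ⟨r, (isLift_lifted x).sol m hm r hr, rfl⟩
    · rintro ⟨r, hr, rfl⟩
      obtain ⟨m, hm, hmr⟩ := (isLift_lifted x).surj r hr
      refine ⟨enc m, (mem_Sol_iff _ _).2 ⟨m, hm, rfl⟩, ?_⟩
      rw [hS]
      exact List.mem_map_of_mem hmr
  · obtain ⟨m, hm, rfl⟩ := (mem_Sol_iff _ _).1 hs
    obtain ⟨t, τ, hr, ht, hd⟩ := h x m hm
    rw [enc_mk (pairOf x), enc_mk (pairOf (reduced x)), enc_pairOf, enc_pairOf] at hr
    refine ⟨t, τ, hr, ?_, ?_, fun k hk => ((hd k hk).trans (hq _)).trans ?_⟩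
    · rw [ht]
      exact ((isLift_lifted x).nodup m hm).map enc_mat_injective
    · rw [ht, hS]
    · rw [Polynomial.eval_comp]
      refine eval_mono q ?_
      have e1 := sz_pairOf_le x
      have e2 := sz_pairOf_le (reduced x)
      have e3 := sz_mat_le (reduced x).n (look m)
      rw [← hm.wf] at e3
      have e4 : (reduced x).n ≤ enumMatchingMulticut.length (reduced x) := by
        have := length_lt_sz (adjMat (reduced x))
        rw [length_adjMat] at this
        rw [length_eq_sz, sz_mk]
        omega
      rw [sz_mk (pairOf x), sz_mk (pairOf (reduced x))]
      simp only [Polynomial.eval_add, Polynomial.eval_mul, Polynomial.eval_X,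
        Polynomial.eval_ofNat, Polynomial.eval_one]
      generalize hN : enumMatchingMulticut.length x + enumMatchingMulticut.length (reduced x) +
          enumMatchingMulticut.param x + enumMatchingMulticut.param (reduced x) = N
      have e5 : (reduced x).n ≤ N := by omega
      have e6 : (reduced x).n * (2 + 4 * (reduced x).n) ≤ N * (2 + 4 * N) := by gcongr
      omega

end EnumKernel

/-- Enum Matching Multicut, parameterized by the vertex-deletion distance `k` to co-cluster, admits
a polynomial-delay enumeration kernel with `O(k²)` vertices. -/
theorem mainTheorem6 :
    ∃ (A A' : EnumKernel.Prog)
      (red : EnumKernel.MulticutInstance → EnumKernel.MulticutInstance) (C : ℕ),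
      EnumKernel.IsPDEKernel EnumKernel.enumMatchingMulticut A A' red ∧
      ∀ x : EnumKernel.MulticutInstance,
        (red x).n ≤ C * (EnumKernel.coClusterDist x.graph ^ 2 + 1) := by
  obtain ⟨A, hA⟩ := EnumKernel.compress_spec
  obtain ⟨A', hA'⟩ := EnumKernel.lift_spec
  exact ⟨A, A', EnumKernel.reduced, 33, ⟨hA, EnumKernel.reduced_bounded, hA'⟩,
    EnumKernel.n_reduced_le⟩
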